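/- "Space" means compactly generated topological space (no separation axiom is assumed); products, colimits and mapping spaces are formed in this category. Let $\Delta_+$ be the category of finite totally ordered sets (including $\emptyset$) and order-preserving maps. An augmented cosimplicial space is a functor $X^\bullet$ from $\Delta_+$ to spaces; write $X^S$ for its value at $S$. For $k\ge 0$ let $\bar k=\{1,\dots,k\}$, let $\mathcal Q_k$ be the category of pairs $(f,T)$ with $T\in\Delta_+$ and $f:T\to\bar k$ a map of sets (morphisms: order-preserving maps over $\bar k$), and let $\Xi_k(X_1^\bullet,\dots,X_k^\bullet)$ be the left Kan extension of the functor $(f,T)\mapsto\prod_{i}X_i^{f^{-1}(i)}$ along $\mathcal Q_k\to\Delta_+$, $(f,T)\mapsto T$. Thus $\Xi_k(X_1^\bullet,\dots,X_k^\bullet)^S$ is the colimit of $\prod_i X_i^{f^{-1}(i)}$ over the diagrams $\bar k\xleftarrow{f}T\xrightarrow{h}S$ with $h$ order-preserving. There is a canonical isomorphism $\Xi_1(X^\bullet)\cong X^\bullet$. The functors $\Xi_k$ have the structure maps $$\sigma_*:\Xi_k(X_1^\bullet,\dots,X_k^\bullet)\to\Xi_k(X_{\sigma(1)}^\bullet,\dots,X_{\sigma(k)}^\bullet),\qquad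 (f,T,h;(x_i)_i)\mapsto(\sigma^{-1}\circ f,T,h;(x_{\sigma(i)})_i)$$ for $\sigma\in\Sigma_k$, and $$\Gamma:\Xi_k\bigl(\Xi_{j_1}(X_1^\bullet,\dots),\dots,\Xi_{j_k}(\dots,X_{j_1+\dots+j_k}^\bullet)\bigr)\to\Xi_{j_1+\dots+j_k}(X_1^\bullet,\dots,X_{j_1+\dots+j_k}^\bullet).$$ The map $\Gamma$ sends the point given by $\bar k\xleftarrow{f}T\xrightarrow{h}S$ and by the points of $\Xi_{j_i}(\dots)^{f^{-1}(i)}$ represented by $\bar\jmath_i\xleftarrow{f_i}T_i\xrightarrow{h_i}f^{-1}(i)$ to the point represented by $\overline{j_1+\dots+j_k}\cong\coprod_i\bar\jmath_i\leftarrow\coprod_iT_i\to T\to S$, where $\coprod_iT_i$ has the unique total order for which the map to $T$ and the inclusions of the $T_i$ are order-preserving. The maps $\Gamma$ are isomorphisms, and $\boxtimes=\Xi_2$ is a symmetric monoidal product with unit $\Xi_0$, whose associativity, unit and symmetry isomorphisms are the ones given by $\Gamma$ and $\sigma_*$. A $\Xi$-algebra is an augmented cosimplicial space $X^\bullet$ with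 maps $\Theta_k:\Xi_k(X^\bullet,\dots,X^\bullet)\to X^\bullet$, $k\ge0$, such that $\Theta_1$ is the canonical isomorphism $\Xi_1(X^\bullet)\cong X^\bullet$, $\Theta_k\circ\Xi_k(\Theta_{j_1},\dots,\Theta_{j_k})=\Theta_{j_1+\dots+j_k}\circ\Gamma$ for all $j_1,\dots,j_k\geq 0$, and $\Theta_k\circ\sigma_*=\Theta_k$ for all $\sigma\in\Sigma_k$. Let $\Delta^\bullet$ be the augmented cosimplicial space with $\Delta^S$ the simplex with vertex set $S$ (so $\Delta^\emptyset=\emptyset$), and let $\mathrm{Tot}(X^\bullet)=\mathrm{Hom}(\Delta^\bullet,X^\bullet)$ be the space of maps of augmented cosimplicial spaces. Put $\mathcal D(k)=\mathrm{Tot}(\Xi_k(\Delta^\bullet,\dots,\Delta^\bullet))$, with $\sigma\in\Sigma_k$ acting on the right by $\varphi\mapsto\sigma_*\circ\varphi$, with unit the canonical isomorphism $\Delta^\bullet\cong\Xi_1(\Delta^\bullet)$ in $\mathcal D(1)$, and with composition $\gamma(\varphi;\psi_1,\dots,\psi_k)=\Gamma\circ\Xi_k(\psi_1,\dots,\psi_k)\circ\varphi$.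 **Theorem.** (a) $\mathcal D$ is an $E_\infty$ operad: with these structure maps it is a symmetric operad of spaces, $\mathcal D(0)$ is a point, every $\mathcal D(k)$ is contractible, and $\Sigma_k$ acts freely on $\mathcal D(k)$. (b) If $X^\bullet$ is a $\Xi$-algebra, then the maps $$\theta_k:\mathcal D(k)\times\mathrm{Tot}(X^\bullet)^k\to\mathrm{Tot}(X^\bullet),\qquad\theta_k(\varphi;x_1,\dots,x_k)=\Theta_k\circ\Xi_k(x_1,\dots,x_k)\circ\varphi,$$ are an action of the operad $\mathcal D$ on $\mathrm{Tot}(X^\bullet)$. Moreover a $\Xi$-algebra structure on $X^\bullet$ is the same thing as a structure of commutative monoid with respect to $\boxtimes$: for each $\Xi$-algebra structure $(\Theta_k)$ the maps $\Theta_0:\Xi_0\to X^\bullet$ and $\Theta_2:X^\bullet\boxtimes X^\bullet\to X^\bullet$ are the unit and the product of a commutative monoid, and each commutative monoid structure arises in this way from exactly one $\Xi$-algebra structure. In particular $\mathcal D$ acts on $\mathrm{Tot}(X^\bullet)$ for every commutative $\boxtimes$-monoid $X^\bullet$. -/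

import Mathlib

noncomputable section

open CategoryTheory Topology

universe u v

namespace CosimpOperad

/-! ### Compactly generated spaces -/

/-- The family of all compact Hausdorff spaces. -/
abbrev CH (K : CompHaus.{0}) : Type := K

/-- The category of compactly generated spaces (no separation axiom): topological spaces whose
topology is determined by the continuous maps from compact Hausdorff spaces. -/
abbrev CGTop := GeneratedByTopCat.{0} CH

/-- The underlying set of `Y` with its compactly generated topology (`k`-ification). -/
abbrev Kify (Y : Type u) [TopologicalSpace Y] : Type u := WithGeneratedByTopology CH Y

/-- Continuity on the compactly generated refinement of the source. For `Y` a product of compactly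
generated spaces this is continuity on the product formed in compactly generated spaces. -/
abbrev KCont {Y : Type u} {Z : Type v} [TopologicalSpace Y] [TopologicalSpace Z] (g : Y → Z) : Prop :=
  ContinuousGeneratedBy CH g

instance isGeneratedBy_of_compact (Y : Type) [TopologicalSpace Y] [CompactSpace Y] [T2Space Y] :
    IsGeneratedBy CH Y :=
  inferInstanceAs (IsGeneratedBy CH (CH (CompHaus.of Y)))

theorem KCont.continuous {Y Z : Type} [TopologicalSpace Y] [TopologicalSpace Z]
    [IsGeneratedBy CH Y] {g : Y → Z} (hg : KCont g) : Continuous g :=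
  (IsGeneratedBy.continuous_iff CH g).2 hg

theorem kcont_iff_kify {Y Z : Type} [TopologicalSpace Y] [TopologicalSpace Z] (g : Y → Z) :
    KCont g ↔ Continuous (fun y : Kify Y => g (WithGeneratedByTopology.equiv y)) := by
  rw [WithGeneratedByTopology.continuous_from_iff]
  rfl

theorem kcont_pi {Y : Type} [TopologicalSpace Y] {I : Type} {Z : I → Type}
    [∀ i, TopologicalSpace (Z i)] {g : Y → ∀ i, Z i} (hg : ∀ i, KCont (fun y => g y i)) :
    KCont g := fun _ p => continuous_pi fun i => hg i p

instance (K L : CompHaus.{0}) : IsGeneratedBy CH (CH K × CH L) :=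
  isGeneratedBy_of_compact (CH K × CH L)

theorem locallyCompact_of_compact (Y : Type) [TopologicalSpace Y] [CompactSpace Y] [T2Space Y] :
    LocallyCompactSpace Y := inferInstance

instance (K : CompHaus.{0}) : LocallyCompactSpace (CH K) := locallyCompact_of_compact (CH K)

/-- A family of maps `q a : B a → Q` which is jointly a quotient map. -/
structure IsJointQuotient {A : Type} {B : A → Type} {Q : Type} [∀ a, TopologicalSpace (B a)]
    [TopologicalSpace Q] (q : ∀ a, B a → Q) : Prop where
  surj : ∀ y, ∃ a b, q a b = y
  desc : ∀ (Z : Type) [TopologicalSpace Z] (g : Q → Z), (∀ a, KCont (g ∘ q a)) → KCont g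

theorem IsJointQuotient.prod {A A' : Type} {B : A → Type} {B' : A' → Type} {Q Q' : Type}
    [∀ a, TopologicalSpace (B a)] [TopologicalSpace Q]
    [∀ a, TopologicalSpace (B' a)] [TopologicalSpace Q']
    {q : ∀ a, B a → Q} {q' : ∀ a, B' a → Q'}
    (hq : IsJointQuotient q) (hq' : IsJointQuotient q') :
    IsJointQuotient (fun (a : A × A') (p : B a.1 × B' a.2) => (q a.1 p.1, q' a.2 p.2)) where
  surj := by
    rintro ⟨y, y'⟩
    obtain ⟨a, b, rfl⟩ := hq.surj y
    obtain ⟨a', b', rfl⟩ := hq'.surj y'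
    exact ⟨(a, a'), (b, b'), rfl⟩
  desc Z _ g h := by
    have slice : ∀ (a : A) (y' : Q'), KCont (fun b : B a => g (q a b, y')) := by
      intro a y'
      obtain ⟨a', b', rfl⟩ := hq'.surj y'
      exact (h (a, a')).comp (f := fun b : B a => (b, b'))
        (by fun_prop : Continuous fun b : B a => (b, b')).continuousGeneratedBy
    have h1 : ∀ a, KCont (fun p : B a × Q' => g (q a p.1, p.2)) := by
      intro a
      have hG : KCont (fun y' : Q' =>
          (⟨fun b => g (q a b, y'), slice a y'⟩ : ContinuousMapGeneratedBy CH (B a) Z)) :=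
        hq'.desc _ _ fun a' => (ContinuousMapGeneratedBy.curryEquiv ⟨_, h (a, a')⟩).prop
      exact (ContinuousMapGeneratedBy.curryEquiv.symm ⟨_, hG⟩).prop
    have slice' : ∀ y : Q, KCont (fun y' : Q' => g (y, y')) := by
      intro y
      obtain ⟨a, b, rfl⟩ := hq.surj y
      exact (h1 a).comp (f := fun y' : Q' => (b, y'))
        (by fun_prop : Continuous fun y' : Q' => (b, y')).continuousGeneratedBy
    have h2 : ∀ a, KCont (fun p : Q' × B a => g (q a p.2, p.1)) := fun a =>
      (h1 a).comp (f := fun p : Q' × B a => (p.2, p.1))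
        (by fun_prop : Continuous fun p : Q' × B a => (p.2, p.1)).continuousGeneratedBy
    have hH : KCont (fun y : Q =>
        (⟨fun y' => g (y, y'), slice' y⟩ : ContinuousMapGeneratedBy CH Q' Z)) :=
      hq.desc _ _ fun a => (ContinuousMapGeneratedBy.curryEquiv ⟨_, h2 a⟩).prop
    have h3 := (ContinuousMapGeneratedBy.curryEquiv.symm ⟨_, hH⟩).prop
    exact ContinuousGeneratedBy.comp h3 (f := fun p : Q × Q' => (p.2, p.1))
      (by fun_prop : Continuous fun p : Q × Q' => (p.2, p.1)).continuousGeneratedBy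

/-- Finite products of joint quotient maps of compactly generated spaces are joint quotient
maps. -/
theorem IsJointQuotient.pi (I : Type) [Finite I] :
    ∀ {A : I → Type} {B : ∀ i, A i → Type} {Q : I → Type}
      [∀ i a, TopologicalSpace (B i a)] [∀ i, TopologicalSpace (Q i)]
      {q : ∀ i a, B i a → Q i}, (∀ i, IsJointQuotient (q i)) →
      IsJointQuotient (fun (a : ∀ i, A i) (b : ∀ i, B i (a i)) i => q i (a i) (b i)) := by
  refine Finite.induction_empty_option (P := fun I => ∀ {A : I → Type} {B : ∀ i, A i → Type}
      {Q : I → Type} [∀ i a, TopologicalSpace (B i a)] [∀ i, TopologicalSpace (Q i)]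
      {q : ∀ i a, B i a → Q i}, (∀ i, IsJointQuotient (q i)) →
      IsJointQuotient (fun (a : ∀ i, A i) (b : ∀ i, B i (a i)) i => q i (a i) (b i)))
      ?_ ?_ ?_ I
  · intro I J e ih A B Q _ _ q hq
    have := ih (A := fun i => A (e i)) (B := fun i => B (e i)) (Q := fun i => Q (e i))
      (q := fun i => q (e i)) (fun i => hq (e i))
    refine ⟨fun y => ?_, fun Z _ g h => ?_⟩
    · choose a b hab using fun i => (hq i).surj (y i)
      exact ⟨a, b, funext hab⟩
    · have h4 : KCont (fun y : ∀ i, Q (e i) => g (Homeomorph.piCongrLeft (Y := Q) e y)) := by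
        refine this.desc Z _ fun a' => ?_
        obtain ⟨a, rfl⟩ : ∃ a : ∀ j, A j, (fun i => a (e i)) = a' :=
          ⟨Equiv.piCongrLeft A e a', funext fun i => Equiv.piCongrLeft_apply_apply A e a' i⟩
        convert (h a).comp (Homeomorph.piCongrLeft (Y := fun j => B j (a j))
          e).continuous.continuousGeneratedBy using 2
        funext b
        refine congrArg g (funext fun j => ?_)
        obtain ⟨i, rfl⟩ := e.surjective j
        exact (Equiv.piCongrLeft_apply_apply Q e _ i).trans
          (congrArg _ (Equiv.piCongrLeft_apply_apply (fun j => B j (a j)) e b i).symm)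
      convert h4.comp (Homeomorph.piCongrLeft (Y := Q) e).symm.continuous.continuousGeneratedBy
        using 2
      funext y
      exact congrArg g ((Homeomorph.piCongrLeft (Y := Q) e).apply_symm_apply y).symm
  · intro A B Q _ _ q hq
    refine ⟨fun y => ⟨fun i => i.elim, fun i => i.elim, funext fun i => i.elim⟩,
      fun Z _ g h i p => ?_⟩
    exact continuous_of_const fun x y => congrArg g (funext fun i => i.elim)
  · intro I _ ih A B Q _ _ q hq
    have := (hq none).prod (ih (A := fun i => A (some i)) (B := fun i => B (some i))
      (Q := fun i => Q (some i)) (q := fun i => q (some i)) (fun i => hq (some i)))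
    refine ⟨fun y => ?_, fun Z _ g h => ?_⟩
    · choose a b hab using fun i => (hq i).surj (y i)
      exact ⟨a, b, funext hab⟩
    · have hc : Continuous (fun (y : Q none × ∀ i, Q (some i)) (i : Option I) =>
          (match i with
            | none => y.1
            | some i => y.2 i : Q i)) := by
        refine continuous_pi fun i => ?_
        cases i with
        | none => exact continuous_fst
        | some i => exact (continuous_apply i).comp continuous_snd
      have h4 := this.desc Z (fun y => g fun i => (match i with
            | none => y.1
            | some i => y.2 i : Q i)) fun a => by
        have hb : Continuous (fun (y : B none a.1 × ∀ i, B (some i) (a.2 i)) (i : Option I) =>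
          (match i with
            | none => y.1
            | some i => y.2 i : B i (match i with
              | none => a.1
              | some i => a.2 i : A i))) := by
          refine continuous_pi fun i => ?_
          cases i with
          | none => exact continuous_fst
          | some i => exact (continuous_apply i).comp continuous_snd
        convert (h fun i => (match i with
              | none => a.1
              | some i => a.2 i : A i)).comp hb.continuousGeneratedBy using 2
        funext y
        refine congrArg g (funext fun i => ?_)
        cases i <;> rfl
      convert h4.comp (f := fun y : ∀ i, Q i => (y none, fun i => y (some i)))
        (by fun_prop : Continuous fun y : ∀ i, Q i =>
          (y none, fun i => y (some i))).continuousGeneratedBy using 2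
      funext y
      refine congrArg g (funext fun i => ?_)
      cases i <;> rfl

/-! ### Finite totally ordered sets and augmented cosimplicial spaces -/

/-- The category `Δ₊` of finite totally ordered sets (including the empty one) and
order-preserving maps. -/
structure FinLinOrd where
  carrier : Type
  [order : LinearOrder carrier]
  [finite : Finite carrier]

namespace FinLinOrd

instance : CoeSort FinLinOrd Type := ⟨carrier⟩

attribute [instance] order finite

instance : Category FinLinOrd where
  Hom S T := S →o T
  id _ := OrderHom.id
  comp f g := OrderHom.comp g f

/-- The finite totally ordered set `{0, …, n - 1}`. -/
abbrev fin (n : ℕ) : FinLinOrd := ⟨Fin n⟩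

instance (S : FinLinOrd) : Fintype S := Fintype.ofFinite S

/-- The fibre `f⁻¹(i)`, with the induced order. -/
abbrev fiber {K : Type} {T : FinLinOrd} (f : T → K) (i : K) : FinLinOrd := ⟨{t : T // f t = i}⟩

/-- The map induced on fibres by an order-preserving map over `K`. -/
abbrev fiberMap {K : Type} {T T' : FinLinOrd} {f : T → K} {f' : T' → K} (g : T →o T')
    (hg : ∀ t, f' (g t) = f t) (i : K) : fiber f i →o fiber f' i :=
  ⟨fun t => ⟨g t.1, (hg t.1).trans t.2⟩, fun _ _ h => g.monotone h⟩

end FinLinOrd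

open FinLinOrd

/-- Augmented cosimplicial spaces. -/
abbrev AugCosimp := FinLinOrd ⥤ CGTop

/-- The structure map of an augmented cosimplicial space, as a continuous map. -/
def ap (X : AugCosimp) {S T : FinLinOrd} (g : S →o T) : C(X.obj S, X.obj T) := (X.map g).hom.hom

/-- The component of a map of augmented cosimplicial spaces, as a continuous map. -/
def compAt {X Y : AugCosimp} (φ : X ⟶ Y) (S : FinLinOrd) : C(X.obj S, Y.obj S) := (φ.app S).hom.hom

theorem ap_id (X : AugCosimp) {S : FinLinOrd} (x : X.obj S) : ap X OrderHom.id x = x :=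
  congrArg (fun φ => φ.hom.hom x) (X.map_id S)

theorem ap_ap (X : AugCosimp) {S T U : FinLinOrd} (g : S →o T) (h : T →o U) (x : X.obj S) :
    ap X h (ap X g x) = ap X (h.comp g) x :=
  (congrArg (fun φ => φ.hom.hom x) (X.map_comp (X := S) (Y := T) (Z := U) g h)).symm

theorem compAt_ap {X Y : AugCosimp} (φ : X ⟶ Y) {S T : FinLinOrd} (g : S →o T) (x : X.obj S) :
    compAt φ T (ap X g x) = ap Y g (compAt φ S x) :=
  congrArg (fun φ => φ.hom.hom x) (φ.naturality (X := S) (Y := T) g)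

/-- Constructor for augmented cosimplicial spaces. -/
def mkAug (obj : FinLinOrd → CGTop) (map : ∀ {S T : FinLinOrd}, (S →o T) → C(obj S, obj T))
    (map_id : ∀ S (x : obj S), map (OrderHom.id : S →o S) x = x)
    (map_comp : ∀ {S T U : FinLinOrd} (g : S →o T) (h : T →o U) (x : obj S),
      map (h.comp g) x = map h (map g x)) : AugCosimp where
  obj := obj
  map g := ⟨TopCat.ofHom (map g)⟩
  map_id S := by
    ext x
    exact map_id S x
  map_comp g h := by
    ext x
    exact map_comp g h x

/-- Constructor for maps of augmented cosimplicial spaces. -/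
def mkHom {X Y : AugCosimp} (app : ∀ S : FinLinOrd, C(X.obj S, Y.obj S))
    (naturality : ∀ {S T : FinLinOrd} (g : S →o T) (x : X.obj S),
      app T (ap X g x) = ap Y g (app S x)) : X ⟶ Y where
  app S := ⟨TopCat.ofHom (app S)⟩
  naturality S T g := by
    ext x
    exact naturality g x

theorem compAt_mkHom {X Y : AugCosimp} (app : ∀ S : FinLinOrd, C(X.obj S, Y.obj S)) (hn)
    (S : FinLinOrd) (x : X.obj S) : compAt (mkHom app hn) S x = app S x := rfl

theorem hom_ext {X Y : AugCosimp} {φ ψ : X ⟶ Y} (h : ∀ S x, compAt φ S x = compAt ψ S x) : φ = ψ := by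
  ext S x
  exact h S x

/-! ### The functors `Ξ_K` -/

section Xi

variable {K : Type} (X : K → AugCosimp)

/-- A diagram `K ← T → S` with `T = {0, …, n - 1}` and `T → S` order-preserving. -/
structure XiIndex (K : Type) (S : FinLinOrd) where
  n : ℕ
  f : fin n → K
  h : fin n →o S

/-- The product `∏ i, X_i^{f⁻¹(i)}` of compactly generated spaces. -/
abbrev XiProd {T : FinLinOrd} (f : T → K) : Type := Kify (∀ i, (X i).obj (fiber f i))

/-- The map of products induced by an order-preserving map over `K`. -/
def XiProd.map {T T' : FinLinOrd} {f : T → K} {f' : T' → K} (g : T →o T')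
    (hg : ∀ t, f' (g t) = f t) (x : XiProd X f) : XiProd X f' :=
  WithGeneratedByTopology.equiv.symm fun i =>
    ap (X i) (fiberMap g hg i) (WithGeneratedByTopology.equiv x i)

/-- The relation on `∐ ∏ i, X_i^{f⁻¹(i)}` (coproduct over the diagrams `K ← T → S`) that defines
the colimit over the category of these diagrams. -/
def XiRel (S : FinLinOrd) (p q : Σ a : XiIndex K S, XiProd X a.f) : Prop :=
  ∃ (g : fin p.1.n →o fin q.1.n) (hf : ∀ t, q.1.f (g t) = p.1.f t),
    (∀ t, q.1.h (g t) = p.1.h t) ∧ q.2 = XiProd.map X g hf p.2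

/-- The space `Ξ_K(X)^S`: the colimit of `∏ i, X_i^{f⁻¹(i)}` over the category of diagrams
`K ← T → S`. As every finite totally ordered set is uniquely isomorphic to some `{0, …, n - 1}`,
the diagrams with `T` of this form are enough. -/
def xiObj (S : FinLinOrd) : CGTop := GeneratedByTopCat.of (Quot (XiRel X S))

/-- The map `Ξ_K(X)^S → Ξ_K(X)^{S'}` induced by `g : S → S'`: compose `T → S` with `g`. -/
def xiMap {S S' : FinLinOrd} (g : S →o S') : C(xiObj X S, xiObj X S') where
  toFun := Quot.map (fun p => ⟨⟨p.1.n, p.1.f, g.comp p.1.h⟩, p.2⟩)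
    (fun _ _ ⟨u, hf, hh, hx⟩ => ⟨u, hf, fun t => congrArg g (hh t), hx⟩)
  continuous_toFun := by
    refine continuous_quot_lift _ (continuous_quot_mk.comp (continuous_sigma fun a => ?_))
    exact continuous_sigmaMk (σ := fun a : XiIndex K S' => XiProd X a.f)
      (i := ⟨a.n, a.f, g.comp a.h⟩)

/-- The augmented cosimplicial space `Ξ_K(X)`: the left Kan extension, along `(f, T) ↦ T`, of
`(f, T) ↦ ∏ i, X_i^{f⁻¹(i)}`, where `T` is a finite totally ordered set and `f : T → K`. -/
def Xi : AugCosimp :=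
  mkAug (xiObj X) (xiMap X) (fun S x => by induction x using Quot.ind; rfl)
    (fun g h x => by induction x using Quot.ind; rfl)

variable {X}

/-- The increasing enumeration of a finite totally ordered set. -/
def enum (T : FinLinOrd) : Fin (Fintype.card T) ≃o T := monoEquivOfFin T rfl

/-- The increasing enumeration as an order-preserving map. -/
def enumHom (T : FinLinOrd) : fin (Fintype.card T) →o T := ⟨enum T, (enum T).monotone⟩

/-- The inverse of the increasing enumeration. -/
def enumInv (T : FinLinOrd) : T →o fin (Fintype.card T) := ⟨(enum T).symm, (enum T).symm.monotone⟩

theorem enumHom_enumInv (T : FinLinOrd) (t : T) : enumHom T (enumInv T t) = t :=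
  (enum T).apply_symm_apply t

/-- The point of `Ξ_K(X)^S` represented by a diagram `K ← T → S` and `x ∈ ∏ i, X_i^{f⁻¹(i)}`. -/
def Xi.mk {S T : FinLinOrd} (f : T → K) (h : T →o S) (x : ∀ i, (X i).obj (fiber f i)) :
    (Xi X).obj S :=
  Quot.mk (XiRel X S) ⟨⟨Fintype.card T, f ∘ enumHom T, h.comp (enumHom T)⟩,
    XiProd.map X (f' := f ∘ enumHom T) (enumInv T)
      (fun t => congrArg f (enumHom_enumInv T t)) (WithGeneratedByTopology.equiv.symm x)⟩

theorem Xi.ap_mk {S S' T : FinLinOrd} (f : T → K) (h : T →o S) (g : S →o S')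
    (x : ∀ i, (X i).obj (fiber f i)) : ap (Xi X) g (Xi.mk f h x) = Xi.mk f (g.comp h) x := rfl

theorem XiProd.map_map {T T' T'' : FinLinOrd} {f : T → K} {f' : T' → K} {f'' : T'' → K}
    (g : T →o T') (hg : ∀ t, f' (g t) = f t) (g' : T' →o T'') (hg' : ∀ t, f'' (g' t) = f' t)
    (x : XiProd X f) : XiProd.map X g' hg' (XiProd.map X g hg x) =
      XiProd.map X (g'.comp g) (fun t => (hg' (g t)).trans (hg t)) x :=
  funext fun i => ap_ap (X i) _ _ _

theorem XiProd.continuous_map {T T' : FinLinOrd} {f : T → K} {f' : T' → K} (g : T →o T')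
    (hg : ∀ t, f' (g t) = f t) : Continuous (XiProd.map X g hg) := by
  refine (IsGeneratedBy.equiv_symm_comp_continuous_iff CH _).2 (continuous_pi fun i => ?_)
  exact (ap (X i) _).continuous.comp
    ((continuous_apply i).comp WithGeneratedByTopology.continuous_equiv)

theorem Xi.continuous_mk {S T : FinLinOrd} (f : T → K) (h : T →o S) :
    KCont (Xi.mk (X := X) f h) := by
  rw [kcont_iff_kify]
  refine continuous_quot_mk.comp ?_
  exact (continuous_sigmaMk (σ := fun a : XiIndex K S => XiProd X a.f)
    (i := ⟨Fintype.card T, f ∘ enumHom T, h.comp (enumHom T)⟩)).comp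
      (XiProd.continuous_map _ _)

theorem Xi.mk_eq {S T T' : FinLinOrd} {f : T → K} {h : T →o S} {f' : T' → K} {h' : T' →o S}
    (g : T →o T') (hf : ∀ t, f' (g t) = f t) (hh : ∀ t, h' (g t) = h t)
    (x : ∀ i, (X i).obj (fiber f i)) :
    Xi.mk f h x = Xi.mk f' h' (fun i => ap (X i) (fiberMap g hf i) (x i)) := by
  refine Quot.sound ⟨(enumInv T').comp (g.comp (enumHom T)),
    fun t => ?_, fun t => ?_, ?_⟩
  · exact (congrArg f' (enumHom_enumInv T' _)).trans (hf _)
  · exact (congrArg h' (enumHom_enumInv T' _)).trans (hh _)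
  · refine (XiProd.map_map (X := X) (f'' := f' ∘ enumHom T') g hf _ _ _).trans ?_
    refine Eq.trans ?_ (XiProd.map_map (X := X) _ _ _ _ _).symm
    congr 1
    ext t
    exact congrArg (fun s => (enumInv T' (g s)).1) (enumHom_enumInv T t).symm

theorem Xi.quot_mk_eq {S : FinLinOrd} (a : XiIndex K S) (x : XiProd X a.f) :
    (Quot.mk (XiRel X S) ⟨a, x⟩ : (Xi X).obj S) =
      Xi.mk a.f a.h (WithGeneratedByTopology.equiv x) := by
  refine Quot.sound ⟨enumInv (fin a.n), fun t => ?_, fun t => ?_, rfl⟩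
  · exact congrArg a.f (enumHom_enumInv (fin a.n) t)
  · exact congrArg a.h (enumHom_enumInv (fin a.n) t)

/-- Every point of `Ξ_K(X)^S` is represented by a diagram. -/
theorem Xi.ind {S : FinLinOrd} {P : (Xi X).obj S → Prop}
    (H : ∀ (T : FinLinOrd) (f : T → K) (h : T →o S) (x : ∀ i, (X i).obj (fiber f i)),
      P (Xi.mk f h x)) (w : (Xi X).obj S) : P w := by
  induction w using Quot.ind with
  | mk p =>
    obtain ⟨a, x⟩ := p
    rw [Xi.quot_mk_eq]
    exact H _ _ _ _

theorem Xi.isJointQuotient (S : FinLinOrd) :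
    IsJointQuotient (fun (a : XiIndex K S) (x : XiProd X a.f) =>
      (Quot.mk (XiRel X S) ⟨a, x⟩ : (Xi X).obj S)) where
  surj y := by
    induction y using Quot.ind with
    | mk p => exact ⟨p.1, p.2, rfl⟩
  desc Z _ g hg := by
    refine Continuous.continuousGeneratedBy ?_
    refine continuous_coinduced_dom.2 (continuous_sigma fun a => ?_)
    exact (hg a).continuous

/-- The universal property of `Ξ_K(X)` as a left Kan extension: a map `Ξ_K(X) → Y` is given by
maps `∏ i, X_i^{f⁻¹(i)} → Y^T`, one for each `f : T → K`, which are compatible with the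
order-preserving maps over `K`. -/
def Xi.desc {Y : AugCosimp}
    (F : ∀ {T : FinLinOrd} (f : T → K), (∀ i, (X i).obj (fiber f i)) → Y.obj T)
    (hF : ∀ {T : FinLinOrd} (f : T → K), KCont (F f))
    (nat : ∀ {T T' : FinLinOrd} (f : T → K) (f' : T' → K) (g : T →o T')
      (hg : ∀ t, f' (g t) = f t) (x : ∀ i, (X i).obj (fiber f i)),
      ap Y g (F f x) = F f' (fun i => ap (X i) (fiberMap g hg i) (x i))) : Xi X ⟶ Y :=
  mkHom (fun S =>
    { toFun := Quot.lift
        (fun p => ap Y p.1.h (F p.1.f (WithGeneratedByTopology.equiv p.2))) (by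
          rintro ⟨a, x⟩ ⟨b, y⟩ ⟨g, hf, hh, hx⟩
          refine Eq.trans ?_ (congrArg
            (fun z => ap Y b.h (F b.f (WithGeneratedByTopology.equiv z))) hx.symm)
          refine Eq.trans ?_ (congrArg (ap Y b.h) (nat a.f b.f g hf _))
          rw [ap_ap]
          congr 2
          ext t
          exact (hh t).symm)
      continuous_toFun := by
        refine continuous_quot_lift _ (continuous_sigma fun a => ?_)
        exact (ap Y a.h).continuous.comp ((kcont_iff_kify _).1 (hF a.f)) })
    (fun {S S'} g x => by
      induction x using Quot.ind with
      | mk p => exact (ap_ap Y _ _ _).symm)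

theorem Xi.desc_mk {Y : AugCosimp} (F) (hF) (nat) {S T : FinLinOrd} (f : T → K) (h : T →o S)
    (x : ∀ i, (X i).obj (fiber f i)) :
    compAt (Xi.desc (X := X) (Y := Y) F hF nat) S (Xi.mk f h x) = ap Y h (F f x) := by
  refine Eq.trans (congrArg (ap Y _) (nat f (f ∘ enumHom T) (enumInv T) _ x).symm) ?_
  refine (ap_ap Y _ _ _).trans ?_
  congr 2
  ext t
  exact congrArg h (enumHom_enumInv T t)

theorem Xi.hom_ext {Y : AugCosimp} {φ ψ : Xi X ⟶ Y}
    (H : ∀ (T : FinLinOrd) (f : T → K) (x : ∀ i, (X i).obj (fiber f i)),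
      compAt φ T (Xi.mk f OrderHom.id x) = compAt ψ T (Xi.mk f OrderHom.id x)) : φ = ψ := by
  refine CosimpOperad.hom_ext fun S w => ?_
  induction w using Xi.ind with
  | H T f h x =>
    have := congrArg (ap Y h) (H T f x)
    rwa [← compAt_ap, ← compAt_ap] at this

/-- Functoriality of `Ξ_K`. -/
def Xi.map {Y : K → AugCosimp} (φ : ∀ i, X i ⟶ Y i) : Xi X ⟶ Xi Y :=
  Xi.desc (fun f x => Xi.mk f OrderHom.id fun i => compAt (φ i) _ (x i))
    (fun f => (Xi.continuous_mk f OrderHom.id).comp (Continuous.continuousGeneratedBy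
      (continuous_pi fun i => (compAt (φ i) _).continuous.comp (continuous_apply i))))
    (fun f f' g hg x => by
      refine (Xi.mk_eq (f' := f') (h' := OrderHom.id) g hg (fun _ => rfl) _).trans ?_
      simp only [compAt_ap])

/-- The isomorphism `Ξ_K(X) → Ξ_L(X ∘ e⁻¹)` induced by a bijection `e : K → L`: it takes the point
represented by `K ← T → S` and `(x_i)` to the point represented by `L ← K ← T → S` and
`(x_{e⁻¹(l)})`. For a permutation `σ` of `K = {1, …, k}` the map
`σ_* : Ξ_k(X_1, …, X_k) → Ξ_k(X_{σ(1)}, …, X_{σ(k)})` is the case `e = σ⁻¹`. -/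
def Xi.reindex {L : Type} (e : K ≃ L) (X : K → AugCosimp) : Xi X ⟶ Xi (fun l => X (e.symm l)) :=
  Xi.desc (fun {T} f x => Xi.mk (fun t => e (f t)) OrderHom.id fun l =>
      ap (X (e.symm l)) (S := fiber f (e.symm l)) (T := fiber (T := T) (fun t => e (f t)) l)
        ⟨fun t => ⟨t.1, (congrArg e t.2).trans (e.apply_symm_apply l)⟩, fun _ _ h => h⟩ (x (e.symm l)))
    (fun f => (Xi.continuous_mk _ OrderHom.id).comp (Continuous.continuousGeneratedBy
      (continuous_pi fun l => (ContinuousMap.continuous _).comp (continuous_apply (e.symm l)))))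
    (fun f f' g hg x => by
      refine (Xi.mk_eq (f' := fun t => e (f' t)) (h' := OrderHom.id) g
        (fun t => congrArg e (hg t)) (fun _ => rfl) _).trans ?_
      simp only [ap_ap]
      rfl)

/-- The canonical isomorphism `X → Ξ_1(X)`. -/
def Xi.iota (K : Type) [Unique K] (X : AugCosimp) : X ⟶ Xi (fun _ : K => X) :=
  mkHom (fun S =>
    { toFun := fun x => Xi.mk (T := S) (fun _ => default) OrderHom.id fun i =>
        ap X (T := fiber (T := S) (fun _ => default) i)
          ⟨fun t => ⟨t, Subsingleton.elim _ _⟩, fun _ _ h => h⟩ x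
      continuous_toFun := KCont.continuous (ContinuousGeneratedBy.comp
        (Xi.continuous_mk _ OrderHom.id) (Continuous.continuousGeneratedBy
          (continuous_pi fun i => ContinuousMap.continuous _))) })
    (fun {S S'} g x => by
      refine Eq.trans ?_ (Xi.mk_eq (f' := fun _ : S' => (default : K)) (h' := OrderHom.id) g
        (fun _ => rfl) (fun _ => rfl) _).symm
      exact congrArg (Xi.mk _ _) (funext fun i => by rw [ap_ap, ap_ap]; rfl))

/-- The inclusion of a fibre. -/
abbrev fiberIncl {T : FinLinOrd} (f : T → K) (i : K) : fiber f i →o T :=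
  ⟨fun t => t.1, fun _ _ h => h⟩

/-- The canonical isomorphism `Ξ_1(X) → X`, inverse to `Xi.iota`. -/
def Xi.eps (K : Type) [Unique K] (X : AugCosimp) : Xi (fun _ : K => X) ⟶ X :=
  Xi.desc (fun f x => ap X (fiberIncl f default) (x default))
    (fun f => Continuous.continuousGeneratedBy
      ((ap X _).continuous.comp (continuous_apply _)))
    (fun f f' g hg x => by rw [ap_ap, ap_ap]; rfl)

end Xi

/-! ### The structure maps `Γ` -/

section Gamma

variable {K : Type} {J : K → Type} {X : ∀ i, J i → AugCosimp}

/-- The component in `J_i` of `f : T → ∐ J_i`, on the preimage of `J_i`. -/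
def sigmaLabel {T : FinLinOrd} (f : T → Σ i, J i) (i : K) :
    fiber (T := T) (fun t => (f t).1) i → J i := fun t => t.2 ▸ (f t.1).2

theorem sigmaLabel_eq {T : FinLinOrd} (f : T → Σ i, J i) {i : K} {j : J i}
    (t : T) (h : (f t).1 = i) : f t = ⟨i, j⟩ ↔ sigmaLabel f i ⟨t, h⟩ = j := by
  subst h
  constructor
  · intro h
    exact eq_of_heq (Sigma.ext_iff.1 h).2
  · intro h
    exact Sigma.ext rfl (heq_of_eq h)

/-- The fibre of `f : T → ∐ J_i` over `(i, j)`, as a fibre of `sigmaLabel f i`. -/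
def sigmaIncl {T : FinLinOrd} (f : T → Σ i, J i) (i : K) (j : J i) :
    fiber f ⟨i, j⟩ →o fiber (sigmaLabel f i) j :=
  ⟨fun t => ⟨⟨t.1, congrArg Sigma.fst t.2⟩, (sigmaLabel_eq f t.1 _).1 t.2⟩, fun _ _ h => h⟩

/-- The map `Λ`, inverse to `Γ`: it takes the point represented by `f : T → ∐ J_i`, the identity of
`T` and `(x_{ij})` to the point represented by `K ← T → T` and by the points represented by the
restrictions `J_i ← f⁻¹(J_i) → f⁻¹(J_i)` of `f` and `(x_{ij})_j`. -/
def Lambda (X : ∀ i, J i → AugCosimp) :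
    Xi (fun p : Σ i, J i => X p.1 p.2) ⟶ Xi (fun i => Xi (X i)) :=
  Xi.desc (fun {T} f x => Xi.mk (T := T) (fun t => (f t).1) OrderHom.id fun i =>
      Xi.mk (sigmaLabel f i) OrderHom.id fun j => ap (X i j) (sigmaIncl f i j) (x ⟨i, j⟩))
    (fun f => ContinuousGeneratedBy.comp (Xi.continuous_mk _ _) (kcont_pi fun i =>
      ContinuousGeneratedBy.comp (Xi.continuous_mk _ _) (Continuous.continuousGeneratedBy
        (continuous_pi fun j => (ContinuousMap.continuous _).comp (continuous_apply _)))))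
    (fun {T T'} f f' g hg x => by
      refine (Xi.mk_eq (f' := fun t => (f' t).1) (h' := OrderHom.id) g
        (fun t => congrArg Sigma.fst (hg t)) (fun _ => rfl) _).trans ?_
      refine congrArg (Xi.mk _ _) (funext fun i => ?_)
      have hl : ∀ t, sigmaLabel f' i (fiberMap (f' := fun t => (f' t).1) g
          (fun t => congrArg Sigma.fst (hg t)) i t) = sigmaLabel f i t := fun t =>
        (sigmaLabel_eq f' _ _).1 ((hg t.1).trans ((sigmaLabel_eq f _ t.2).2 rfl))
      refine (Xi.mk_eq (f' := sigmaLabel f' i) (h' := OrderHom.id) _ hl (fun _ => rfl) _).trans ?_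
      refine congrArg (Xi.mk _ _) (funext fun j => ?_)
      rw [ap_ap, ap_ap]
      rfl)

/-- The set `∐ T_i` for order-preserving maps `h_i : T_i → f⁻¹(i)`, where `f : T → K`. -/
@[ext]
structure Glue {T : FinLinOrd} {f : T → K} {Ti : K → FinLinOrd} (h : ∀ i, Ti i →o fiber f i) :
    Type where
  fst : K
  snd : Ti fst

namespace Glue

variable {T : FinLinOrd} {f : T → K} {Ti : K → FinLinOrd} {h : ∀ i, Ti i →o fiber f i}

/-- The underlying element of the disjoint union. -/
def toSigma (p : Glue h) : Σ i, Ti i := ⟨p.1, p.2⟩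

theorem toSigma_injective : Function.Injective (toSigma (h := h)) := by
  rintro ⟨i, s⟩ ⟨j, t⟩ hst
  cases hst
  rfl

/-- The map `∐ T_i → T`. -/
def base (p : Glue h) : T := (h p.1 p.2).1

theorem f_base (p : Glue h) : f p.base = p.1 := (h p.1 p.2).2

/-- The unique total order on `∐ T_i` for which the map to `T` and the inclusions of the `T_i` are
order-preserving. -/
instance : LinearOrder (Glue h) where
  le a b := a.base < b.base ∨ a.base = b.base ∧ a.toSigma ≤ b.toSigma
  le_refl a := Or.inr ⟨rfl, le_refl a.toSigma⟩
  le_trans a b c := by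
    rintro (h1 | ⟨h1, h1'⟩) (h2 | ⟨h2, h2'⟩)
    · exact Or.inl (h1.trans h2)
    · exact Or.inl (h2 ▸ h1)
    · exact Or.inl (h1 ▸ h2)
    · exact Or.inr ⟨h1.trans h2, le_trans h1' h2'⟩
  le_antisymm a b := by
    rintro (h1 | ⟨h1, h1'⟩) (h2 | ⟨h2, h2'⟩)
    · exact absurd (h1.trans h2) (lt_irrefl _)
    · exact absurd h1 (h2 ▸ lt_irrefl _)
    · exact absurd h2 (h1 ▸ lt_irrefl _)
    · exact toSigma_injective (le_antisymm h1' h2')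
  le_total a b := by
    rcases lt_trichotomy a.base b.base with h1 | h1 | h1
    · exact Or.inl (Or.inl h1)
    · have h2 : a.1 = b.1 := by rw [← f_base a, ← f_base b, h1]
      obtain ⟨i, s⟩ := a
      obtain ⟨j, t⟩ := b
      obtain rfl : i = j := h2
      rcases le_total s t with h3 | h3
      · exact Or.inl (Or.inr ⟨h1, Sigma.mk_le_mk_iff.2 h3⟩)
      · exact Or.inr (Or.inr ⟨h1.symm, Sigma.mk_le_mk_iff.2 h3⟩)
    · exact Or.inr (Or.inl h1)
  toDecidableLE := Classical.decRel _

theorem mk_le_mk {i : K} {s t : Ti i} : (⟨i, s⟩ : Glue h) ≤ ⟨i, t⟩ ↔ s ≤ t := by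
  constructor
  · rintro (h1 | ⟨_, h1⟩)
    · exact le_of_not_ge fun h2 => absurd h1 (not_lt_of_ge ((h i).monotone h2))
    · exact (Sigma.mk_le_mk_iff (α := fun i => Ti i)).1 h1
  · intro hst
    rcases ((h i).monotone hst).lt_or_eq with h1 | h1
    · exact Or.inl h1
    · exact Or.inr ⟨congrArg Subtype.val h1, Sigma.mk_le_mk_iff.2 hst⟩

theorem base_le {a b : Glue h} (hab : a ≤ b) : a.base ≤ b.base := by
  rcases hab with h1 | ⟨h1, _⟩
  · exact h1.le
  · exact h1.le

theorem le_of_base_le {a b : Glue h} (hne : a.1 ≠ b.1) (hab : a.base ≤ b.base) : a ≤ b := by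
  rcases hab.lt_or_eq with h1 | h1
  · exact Or.inl h1
  · exact absurd (by rw [← f_base a, ← f_base b, h1]) hne

instance [Finite K] : Finite (Glue h) := Finite.of_injective _ (toSigma_injective (h := h))

end Glue

variable [Finite K]

/-- The finite totally ordered set `∐ T_i`. -/
abbrev glue {T : FinLinOrd} {f : T → K} {Ti : K → FinLinOrd} (h : ∀ i, Ti i →o fiber f i) :
    FinLinOrd := ⟨Glue h⟩

/-- The order-preserving map `∐ T_i → T`. -/
def glueBase {T : FinLinOrd} {f : T → K} {Ti : K → FinLinOrd} (h : ∀ i, Ti i →o fiber f i) :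
    glue h →o T := ⟨Glue.base, fun _ _ => Glue.base_le⟩

/-- The map `∐ T_i → ∐ J_i` given by maps `f_i : T_i → J_i`. -/
def glueLabel {T : FinLinOrd} {f : T → K} {Ti : K → FinLinOrd} (h : ∀ i, Ti i →o fiber f i)
    (fi : ∀ i, Ti i → J i) : glue h → Σ i, J i := fun p => ⟨p.1, fi p.1 p.2⟩

/-- The fibre of `f_i` over `j` as the fibre of `∐ T_i → ∐ J_i` over `(i, j)`. -/
def glueIncl {T : FinLinOrd} {f : T → K} {Ti : K → FinLinOrd} (h : ∀ i, Ti i →o fiber f i)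
    (fi : ∀ i, Ti i → J i) (p : Σ i, J i) : fiber (fi p.1) p.2 →o fiber (glueLabel h fi) p :=
  ⟨fun s => ⟨⟨p.1, s.1⟩, Sigma.ext rfl (heq_of_eq s.2)⟩, fun _ _ hst => Glue.mk_le_mk.2 hst⟩

/-- The value of `Γ` at the point represented by `K ← T → T` (the second map being the identity) and
by the points of `Ξ_{J_i}(X_i)^{f⁻¹(i)}` represented by `J_i ← T_i → f⁻¹(i)` and `x_i`: it is
represented by `∐ J_i ← ∐ T_i → T`. -/
def gammaRep {T : FinLinOrd} {f : T → K} {Ti : K → FinLinOrd} (h : ∀ i, Ti i →o fiber f i)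
    (fi : ∀ i, Ti i → J i) (x : ∀ i j, (X i j).obj (fiber (fi i) j)) :
    (Xi (fun p : Σ i, J i => X p.1 p.2)).obj T :=
  Xi.mk (glueLabel h fi) (glueBase h) fun p => ap (X p.1 p.2) (glueIncl h fi p) (x p.1 p.2)

theorem gammaRep_eq {T T' : FinLinOrd} {f : T → K} {f' : T' → K} (g : T →o T')
    (hg : ∀ t, f' (g t) = f t) {Ti Ti' : K → FinLinOrd} {h : ∀ i, Ti i →o fiber f i}
    {h' : ∀ i, Ti' i →o fiber f' i} {fi : ∀ i, Ti i → J i} {fi' : ∀ i, Ti' i → J i}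
    (u : ∀ i, Ti i →o Ti' i) (hu : ∀ i s, fi' i (u i s) = fi i s)
    (hh : ∀ i s, h' i (u i s) = fiberMap g hg i (h i s))
    {x : ∀ i j, (X i j).obj (fiber (fi i) j)} {x' : ∀ i j, (X i j).obj (fiber (fi' i) j)}
    (hx : ∀ i j, x' i j = ap (X i j) (fiberMap (u i) (hu i) j) (x i j)) :
    ap (Xi (fun p : Σ i, J i => X p.1 p.2)) g (gammaRep h fi x) = gammaRep h' fi' x' := by
  have hb : ∀ a : Glue h, Glue.base (⟨a.1, u a.1 a.2⟩ : Glue h') = g a.base := fun a =>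
    congrArg Subtype.val (hh a.1 a.2)
  have hm : Monotone (fun a : Glue h => (⟨a.1, u a.1 a.2⟩ : Glue h')) := by
    intro a b hab
    by_cases hne : a.1 = b.1
    · obtain ⟨i, s⟩ := a
      obtain ⟨j, t⟩ := b
      obtain rfl : i = j := hne
      exact Glue.mk_le_mk.2 ((u i).monotone (Glue.mk_le_mk.1 hab))
    · refine Glue.le_of_base_le hne ?_
      rw [hb, hb]
      exact g.monotone (Glue.base_le hab)
  refine (Xi.mk_eq (T := glue h) (T' := glue h') (f := glueLabel h fi) (f' := glueLabel h' fi')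
    (h := g.comp (glueBase h)) (h' := glueBase h') ⟨_, hm⟩
    (fun a : Glue h => Sigma.ext rfl (heq_of_eq (hu a.1 a.2))) hb _).trans ?_
  refine congrArg (Xi.mk _ _) (funext fun p => ?_)
  rw [hx, ap_ap, ap_ap]
  rfl

theorem finite_quot_sound {I : Type} [Finite I] {A : I → Type} {R : ∀ i, A i → A i → Prop}
    (hR : ∀ i a, R i a a) {B : Type} (F : (∀ i, A i) → B)
    (hF : ∀ r r', (∀ i, R i (r i) (r' i)) → F r = F r') (r r' : ∀ i, A i)
    (h : ∀ i, Quot.mk (R i) (r i) = Quot.mk (R i) (r' i)) : F r = F r' := by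
  classical
  have := Fintype.ofFinite I
  have h1 : ∀ (c : ∀ i, A i) (a : I) (y y' : A a), Relation.EqvGen (R a) y y' →
      F (Function.update c a y) = F (Function.update c a y') := by
    intro c a y y' hy
    induction hy with
    | rel y y' hy =>
      refine hF _ _ fun i => ?_
      by_cases hi : i = a
      · subst hi
        simpa using hy
      · simpa [hi] using hR i (c i)
    | refl y => rfl
    | symm y y' _ ih => exact ih.symm
    | trans y y' y'' _ _ ih ih' => exact ih.trans ih'
  have h2 : ∀ s : Finset I, F (s.piecewise r' r) = F r := by
    intro s
    induction s using Finset.induction_on with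
    | empty => simp
    | insert a s ha ih =>
      rw [Finset.piecewise_insert, ← ih,
        ← h1 (s.piecewise r' r) a (r a) (r' a) (Quot.eqvGen_exact (h a))]
      congr 1
      refine Eq.trans ?_ (Function.update_eq_self a _)
      rw [Finset.piecewise_eq_of_notMem _ _ _ ha]
  have h3 := h2 Finset.univ
  rw [Finset.piecewise_univ] at h3
  exact h3.symm

/-- `Γ` on representatives. -/
def gammaQ {T : FinLinOrd} (f : T → K)
    (r : ∀ i, Σ a : XiIndex (J i) (fiber f i), XiProd (X i) a.f) :
    (Xi (fun p : Σ i, J i => X p.1 p.2)).obj T :=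
  gammaRep (f := f) (fun i => (r i).1.h) (fun i => (r i).1.f)
    (fun i j => WithGeneratedByTopology.equiv (r i).2 j)

theorem gammaQ_sound {T : FinLinOrd} (f : T → K)
    (r r' : ∀ i, Σ a : XiIndex (J i) (fiber f i), XiProd (X i) a.f)
    (h : ∀ i, Quot.mk (XiRel (X i) (fiber f i)) (r i) = Quot.mk (XiRel (X i) (fiber f i)) (r' i)) :
    gammaQ f r = gammaQ f r' := by
  refine finite_quot_sound (R := fun i => XiRel (X i) (fiber f i)) (fun i a => ?_) (gammaQ f)
    (fun r r' hr => ?_) r r' h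
  · exact ⟨OrderHom.id, fun _ => rfl, fun _ => rfl, funext fun j => (ap_id (X i j) _).symm⟩
  · choose u hu hh hx using hr
    refine (ap_id _ _).symm.trans (gammaRep_eq OrderHom.id (fun _ => rfl) u hu hh fun i j => ?_)
    exact congrFun (hx i) j

/-- The map `∏ i, Ξ_{J_i}(X_i)^{f⁻¹(i)} → Ξ_{∐ J_i}(X)^T` that defines `Γ`. -/
def gammaFun {T : FinLinOrd} (f : T → K) (w : ∀ i, (Xi (X i)).obj (fiber f i)) :
    (Xi (fun p : Σ i, J i => X p.1 p.2)).obj T :=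
  gammaQ f fun i => Quot.out (w i)

theorem gammaFun_quot_mk {T : FinLinOrd} (f : T → K)
    (r : ∀ i, Σ a : XiIndex (J i) (fiber f i), XiProd (X i) a.f) :
    gammaFun (X := X) f (fun i => Quot.mk (XiRel (X i) (fiber f i)) (r i)) = gammaQ f r :=
  gammaQ_sound f _ _ fun _ => Quot.out_eq _

theorem kcont_gammaFun {T : FinLinOrd} (f : T → K) : KCont (gammaFun (X := X) f) := by
  refine (IsJointQuotient.pi K fun i => Xi.isJointQuotient (X := X i) (fiber f i)).desc _ _
    fun a => ?_
  have hc : KCont (fun b : ∀ i, XiProd (X i) (a i).f => gammaQ f fun i => ⟨a i, b i⟩) := by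
    have hp : Continuous (fun (b : ∀ i, XiProd (X i) (a i).f) (p : Σ i, J i) =>
        ap (X p.1 p.2) (glueIncl (f := f) (fun i => (a i).h) (fun i => (a i).f) p)
          (WithGeneratedByTopology.equiv (b p.1) p.2)) :=
      continuous_pi fun p => (ContinuousMap.continuous _).comp ((continuous_apply p.2).comp
        (WithGeneratedByTopology.continuous_equiv.comp (continuous_apply p.1)))
    exact (Xi.continuous_mk (X := fun p : Σ i, J i => X p.1 p.2) (glueLabel _ _)
      (glueBase fun i => (a i).h)).comp hp.continuousGeneratedBy
  have he : (fun b : ∀ i, XiProd (X i) (a i).f => gammaQ f fun i => ⟨a i, b i⟩) =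
      fun b => gammaFun (X := X) f (fun i => Quot.mk (XiRel (X i) (fiber f i)) ⟨a i, b i⟩) :=
    funext fun b => (gammaFun_quot_mk f fun i => ⟨a i, b i⟩).symm
  rw [he] at hc
  exact hc

/-- The structure map `Γ : Ξ_K(Ξ_{J_1}(…), …, Ξ_{J_k}(…)) → Ξ_{∐ J_i}(…)`. -/
def Gamma (X : ∀ i, J i → AugCosimp) :
    Xi (fun i => Xi (X i)) ⟶ Xi (fun p : Σ i, J i => X p.1 p.2) :=
  Xi.desc (fun f w => gammaFun f w) kcont_gammaFun (fun {T T'} f f' g hg w => by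
    obtain ⟨r, rfl⟩ : ∃ r : ∀ i, Σ a : XiIndex (J i) (fiber f i), XiProd (X i) a.f,
        (fun i => (Quot.mk (XiRel (X i) (fiber f i)) (r i) : (Xi (X i)).obj (fiber f i))) = w :=
      ⟨fun i => Quot.out (w i), funext fun i => Quot.out_eq _⟩
    rw [gammaFun_quot_mk]
    refine Eq.trans ?_ (gammaFun_quot_mk f' fun i =>
      ⟨⟨(r i).1.n, (r i).1.f, (fiberMap g hg i).comp (r i).1.h⟩, (r i).2⟩).symm
    exact gammaRep_eq (h := fun i => (r i).1.h) (fi := fun i => (r i).1.f)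
      (h' := fun i => (fiberMap g hg i).comp (r i).1.h) (fi' := fun i => (r i).1.f)
      g hg (fun i => OrderHom.id) (fun _ _ => rfl) (fun _ _ => rfl)
      (fun i j => (ap_id (X i j) _).symm))

end Gamma

/-! ### Operads -/

/-- The data of a symmetric operad of spaces: spaces `O(n)`, a unit `1 ∈ O(1)`, the composition
`γ : O(k) × O(j_1) × ⋯ × O(j_k) → O(j_1 + ⋯ + j_k)`, and for each bijection
`e : {1, …, m} → {1, …, n}` (so that `m = n`) a map `O(m) → O(n)`. For `m = n` the latter is the
action of the symmetric group, written as a left action (the right action of `σ` is the map of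
`σ⁻¹`); for the increasing bijection it identifies `O(m)` and `O(n)` along `m = n`. -/
structure OperadData where
  obj : ℕ → Type u
  [top : ∀ n, TopologicalSpace (obj n)]
  map : ∀ {m n : ℕ}, Fin m ≃ Fin n → obj m → obj n
  one : obj 1
  comp : ∀ {k : ℕ} (j : Fin k → ℕ), obj k → (∀ i, obj (j i)) → obj (∑ i, j i)

attribute [instance] OperadData.top

theorem sum_finSigma {k : ℕ} (j : Fin k → ℕ) (l : ∀ a, Fin (j a) → ℕ) :
    ∑ c, l (finSigmaFinEquiv.symm c).1 (finSigmaFinEquiv.symm c).2 = ∑ a, ∑ b, l a b := by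
  rw [Equiv.sum_comp finSigmaFinEquiv.symm (fun p : Σ a, Fin (j a) => l p.1 p.2)]
  exact Fintype.sum_sigma _

/-- The block sum of bijections. -/
def blockSum {k : ℕ} {j j' : Fin k → ℕ} (τ : ∀ i, Fin (j i) ≃ Fin (j' i)) :
    Fin (∑ i, j i) ≃ Fin (∑ i, j' i) :=
  finSigmaFinEquiv.symm.trans ((Equiv.sigmaCongrRight τ).trans finSigmaFinEquiv)

/-- The bijection which permutes blocks by `σ`: the `i`-th block (of size `j (σ i)`) goes to the
`σ i`-th block. -/
def blockPerm {k k' : ℕ} (σ : Fin k ≃ Fin k') (j : Fin k' → ℕ) :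
    Fin (∑ i, j (σ i)) ≃ Fin (∑ i, j i) :=
  finSigmaFinEquiv.symm.trans
    ((Equiv.sigmaCongrLeft (β := fun i => Fin (j i)) σ).trans finSigmaFinEquiv)

/-- The axioms of a symmetric operad in the category of compactly generated spaces. -/
structure OperadData.IsOperad (O : OperadData.{u}) : Prop where
  isGeneratedBy : ∀ n, IsGeneratedBy CH (O.obj n)
  continuous_map : ∀ {m n : ℕ} (e : Fin m ≃ Fin n), Continuous (O.map e)
  continuous_comp : ∀ {k : ℕ} (j : Fin k → ℕ),
    KCont (fun p : O.obj k × (∀ i, O.obj (j i)) => O.comp j p.1 p.2)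
  map_refl : ∀ {n : ℕ} (x : O.obj n), O.map (Equiv.refl _) x = x
  map_trans : ∀ {l m n : ℕ} (e : Fin l ≃ Fin m) (e' : Fin m ≃ Fin n) (x : O.obj l),
    O.map (e.trans e') x = O.map e' (O.map e x)
  one_comp : ∀ {n : ℕ} (x : O.obj n),
    O.comp (fun _ : Fin 1 => n) O.one (fun _ => x) = O.map (finCongr (by simp)) x
  comp_one : ∀ {n : ℕ} (x : O.obj n),
    O.comp (fun _ : Fin n => 1) x (fun _ => O.one) = O.map (finCongr (by simp)) x
  comp_assoc : ∀ {k : ℕ} (j : Fin k → ℕ) (l : ∀ a, Fin (j a) → ℕ) (x : O.obj k)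
    (y : ∀ a, O.obj (j a)) (z : ∀ a b, O.obj (l a b)),
    O.comp (fun a => ∑ b, l a b) x (fun a => O.comp (l a) (y a) (z a)) =
      O.map (finCongr (sum_finSigma j l))
        (O.comp (fun c => l (finSigmaFinEquiv.symm c).1 (finSigmaFinEquiv.symm c).2)
          (O.comp j x y) (fun c => z (finSigmaFinEquiv.symm c).1 (finSigmaFinEquiv.symm c).2))
  comp_map_right : ∀ {k : ℕ} {j j' : Fin k → ℕ} (τ : ∀ i, Fin (j i) ≃ Fin (j' i)) (x : O.obj k)
    (y : ∀ i, O.obj (j i)),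
    O.comp j' x (fun i => O.map (τ i) (y i)) = O.map (blockSum τ) (O.comp j x y)
  comp_map_left : ∀ {k k' : ℕ} (σ : Fin k ≃ Fin k') (j : Fin k' → ℕ) (x : O.obj k)
    (y : ∀ i, O.obj (j i)),
    O.comp j (O.map σ x) y = O.map (blockPerm σ j) (O.comp (fun i => j (σ i)) x (fun i => y (σ i)))

/-- `E_∞` operads: `O(0)` is a point, every `O(n)` is contractible, and the symmetric group `Σ_n`
acts freely on `O(n)`. -/
structure OperadData.IsEInfty (O : OperadData.{u}) : Prop extends O.IsOperad where
  zero : Nonempty (Unique (O.obj 0))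
  contractible : ∀ n, ContractibleSpace (O.obj n)
  free : ∀ {n : ℕ} (σ : Equiv.Perm (Fin n)) (x : O.obj n), O.map σ x = x → σ = 1

/-- The maps `θ_k : O(k) × Y^k → Y` are an action of the operad `O` on the compactly generated
space `Y`. -/
structure OperadData.IsAction (O : OperadData.{u}) {Y : Type v} [TopologicalSpace Y]
    (θ : ∀ k, O.obj k → (Fin k → Y) → Y) : Prop where
  isGeneratedBy : IsGeneratedBy CH Y
  continuous : ∀ k, KCont (fun p : O.obj k × (Fin k → Y) => θ k p.1 p.2)
  one : ∀ y : Y, θ 1 O.one (fun _ => y) = y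
  comp : ∀ {k : ℕ} (j : Fin k → ℕ) (x : O.obj k) (z : ∀ i, O.obj (j i))
    (y : Fin (∑ i, j i) → Y),
    θ _ (O.comp j x z) y = θ k x (fun i => θ (j i) (z i) (fun b => y (finSigmaFinEquiv ⟨i, b⟩)))
  map : ∀ {m n : ℕ} (e : Fin m ≃ Fin n) (x : O.obj m) (y : Fin n → Y),
    θ n (O.map e x) y = θ m x (fun i => y (e i))

/-! ### `Tot` and the operad `D` -/

/-- The augmented cosimplicial space `Δ^•`, with `Δ^S` the simplex with vertex set `S`; in
particular `Δ^∅ = ∅`. -/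
def Simp : AugCosimp :=
  mkAug (fun S => GeneratedByTopCat.of (stdSimplex ℝ S))
    (fun g => ⟨stdSimplex.map g, stdSimplex.continuous_map g⟩)
    (fun _ x => stdSimplex.map_id_apply x)
    (fun g h x => (stdSimplex.map_comp_apply g h x).symm)

/-- `Tot(X)`, the space of maps `Δ^• → X` of augmented cosimplicial spaces. -/
def Tot (X : AugCosimp) : Type 1 := Simp ⟶ X

/-- `Tot(X)` is a subspace of the product of the mapping spaces from `Δ^S` to `X^S` (with the
compact-open topology), formed in compactly generated spaces. -/
instance (X : AugCosimp) : TopologicalSpace (Tot X) :=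
  TopologicalSpace.generatedBy CH (tY :=
    ⨅ S : FinLinOrd, TopologicalSpace.induced (fun φ : Simp ⟶ X => compAt φ S) inferInstance)

/-- The map `Γ : Ξ_k(Ξ_{j_1}(X, …, X), …, Ξ_{j_k}(X, …, X)) → Ξ_{j_1 + ⋯ + j_k}(X, …, X)`. -/
def gammaSum (X : AugCosimp) {k : ℕ} (j : Fin k → ℕ) :
    Xi (fun i => Xi (fun _ : Fin (j i) => X)) ⟶ Xi (fun _ : Fin (∑ i, j i) => X) :=
  Gamma (fun i (_ : Fin (j i)) => X) ≫ Xi.reindex finSigmaFinEquiv (fun _ => X)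

/-- The operad `D` with `D(k) = Tot(Ξ_k(Δ^•, …, Δ^•))`. -/
def D : OperadData.{1} where
  obj k := Tot (Xi (fun _ : Fin k => Simp))
  map e φ := (φ : Simp ⟶ _) ≫ Xi.reindex e (fun _ => Simp)
  one := Xi.iota (Fin 1) Simp
  comp j φ ψ := (φ : Simp ⟶ _) ≫ Xi.map (fun i => (ψ i : Simp ⟶ _)) ≫ gammaSum Simp j

/-- Algebras over the functor-operad `Ξ`. -/
@[ext]
structure XiAlgebra (X : AugCosimp) where
  act : ∀ k : ℕ, Xi (fun _ : Fin k => X) ⟶ X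
  unit : Xi.iota (Fin 1) X ≫ act 1 = 𝟙 X
  assoc : ∀ {k : ℕ} (j : Fin k → ℕ),
    Xi.map (fun i => act (j i)) ≫ act k = gammaSum X j ≫ act (∑ i, j i)
  equivariant : ∀ {k : ℕ} (σ : Equiv.Perm (Fin k)), Xi.reindex σ (fun _ => X) ≫ act k = act k

/-- The maps `D(k) × Tot(X)^k → Tot(X)` for a `Ξ`-algebra `X`. -/
def XiAlgebra.totAction {X : AugCosimp} (A : XiAlgebra X) (k : ℕ) (φ : D.obj k)
    (x : Fin k → Tot X) : Tot X :=
  (φ : Simp ⟶ Xi (fun _ : Fin k => Simp)) ≫ Xi.map (fun i => (x i : Simp ⟶ X)) ≫ A.act k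

/-! ### Commutative monoids with respect to `⊠` -/

/-- The family `(X, Y)`. -/
def pair (X Y : AugCosimp) : Fin 2 → AugCosimp
  | 0 => X
  | 1 => Y

/-- A pair of maps as a map of families. -/
def pairHom {X Y : Fin 2 → AugCosimp} (φ : X 0 ⟶ Y 0) (ψ : X 1 ⟶ Y 1) :
    ∀ i, X i ⟶ Y i
  | 0 => φ
  | 1 => ψ

/-- The product `X ⊠ Y = Ξ_2(X, Y)`. -/
def box (X Y : AugCosimp) : AugCosimp := Xi (pair X Y)

/-- Functoriality of `⊠`. -/
def boxHom {X X' Y Y' : AugCosimp} (φ : X ⟶ X') (ψ : Y ⟶ Y') : box X Y ⟶ box X' Y' :=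
  Xi.map (pairHom (X := pair X Y) (Y := pair X' Y') φ ψ)

/-- The unit `Ξ_0`. -/
def boxUnit : AugCosimp := Xi (Fin.elim0 : Fin 0 → AugCosimp)

/-- The left unit isomorphism `Ξ_0 ⊠ X → X`. -/
def leftUnitor (X : AugCosimp) : box boxUnit X ⟶ X :=
  Xi.desc (X := pair boxUnit X) (fun f x => ap X (fiberIncl f 1) (x 1))
    (fun f => Continuous.continuousGeneratedBy
      ((ap X (fiberIncl f 1)).continuous.comp (continuous_apply (1 : Fin 2))))
    (fun _ f' g hg _ => (ap_ap X _ _ _).trans (ap_ap X (fiberMap g hg 1) (fiberIncl f' 1) _).symm)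

/-- The right unit isomorphism `X ⊠ Ξ_0 → X`. -/
def rightUnitor (X : AugCosimp) : box X boxUnit ⟶ X :=
  Xi.desc (X := pair X boxUnit) (fun f x => ap X (fiberIncl f 0) (x 0))
    (fun f => Continuous.continuousGeneratedBy
      ((ap X (fiberIncl f 0)).continuous.comp (continuous_apply (0 : Fin 2))))
    (fun _ f' g hg _ => (ap_ap X _ _ _).trans (ap_ap X (fiberMap g hg 0) (fiberIncl f' 0) _).symm)

/-- The symmetry isomorphism `X ⊠ Y → Y ⊠ X`. -/
def braiding (X Y : AugCosimp) : box X Y ⟶ box Y X :=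
  Xi.reindex (Equiv.swap (0 : Fin 2) 1) (pair X Y) ≫
    Xi.map (pairHom (X := fun l => pair X Y ((Equiv.swap (0 : Fin 2) 1).symm l)) (Y := pair Y X)
      (𝟙 Y) (𝟙 X))

/-- The family `(X, Y, Z)`. -/
def triple (X Y Z : AugCosimp) : Fin 3 → AugCosimp := Fin.cons X (pair Y Z)

/-- The arities `(2, 1)`. -/
def leftArity : Fin 2 → ℕ
  | 0 => 2
  | 1 => 1

/-- The family `((X, Y), (Z))`. -/
def leftFamily (X Y Z : AugCosimp) : ∀ i, Fin (leftArity i) → AugCosimp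
  | 0 => pair X Y
  | 1 => fun _ => Z

/-- The increasing bijection `{1, 2, 3} → {1, 2} ∐ {1}`. -/
def leftIndex : Fin 3 → Σ i, Fin (leftArity i)
  | 0 => ⟨0, (0 : Fin 2)⟩
  | 1 => ⟨0, (1 : Fin 2)⟩
  | 2 => ⟨1, (0 : Fin 1)⟩

/-- The arities `(1, 2)`. -/
def rightArity : Fin 2 → ℕ
  | 0 => 1
  | 1 => 2

/-- The family `((X), (Y, Z))`. -/
def rightFamily (X Y Z : AugCosimp) : ∀ i, Fin (rightArity i) → AugCosimp
  | 0 => fun _ => X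
  | 1 => pair Y Z

/-- The increasing bijection `{1} ∐ {1, 2} → {1, 2, 3}`. -/
def rightIndex : (Σ i, Fin (rightArity i)) → Fin 3
  | ⟨0, _⟩ => 0
  | ⟨1, b⟩ => Fin.succ (n := 2) b

/-- The identification of the families `((X, Y), (Z))` and `(X, Y, Z)`. -/
def leftHom (X Y Z : AugCosimp) : ∀ l : Fin 3,
    leftFamily X Y Z (leftIndex l).1 (leftIndex l).2 ⟶ triple X Y Z l
  | 0 => 𝟙 X
  | 1 => 𝟙 Y
  | 2 => 𝟙 Z

/-- The isomorphism `(X ⊠ Y) ⊠ Z → Ξ_3(X, Y, Z)` given by `Γ`. -/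
def leftTriple (X Y Z : AugCosimp) : box (box X Y) Z ⟶ Xi (triple X Y Z) :=
  Xi.map (pairHom (X := pair (box X Y) Z) (Y := fun i => Xi (leftFamily X Y Z i))
    (𝟙 (box X Y)) (Xi.iota (Fin 1) Z)) ≫
  Gamma (leftFamily X Y Z) ≫
  Xi.reindex (Equiv.ofBijective leftIndex (by decide)).symm
    (fun p => leftFamily X Y Z p.1 p.2) ≫
  Xi.map (leftHom X Y Z)

/-- The identification of the families `(X, Y, Z)` and `((X), (Y, Z))`. -/
def rightHom (X Y Z : AugCosimp) : ∀ p : (Σ i, Fin (rightArity i)),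
    triple X Y Z (rightIndex p) ⟶ rightFamily X Y Z p.1 p.2
  | ⟨0, _⟩ => 𝟙 X
  | ⟨1, b⟩ => 𝟙 (pair Y Z b)

/-- The isomorphism `Ξ_3(X, Y, Z) → X ⊠ (Y ⊠ Z)` given by `Λ = Γ⁻¹`. -/
def rightTriple (X Y Z : AugCosimp) : Xi (triple X Y Z) ⟶ box X (box Y Z) :=
  Xi.reindex (Equiv.ofBijective rightIndex (by decide)).symm (triple X Y Z) ≫
  Xi.map (rightHom X Y Z) ≫
  Lambda (rightFamily X Y Z) ≫
  Xi.map (pairHom (X := fun i => Xi (rightFamily X Y Z i)) (Y := pair X (box Y Z))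
    (Xi.eps (Fin 1) X) (𝟙 (box Y Z)))

/-- The associativity isomorphism `(X ⊠ Y) ⊠ Z → X ⊠ (Y ⊠ Z)`. -/
def associator (X Y Z : AugCosimp) : box (box X Y) Z ⟶ box X (box Y Z) :=
  leftTriple X Y Z ≫ rightTriple X Y Z

/-- Commutative monoid structures on `X` with respect to the symmetric monoidal product `⊠`. -/
@[ext]
structure CommBoxMonoid (X : AugCosimp) where
  one : boxUnit ⟶ X
  mul : box X X ⟶ X
  one_mul : boxHom one (𝟙 X) ≫ mul = leftUnitor X
  mul_one : boxHom (𝟙 X) one ≫ mul = rightUnitor X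
  mul_assoc : boxHom mul (𝟙 X) ≫ mul = associator X X X ≫ boxHom (𝟙 X) mul ≫ mul
  mul_comm : braiding X X ≫ mul = mul

/-- The `Ξ`-algebra structure `A` on `X` restricts to the commutative monoid structure `M`: the
unit and the product of `M` are the structure maps of `A` on `Ξ_0` and on `Ξ_2(X, X)`. -/
def XiAlgebra.RestrictsTo {X : AugCosimp} (A : XiAlgebra X) (M : CommBoxMonoid X) : Prop :=
  M.one = Xi.map (Y := fun _ : Fin 0 => X) (fun i => i.elim0) ≫ A.act 0 ∧
  M.mul = Xi.map (pairHom (X := pair X X) (Y := fun _ => X) (𝟙 X) (𝟙 X)) ≫ A.act 2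

end CosimpOperad

end

noncomputable section

open CategoryTheory Topology

universe u v

namespace CosimpOperad

open FinLinOrd

/-! ### Structure maps on representatives -/

section Representatives

variable {K L : Type} {X Y Z : K → AugCosimp}

/-! Structure maps. Two representatives of a point of `Ξ_K(X)^S` agree as soon as an
order-preserving map over `K` and `S` carries one to the other (`Xi.mk_eq_mk`), so an identity of
structure maps amounts to exhibiting such maps of diagrams. `Γ` needs representatives on two levels,
whereas its inverse `Λ` merely restricts a label `T → ∐ J_i` to the preimages of the `J_i`. Unit,
associativity and equivariance are therefore checked for `Λ` and transported to `Γ`. What remains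
for the operad axioms is the numbering of `∐ Fin (j i)`, and continuity: maps from a compact
Hausdorff space to `Tot(X)` are the jointly continuous families (`Tot.continuous_iff`).

Freeness. In a point of `Ξ_K(Δ^•)^S` each label `i` carries a point of the simplex on `f⁻¹(i)`,
which has nonempty support. Ordering the labels by the first elements of their supports gives a
strict total order on `K`. Maps of diagrams never identify elements with different labels, so this
order depends only on the point (`labelOrder`). A permutation fixing the point preserves the order,
hence is trivial.

Contractibility. Such a point is an interval of length `|K|` divided into consecutive pieces indexed
by `T`, each with a label in `K` and a position in `S`, every label having total length one. It
carries two kinds of data: a path (the subdivision labelled by `K`) and the lengths over `S`.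
Conversely, a path and a list of lengths with the same total can be cut against each other: the
lengths of the intersections are weights on a product, and their support is a chain. This `cut` is
natural and recovers a point from its own path and lengths (`cut_self`). Keep the lengths, and
replace the path by the standard path through all labels, scaled by `r`, followed by the given one,
scaled by `1 - r`. The result is a homotopy, through maps of augmented cosimplicial spaces, from the
identity to a composite `Ξ_K(Δ^•) → Δ^• → Ξ_K(Δ^•)`. Maps `Δ^• → Δ^•` contract to the identity along
straight lines, so `D(k)` is contractible for `k ≥ 1`; `D(0)` is a point.

Monoids. For a commutative `⊠`-monoid `M` and a finite totally ordered set `Ω`, the pairs `(A, x)`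
with `A ⊆ Ω` and `x ∈ X^A`, together with a zero, form an ordinary commutative monoid `Piece M Ω`,
in which the product is zero unless the subsets are disjoint. A map `Ξ_K(X, …, X) → X` that computes
the `K`-fold products in these monoids is unique (`IsIteratedProduct.unique`) and is built by
induction on arity. The axioms of a `Ξ`-algebra, and its uniqueness, thus follow from properties of
finite products. In the other direction the monoid axioms are the algebra axioms in small arities.
-/

theorem compAt_comp {X Y Z : AugCosimp} (φ : X ⟶ Y) (ψ : Y ⟶ Z) (S : FinLinOrd) (x : X.obj S) :
    compAt (φ ≫ ψ) S x = compAt ψ S (compAt φ S x) := rfl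

theorem compAt_id (X : AugCosimp) (S : FinLinOrd) (x : X.obj S) : compAt (𝟙 X) S x = x := rfl

theorem ap_congr (X : AugCosimp) {S T : FinLinOrd} {g h : S →o T} (hgh : ∀ s, g s = h s)
    (x : X.obj S) : ap X g x = ap X h x := by
  rw [OrderHom.ext _ _ (funext hgh)]

theorem ap_eq_self (X : AugCosimp) {S : FinLinOrd} {g : S →o S} (hg : ∀ s, g s = s)
    (x : X.obj S) : ap X g x = x :=
  (ap_congr X (h := OrderHom.id) hg x).trans (ap_id X x)

/-- Two representatives of a point of `Ξ_K(X)^S` related by a map of diagrams. -/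
theorem Xi.mk_eq_mk {S T T' : FinLinOrd} {f : T → K} {h : T →o S} {f' : T' → K} {h' : T' →o S}
    (g : T →o T') (hf : ∀ t, f' (g t) = f t) (hh : ∀ t, h' (g t) = h t)
    {x : ∀ i, (X i).obj (fiber f i)} {x' : ∀ i, (X i).obj (fiber f' i)}
    (hx : ∀ i, ap (X i) (fiberMap g hf i) (x i) = x' i) : Xi.mk f h x = Xi.mk f' h' x' :=
  (Xi.mk_eq g hf hh x).trans (congrArg (Xi.mk f' h') (funext hx))

theorem Xi.map_mk (φ : ∀ i, X i ⟶ Y i) {S T : FinLinOrd} (f : T → K) (h : T →o S)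
    (x : ∀ i, (X i).obj (fiber f i)) :
    compAt (Xi.map φ) S (Xi.mk f h x) = Xi.mk f h fun i => compAt (φ i) _ (x i) := by
  refine (Xi.desc_mk _ _ _ f h x).trans ?_
  rw [Xi.ap_mk]
  rfl

theorem Xi.map_id (X : K → AugCosimp) : Xi.map (fun i => 𝟙 (X i)) = 𝟙 (Xi X) :=
  Xi.hom_ext fun _ _ _ => Xi.map_mk _ _ _ _

theorem Xi.map_comp (φ : ∀ i, X i ⟶ Y i) (ψ : ∀ i, Y i ⟶ Z i) :
    Xi.map (fun i => φ i ≫ ψ i) = Xi.map φ ≫ Xi.map ψ :=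
  Xi.hom_ext fun _ _ _ => by
    rw [compAt_comp, Xi.map_mk, Xi.map_mk, Xi.map_mk]
    rfl

/-- The fibre of `f` over `e⁻¹(l)` as the fibre of `e ∘ f` over `l`. -/
abbrev reindexFiber (e : K ≃ L) {T : FinLinOrd} (f : T → K) (l : L) :
    fiber f (e.symm l) →o fiber (T := T) (fun t => e (f t)) l :=
  ⟨fun t => ⟨t.1, (congrArg e t.2).trans (e.apply_symm_apply l)⟩, fun _ _ h => h⟩

theorem Xi.reindex_mk (e : K ≃ L) {S T : FinLinOrd} (f : T → K) (h : T →o S)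
    (x : ∀ i, (X i).obj (fiber f i)) :
    compAt (Xi.reindex e X) S (Xi.mk f h x) =
      Xi.mk (T := T) (X := fun l => X (e.symm l)) (fun t => e (f t)) h fun l =>
        ap (X (e.symm l)) (reindexFiber e f l) (x (e.symm l)) := by
  refine (Xi.desc_mk _ _ _ f h x).trans ?_
  rw [Xi.ap_mk]
  rfl

theorem Xi.iota_apply (K : Type) [Unique K] (X : AugCosimp) {S : FinLinOrd} (x : X.obj S) :
    compAt (Xi.iota K X) S x = Xi.mk (T := S) (X := fun _ : K => X) (fun _ => default) OrderHom.id
      fun i => ap X (T := fiber (T := S) (fun _ => default) i)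
          ⟨fun t => ⟨t, Subsingleton.elim _ _⟩, fun _ _ h => h⟩ x := rfl

theorem Xi.eps_mk (K : Type) [Unique K] (X : AugCosimp) {S T : FinLinOrd} (f : T → K) (h : T →o S)
    (x : ∀ i, X.obj (fiber f i)) :
    compAt (Xi.eps K X) S (Xi.mk f h x) = ap X (h.comp (fiberIncl f default)) (x default) := by
  refine (Xi.desc_mk _ _ _ f h x).trans ?_
  rw [ap_ap]

theorem Xi.iota_eps (K : Type) [Unique K] (X : AugCosimp) : Xi.iota K X ≫ Xi.eps K X = 𝟙 X :=
  CosimpOperad.hom_ext fun S x => by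
    rw [compAt_comp, Xi.iota_apply, Xi.eps_mk, ap_ap]
    exact ap_eq_self X (fun _ => rfl) x

theorem Xi.eps_iota (K : Type) [Unique K] (X : AugCosimp) :
    Xi.eps K X ≫ Xi.iota K X = 𝟙 (Xi fun _ : K => X) :=
  Xi.hom_ext fun T f x => by
    rw [compAt_comp, Xi.eps_mk, Xi.iota_apply]
    refine Xi.mk_eq_mk OrderHom.id (fun t => Subsingleton.elim _ _) (fun _ => rfl) fun i => ?_
    obtain rfl : i = default := Subsingleton.elim _ _
    rw [ap_ap, ap_ap]
    exact ap_eq_self X (fun _ => rfl) _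

theorem Xi.iota_naturality (K : Type) [Unique K] {X Y : AugCosimp} (φ : X ⟶ Y) :
    Xi.iota K X ≫ Xi.map (fun _ => φ) = φ ≫ Xi.iota K Y :=
  CosimpOperad.hom_ext fun S x => by
    rw [compAt_comp, compAt_comp, Xi.iota_apply, Xi.iota_apply, Xi.map_mk]
    simp only [compAt_ap]

theorem Xi.reindex_naturality (e : K ≃ L) (φ : ∀ i, X i ⟶ Y i) :
    Xi.reindex e X ≫ Xi.map (fun l => φ (e.symm l)) = Xi.map φ ≫ Xi.reindex e Y :=
  Xi.hom_ext fun T f x => by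
    rw [compAt_comp, compAt_comp, Xi.reindex_mk, Xi.map_mk, Xi.map_mk, Xi.reindex_mk]
    simp only [compAt_ap]

theorem Xi.reindex_refl (X : K → AugCosimp) : Xi.reindex (Equiv.refl K) X = 𝟙 (Xi X) :=
  Xi.hom_ext fun T f x => by
    rw [Xi.reindex_mk]
    exact congrArg (Xi.mk _ _) (funext fun i => ap_eq_self (X i) (fun _ => rfl) _)

theorem Xi.reindex_trans {M : Type} (e : K ≃ L) (e' : L ≃ M) (X : K → AugCosimp) :
    Xi.reindex (e.trans e') X = Xi.reindex e X ≫ Xi.reindex e' (fun l => X (e.symm l)) :=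
  Xi.hom_ext fun T f x => by
    refine (Xi.reindex_mk _ _ _ _).trans (Eq.symm ?_)
    refine (congrArg (compAt (Xi.reindex e' _) T) (Xi.reindex_mk _ _ _ _)).trans ?_
    refine (Xi.reindex_mk _ _ _ _).trans ?_
    exact congrArg (Xi.mk _ _) (funext fun i => ap_ap _ _ _ _)

/-- For constant families `Xi.reindex e` and `Xi.reindex e.symm` are inverse to each other. -/
theorem Xi.reindex_symm_const (e : K ≃ L) (X : AugCosimp) :
    Xi.reindex e (fun _ => X) ≫ Xi.reindex e.symm (fun _ => X) = 𝟙 (Xi fun _ : K => X) := by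
  rw [← Xi.reindex_trans e e.symm (fun _ => X), e.self_trans_symm]
  exact Xi.reindex_refl _

end Representatives

/-! ### `Γ` and `Λ` are inverse to each other -/

section GammaLambda

variable {K : Type} {J : K → Type} {X Y : ∀ i, J i → AugCosimp}

theorem Lambda_mk {S T : FinLinOrd} (f : T → Σ i, J i) (h : T →o S)
    (x : ∀ p : Σ i, J i, (X p.1 p.2).obj (fiber f p)) :
    compAt (Lambda X) S (Xi.mk f h x) =
      Xi.mk (T := T) (X := fun i => Xi (X i)) (fun t => (f t).1) h fun i =>
        Xi.mk (sigmaLabel f i) OrderHom.id fun j => ap (X i j) (sigmaIncl f i j) (x ⟨i, j⟩) := by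
  refine (Xi.desc_mk _ _ _ f h x).trans ?_
  rw [Xi.ap_mk]
  rfl

theorem Lambda_naturality (φ : ∀ i j, X i j ⟶ Y i j) :
    Lambda X ≫ Xi.map (fun i => Xi.map (φ i)) =
      Xi.map (fun p : Σ i, J i => φ p.1 p.2) ≫ Lambda Y :=
  Xi.hom_ext fun T f x => by
    rw [compAt_comp, compAt_comp, Lambda_mk, Xi.map_mk, Xi.map_mk, Lambda_mk]
    simp only [Xi.map_mk, compAt_ap]

/-- Every point of `Ξ_K(Ξ_{J_i}(X_i))^T` is represented by representatives. -/
theorem Xi.hom_ext₂ {Z : AugCosimp} {φ ψ : Xi (fun i => Xi (X i)) ⟶ Z}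
    (H : ∀ (T : FinLinOrd) (f : T → K) (Ti : K → FinLinOrd) (h : ∀ i, Ti i →o fiber f i)
      (fi : ∀ i, Ti i → J i) (x : ∀ i j, (X i j).obj (fiber (fi i) j)),
      compAt φ T (Xi.mk (X := fun i => Xi (X i)) f OrderHom.id fun i => Xi.mk (fi i) (h i) (x i)) =
        compAt ψ T (Xi.mk (X := fun i => Xi (X i)) f OrderHom.id fun i => Xi.mk (fi i) (h i) (x i))) :
    φ = ψ := by
  refine Xi.hom_ext fun T f w => ?_
  have hw : ∀ i, ∃ (U : FinLinOrd) (f' : U → J i) (h : U →o fiber f i)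
      (x : ∀ j, (X i j).obj (fiber f' j)), Xi.mk f' h x = w i := fun i =>
    Xi.ind (X := X i) (P := fun v => ∃ (U : FinLinOrd) (f' : U → J i) (h : U →o fiber f i)
      (x : ∀ j, (X i j).obj (fiber f' j)), Xi.mk f' h x = v) (fun U f' h x => ⟨U, f', h, x, rfl⟩) (w i)
  choose Ti fi h x hx using hw
  obtain rfl : (fun i => Xi.mk (fi i) (h i) (x i)) = w := funext hx
  exact H T f Ti h fi x

variable [Finite K]

/-- `Γ` is defined through `Quot.out`, but does not depend on the inner representatives
(`gammaFun_quot_mk`), so any may be inserted. Those underlying `Xi.mk` are related to the given ones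
by the increasing enumerations of the `T_i`. -/
theorem Gamma_mk {S T : FinLinOrd} {f : T → K} (h₀ : T →o S) {Ti : K → FinLinOrd}
    (h : ∀ i, Ti i →o fiber f i) (fi : ∀ i, Ti i → J i)
    (x : ∀ i j, (X i j).obj (fiber (fi i) j)) :
    compAt (Gamma X) S
        (Xi.mk (X := fun i => Xi (X i)) f h₀ fun i => Xi.mk (fi i) (h i) (x i)) =
      Xi.mk (glueLabel h fi) (h₀.comp (glueBase h)) fun p =>
        ap (X p.1 p.2) (glueIncl h fi p) (x p.1 p.2) := by
  refine (Xi.desc_mk _ _ _ f h₀ _).trans ?_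
  refine Eq.trans ?_ (Xi.ap_mk (glueLabel h fi) (glueBase h) h₀ _)
  refine congrArg (ap _ h₀) ?_
  refine (gammaFun_quot_mk (X := X) f fun i => ⟨⟨Fintype.card (Ti i), fi i ∘ enumHom (Ti i),
    (h i).comp (enumHom (Ti i))⟩, XiProd.map (X i) (f' := fi i ∘ enumHom (Ti i)) (enumInv (Ti i))
      (fun t => congrArg (fi i) (enumHom_enumInv (Ti i) t))
      (WithGeneratedByTopology.equiv.symm (x i))⟩).trans ?_
  refine Eq.symm ((ap_id _ _).symm.trans (gammaRep_eq OrderHom.id (fun _ => rfl)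
    (fun i => enumInv (Ti i)) (fun i t => congrArg (fi i) (enumHom_enumInv (Ti i) t))
    (fun i t => congrArg (h i) (enumHom_enumInv (Ti i) t)) fun i j => ?_))
  rfl

/-- Here the `T_i` are the preimages of the `J_i` in `T`, and `∐ T_i → T` is a map of diagrams to
the original representative. -/
theorem Lambda_Gamma (X : ∀ i, J i → AugCosimp) : Lambda X ≫ Gamma X = 𝟙 _ :=
  Xi.hom_ext fun T f x => by
    rw [compAt_comp, Lambda_mk, Gamma_mk]
    refine Xi.mk_eq_mk (glueBase _) (fun t => ?_) (fun _ => rfl) fun p => ?_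
    · exact (sigmaLabel_eq f _ t.2.2).2 rfl
    · rw [ap_ap, ap_ap]
      exact ap_eq_self _ (fun _ => rfl) _

/-- The outer diagrams are related by `∐ T_i → T`, the inner ones by the inclusion of `T_i` as the
part of `∐ T_i` over `i`. -/
theorem Gamma_Lambda (X : ∀ i, J i → AugCosimp) : Gamma X ≫ Lambda X = 𝟙 _ :=
  Xi.hom_ext₂ fun T f Ti h fi x => by
    rw [compAt_comp, Gamma_mk, Lambda_mk]
    refine Xi.mk_eq_mk (glueBase h) (fun t => t.f_base) (fun _ => rfl) fun i => ?_
    refine (Xi.ap_mk _ _ _ _).trans ?_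
    have hm : Monotone fun s : Ti i => (⟨⟨i, s⟩, rfl⟩ :
        fiber (T := glue h) (fun t => (glueLabel h fi t).1) i) :=
      fun s t hst => (Glue.mk_le_mk (h := h)).2 hst
    refine Eq.symm (Xi.mk_eq_mk (f := fi i) (h := h i) (f' := sigmaLabel (glueLabel h fi) i)
      ⟨_, hm⟩ (fun s => rfl) (fun s => rfl) fun j => ?_)
    exact (ap_ap (X i j) (glueIncl h fi ⟨i, j⟩) (sigmaIncl (glueLabel h fi) i j) (x i j)).symm

theorem Gamma_naturality (φ : ∀ i j, X i j ⟶ Y i j) :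
    Gamma X ≫ Xi.map (fun p : Σ i, J i => φ p.1 p.2) =
      Xi.map (fun i => Xi.map (φ i)) ≫ Gamma Y := by
  have h := congrArg (fun ψ => Gamma X ≫ ψ ≫ Gamma Y) (Lambda_naturality φ)
  simp only [Category.assoc, Lambda_Gamma, Category.comp_id] at h
  rw [← h, ← Category.assoc (Gamma X), Gamma_Lambda, Category.id_comp]

/-- With `comp_Gamma_eq_iff`, this trades `Γ` for `Λ`, which has a formula on representatives of a
single level. -/
theorem eq_Gamma_comp_iff {Z : AugCosimp} {X : ∀ i, J i → AugCosimp}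
    {φ : Xi (fun i => Xi (X i)) ⟶ Z} {ψ : Xi (fun p : Σ i, J i => X p.1 p.2) ⟶ Z} :
    φ = Gamma X ≫ ψ ↔ Lambda X ≫ φ = ψ := by
  constructor
  · rintro rfl
    rw [← Category.assoc, Lambda_Gamma, Category.id_comp]
  · rintro rfl
    rw [← Category.assoc, Gamma_Lambda, Category.id_comp]

theorem comp_Gamma_eq_iff {Z : AugCosimp} {X : ∀ i, J i → AugCosimp}
    {φ : Z ⟶ Xi (fun i => Xi (X i))} {ψ : Z ⟶ Xi (fun p : Σ i, J i => X p.1 p.2)} :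
    φ ≫ Gamma X = ψ ↔ φ = ψ ≫ Lambda X := by
  constructor
  · rintro rfl
    rw [Category.assoc, Gamma_Lambda, Category.comp_id]
  · rintro rfl
    rw [Category.assoc, Lambda_Gamma, Category.comp_id]

end GammaLambda

/-! ### Compatibilities of `Λ` and `Γ` -/

section LambdaIdentities

variable {K : Type} {J : K → Type}

theorem sigmaLabel_spec {T : FinLinOrd} (f : T → Σ i, J i) (i : K)
    (t : fiber (T := T) (fun t => (f t).1) i) : f t.1 = ⟨i, sigmaLabel f i t⟩ :=
  (sigmaLabel_eq f t.1 t.2).2 rfl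

theorem sigmaLabel_of_eq {T : FinLinOrd} {f : T → Σ i, J i} {i : K} {j : J i}
    {t : fiber (T := T) (fun t => (f t).1) i} (h : f t.1 = ⟨i, j⟩) : sigmaLabel f i t = j :=
  (sigmaLabel_eq f t.1 t.2).1 h

/-- `Λ` for a single block is the canonical isomorphism `Xi.iota`. -/
theorem reindex_Lambda_iota {U L : Type} [Unique U] (X : AugCosimp) (e : L ≃ Σ _ : U, L)
    (he : ∀ l, e l = ⟨default, l⟩) :
    Xi.reindex e (fun _ => X) ≫ Lambda (fun (_ : U) (_ : L) => X) =
      Xi.iota U (Xi fun _ : L => X) :=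
  Xi.hom_ext fun T f x => by
    rw [compAt_comp, Xi.reindex_mk, Lambda_mk, Xi.iota_apply]
    have hes : ∀ l, e.symm ⟨default, l⟩ = l := fun l => (e.symm_apply_eq).2 (he l).symm
    refine Xi.mk_eq_mk OrderHom.id (fun _ => Subsingleton.elim _ _) (fun _ => rfl) fun i => ?_
    obtain rfl : i = default := Subsingleton.elim _ _
    rw [Xi.ap_mk, Xi.ap_mk]
    refine Xi.mk_eq_mk ?_ ?_ ?_ fun l => ?_
    · exact ⟨fun t => t.1, fun _ _ h => h⟩
    · intro t
      exact (sigmaLabel_of_eq (f := fun t => e (f t)) (he _)).symm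
    · exact fun _ => rfl
    · rw [ap_ap, ap_ap]
      -- The index `e.symm ⟨default, l⟩` equals `l` only propositionally; generalizing it to a
      -- variable lets the transport be eliminated by substitution.
      have key : ∀ (l' : L) (hl : l' = l), ap X (S := fiber f l') (T := fiber f l)
          ⟨fun t => ⟨t.1, t.2.trans hl⟩, fun _ _ h => h⟩ (x l') = x l := by
        rintro l' rfl
        exact ap_eq_self X (fun _ => rfl) _
      exact key _ (hes l)

/-- `Λ` for blocks of size one is induced by the canonical isomorphisms `Xi.iota`. -/
theorem reindex_Lambda_map_iota {U : Type} [Unique U] (X : AugCosimp) (e : K ≃ Σ _ : K, U)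
    (he : ∀ i, e i = ⟨i, default⟩) :
    Xi.reindex e (fun _ => X) ≫ Lambda (fun (_ : K) (_ : U) => X) =
      Xi.map (fun _ => Xi.iota U X) :=
  Xi.hom_ext fun T f x => by
    rw [compAt_comp, Xi.reindex_mk, Lambda_mk, Xi.map_mk]
    have hes : ∀ i, e.symm ⟨i, default⟩ = i := fun i => (e.symm_apply_eq).2 (he i).symm
    refine Xi.mk_eq_mk OrderHom.id (fun t => ?_) (fun _ => rfl) fun i => ?_
    · exact (congrArg Sigma.fst (he (f t))).symm
    rw [Xi.ap_mk, Xi.iota_apply]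
    refine Xi.mk_eq_mk ?_ ?_ ?_ fun u => ?_
    · exact ⟨fun t => ⟨t.1, (congrArg Sigma.fst (he (f t.1))).symm.trans t.2⟩, fun _ _ h => h⟩
    · exact fun _ => Subsingleton.elim _ _
    · exact fun _ => rfl
    · obtain rfl : u = default := Subsingleton.elim _ _
      rw [ap_ap, ap_ap]
      have key : ∀ (l' : K) (hl : l' = i) (g : fiber f l' →o _) (h : fiber f i →o _)
          (_ : ∀ t, (g t).1.1 = t.1) (_ : ∀ t, (h t).1.1 = t.1),
          ap X (T := fiber (T := fiber f i) (fun _ => (default : U)) default) g (x l') =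
            ap X h (x i) := by
        rintro l' rfl g h hg hh
        exact ap_congr X (fun t => Subtype.ext (Subtype.ext ((hg t).trans (hh t).symm))) _
      exact key _ (hes i) _ _ (fun _ => rfl) (fun _ => rfl)

/-- Restricting `T → ∐∐ L_ij` in one stage or in two gives nested preimages with the same underlying
elements of `T`, so the identity on elements is a map of diagrams on each level. -/
theorem Lambda_assoc {L : ∀ i, J i → Type} (X : AugCosimp) :
    Lambda (fun i (_ : Σ j, L i j) => X) ≫
        Xi.map (fun i => Lambda (fun j (_ : L i j) => X)) =
      Xi.reindex (Equiv.sigmaAssoc L).symm (fun _ => X) ≫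
        Lambda (fun (p : Σ i, J i) (_ : L p.1 p.2) => X) ≫
          Lambda (fun i j => Xi fun _ : L i j => X) :=
  Xi.hom_ext fun T f x => by
    rw [compAt_comp, compAt_comp, compAt_comp, Xi.reindex_mk, Lambda_mk, Lambda_mk, Lambda_mk,
      Xi.map_mk]
    refine congrArg (Xi.mk _ _) (funext fun i => ?_)
    rw [Lambda_mk]
    have h1 : ∀ t : fiber (T := T) (fun t => (f t).1) i,
        sigmaLabel (fun t => ((Equiv.sigmaAssoc L).symm (f t)).1) i t = (sigmaLabel f i t).1 := by
      intro t
      refine sigmaLabel_of_eq ?_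
      rw [sigmaLabel_spec f i t]
      rfl
    refine Xi.mk_eq_mk OrderHom.id h1 (fun _ => rfl) fun j => ?_
    refine (Xi.ap_mk _ _ _ _).trans (Eq.trans ?_ (Xi.ap_mk _ _ _ _).symm)
    refine Xi.mk_eq_mk ?_ ?_ ?_ fun l => ?_
    · refine ⟨fun t => ⟨t.1.1, ?_⟩, fun _ _ h => h⟩
      change ((Equiv.sigmaAssoc L).symm (f t.1.1)).1 = _
      rw [sigmaLabel_spec f i t.1]
      exact Sigma.ext rfl (heq_of_eq t.2)
    · intro t
      refine sigmaLabel_of_eq ?_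
      have h2 := sigmaLabel_spec (sigmaLabel f i) j t
      change (Equiv.sigmaAssoc L).symm (f t.1.1) = _
      rw [sigmaLabel_spec f i t.1, h2]
      rfl
    · exact fun _ => rfl
    · simp only [ap_ap]
      rfl

theorem Lambda_map_reindex {J' : K → Type} (X : AugCosimp) (τ : ∀ i, J i ≃ J' i) :
    Lambda (fun i (_ : J i) => X) ≫ Xi.map (fun i => Xi.reindex (τ i) (fun _ => X)) =
      Xi.reindex (Equiv.sigmaCongrRight τ) (fun _ => X) ≫ Lambda (fun i (_ : J' i) => X) :=
  Xi.hom_ext fun T f x => by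
    rw [compAt_comp, compAt_comp, Xi.reindex_mk, Lambda_mk, Lambda_mk, Xi.map_mk]
    refine congrArg (Xi.mk _ _) (funext fun i => ?_)
    rw [Xi.reindex_mk]
    refine Xi.mk_eq_mk OrderHom.id (fun t => ?_) (fun _ => rfl) fun j => ?_
    · refine sigmaLabel_of_eq ?_
      exact congrArg (Equiv.sigmaCongrRight τ) (sigmaLabel_spec f i t)
    · simp only [ap_ap]
      rfl

/-- By `he`, `e` moves the block at `σ k` to the block at `k` without changing positions inside it.
Permuting the outer labels after `Λ`, or all labels before it, then selects the same preimages in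
`T`. -/
theorem Lambda_reindex {K' : Type} {J : K' → Type} (X : AugCosimp) (σ : K ≃ K')
    (e : (Σ l, J l) ≃ Σ k, J (σ k)) (he : ∀ k j, e ⟨σ k, j⟩ = ⟨k, j⟩) :
    Lambda (fun l (_ : J l) => X) ≫ Xi.reindex σ.symm (fun l => Xi fun _ : J l => X) =
      Xi.reindex e (fun _ => X) ≫ Lambda (fun k (_ : J (σ k)) => X) :=
  Xi.hom_ext fun T f x => by
    have hes : ∀ k j, e.symm ⟨k, j⟩ = ⟨σ k, j⟩ := fun k j => (e.symm_apply_eq).2 (he k j).symm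
    have he1 : ∀ p, (e p).1 = σ.symm p.1 := by
      rintro ⟨l, j⟩
      obtain ⟨k, rfl⟩ := σ.surjective l
      rw [he, σ.symm_apply_apply]
    rw [compAt_comp, compAt_comp, Xi.reindex_mk, Lambda_mk, Lambda_mk]
    refine (Xi.reindex_mk _ _ _ _).trans ?_
    refine Xi.mk_eq_mk OrderHom.id (fun t => he1 _) (fun _ => rfl) fun k => ?_
    refine (congrArg _ (Xi.ap_mk _ _ _ _)).trans ?_
    refine (Xi.ap_mk _ _ _ _).trans ?_
    refine Xi.mk_eq_mk ?_ ?_ ?_ fun j => ?_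
    · exact ⟨fun t => ⟨t.1, (he1 _).trans ((congrArg σ.symm t.2).trans (σ.symm_apply_apply k))⟩,
        fun _ _ h => h⟩
    · intro t
      refine sigmaLabel_of_eq ?_
      refine (congrArg e (sigmaLabel_spec f _ t)).trans (he _ _)
    · exact fun _ => rfl
    · have key : ∀ (p : Σ l, J l) (hp : p = ⟨σ k, j⟩) (T' : FinLinOrd) (g : fiber f p →o T')
          (h : fiber f ⟨σ k, j⟩ →o T') (_ : ∀ t t', t.1 = t'.1 → g t = h t'),
          ap X h (x ⟨σ k, j⟩) = ap X g (x p) := by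
        rintro p rfl T' g h hg
        exact ap_congr X (fun t => (hg t t rfl).symm) _
      refine (ap_ap X _ _ _).trans (Eq.trans ?_ (ap_ap X _ _ _).symm)
      exact key _ (hes k j) _ _ _ fun t t' h => Subtype.ext (Subtype.ext h)

end LambdaIdentities

section GammaIdentities

variable {K : Type} [Finite K] {J : K → Type}

theorem iota_Gamma {U L : Type} [Unique U] [Finite U] (X : AugCosimp) (e : L ≃ Σ _ : U, L)
    (he : ∀ l, e l = ⟨default, l⟩) :
    Xi.iota U (Xi fun _ : L => X) ≫ Gamma (fun (_ : U) (_ : L) => X) =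
      Xi.reindex e (fun _ => X) :=
  comp_Gamma_eq_iff.2 (reindex_Lambda_iota X e he).symm

theorem map_iota_Gamma {U : Type} [Unique U] (X : AugCosimp) (e : K ≃ Σ _ : K, U)
    (he : ∀ i, e i = ⟨i, default⟩) :
    Xi.map (fun _ => Xi.iota U X) ≫ Gamma (fun (_ : K) (_ : U) => X) =
      Xi.reindex e (fun _ => X) :=
  comp_Gamma_eq_iff.2 (reindex_Lambda_map_iota X e he).symm

theorem map_reindex_Gamma {J' : K → Type} (X : AugCosimp) (τ : ∀ i, J i ≃ J' i) :
    Xi.map (fun i => Xi.reindex (τ i) (fun _ => X)) ≫ Gamma (fun i (_ : J' i) => X) =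
      Gamma (fun i (_ : J i) => X) ≫ Xi.reindex (Equiv.sigmaCongrRight τ) (fun _ => X) := by
  rw [comp_Gamma_eq_iff, Category.assoc]
  exact eq_Gamma_comp_iff.2 (Lambda_map_reindex X τ)

theorem reindex_Gamma {K' : Type} [Finite K'] {J : K' → Type} (X : AugCosimp) (σ : K ≃ K')
    (e : (Σ l, J l) ≃ Σ k, J (σ k)) (he : ∀ k j, e ⟨σ k, j⟩ = ⟨k, j⟩) :
    Xi.reindex σ.symm (fun l => Xi fun _ : J l => X) ≫ Gamma (fun k (_ : J (σ k)) => X) =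
      Gamma (fun l (_ : J l) => X) ≫ Xi.reindex e (fun _ => X) := by
  refine comp_Gamma_eq_iff.2 ?_
  rw [Category.assoc]
  exact eq_Gamma_comp_iff.2 (Lambda_reindex X σ e he)

/-- All arrows of `Lambda_assoc` are invertible, and this is the identity of their inverses. -/
theorem Gamma_assoc [∀ i, Finite (J i)] {L : ∀ i, J i → Type} (X : AugCosimp) :
    Xi.map (fun i => Gamma (fun j (_ : L i j) => X)) ≫ Gamma (fun i (_ : Σ j, L i j) => X) =
      Gamma (fun i j => Xi fun _ : L i j => X) ≫
        Gamma (fun (p : Σ i, J i) (_ : L p.1 p.2) => X) ≫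
          Xi.reindex (Equiv.sigmaAssoc L) (fun _ => X) := by
  have h1 : Xi.map (fun i => Lambda (fun j (_ : L i j) => X)) ≫
      Xi.map (fun i => Gamma (fun j (_ : L i j) => X)) = 𝟙 _ := by
    rw [← Xi.map_comp]
    simp only [Lambda_Gamma]
    exact Xi.map_id _
  have h2 : Xi.map (fun i => Gamma (fun j (_ : L i j) => X)) ≫
      Xi.map (fun i => Lambda (fun j (_ : L i j) => X)) = 𝟙 _ := by
    rw [← Xi.map_comp]
    simp only [Gamma_Lambda]
    exact Xi.map_id _
  have h3 : Lambda (fun i (_ : Σ j, L i j) => X) =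
      Xi.reindex (Equiv.sigmaAssoc L).symm (fun _ => X) ≫
        Lambda (fun (p : Σ i, J i) (_ : L p.1 p.2) => X) ≫
          Lambda (fun i j => Xi fun _ : L i j => X) ≫
            Xi.map (fun i => Gamma (fun j (_ : L i j) => X)) := by
    have := congrArg (· ≫ Xi.map (fun i => Gamma (fun j (_ : L i j) => X)))
      (Lambda_assoc (J := J) (L := L) X)
    simp only [Category.assoc] at this
    rwa [h1, Category.comp_id] at this
  rw [comp_Gamma_eq_iff, h3]
  simp only [Category.assoc]
  have h4 : Xi.reindex (Equiv.sigmaAssoc L) (fun _ => X) ≫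
      Xi.reindex (Equiv.sigmaAssoc L).symm (fun _ => X) = 𝟙 _ := Xi.reindex_symm_const _ X
  rw [← Category.assoc (Xi.reindex (Equiv.sigmaAssoc L) (fun _ => X)), h4, Category.id_comp,
    ← Category.assoc (Gamma (fun (p : Σ i, J i) (_ : L p.1 p.2) => X)), Gamma_Lambda,
    Category.id_comp]
  rw [← Category.assoc, Gamma_Lambda, Category.id_comp]

end GammaIdentities

/-! ### The operad axioms for `D` -/

/-- Blocks are numbered consecutively: block `p.1` ends before block `q.1` begins. -/
theorem finSigmaFinEquiv_lt {m : ℕ} {n : Fin m → ℕ} {p q : Σ i, Fin (n i)} (h : p.1 < q.1) :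
    finSigmaFinEquiv p < finSigmaFinEquiv q := by
  -- Extending the block sizes by zero turns partial sums over varying types `Fin k` into sums over
  -- `Finset.range`, which can be compared by inclusion.
  let g : ℕ → ℕ := fun i => if h : i < m then n ⟨i, h⟩ else 0
  have hg : ∀ (k : ℕ) (hk : k ≤ m), ∑ i : Fin k, n (Fin.castLE hk i) = ∑ i ∈ Finset.range k, g i := by
    intro k hk
    rw [Finset.sum_range]
    refine Finset.sum_congr rfl fun i _ => ?_
    simp only [g, dif_pos (i.2.trans_le hk)]
    rfl
  rw [Fin.lt_def, finSigmaFinEquiv_apply, finSigmaFinEquiv_apply, hg _ p.1.2.le, hg _ q.1.2.le]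
  have h1 : ∑ i ∈ Finset.range (p.1 + 1), g i ≤ ∑ i ∈ Finset.range q.1, g i :=
    Finset.sum_le_sum_of_subset (Finset.range_subset_range.2 h)
  rw [Finset.sum_range_succ] at h1
  have h2 : g p.1 = n p.1 := by simp only [g, dif_pos p.1.2]
  have := p.2.2
  omega

theorem finSigmaFinEquiv_mk_lt_mk {m : ℕ} {n : Fin m → ℕ} {i : Fin m} {a b : Fin (n i)} :
    finSigmaFinEquiv (n := n) ⟨i, a⟩ < finSigmaFinEquiv ⟨i, b⟩ ↔ a < b := by
  rw [Fin.lt_def, finSigmaFinEquiv_apply, finSigmaFinEquiv_apply]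
  simp only [add_lt_add_iff_left, Fin.lt_def]

/-- A finite total order has no automorphism but the identity, so a numbering is known once it is
known to be increasing. -/
theorem finCongr_eq_of_strictMono {m n : ℕ} (h : m = n) {e : Fin m ≃ Fin n} (he : StrictMono e) :
    e = finCongr h := by
  subst h
  have := Subsingleton.elim (he.orderIsoOfSurjective e e.surjective) (OrderIso.refl (Fin m))
  ext i
  exact congrArg (fun f : Fin m ≃o Fin m => (f i : ℕ)) this

/-- Both numberings of the triples `(a, b, r)` are lexicographic. Their comparison is therefore
increasing, which forces it to be `finCongr`. -/
theorem finSigmaFinEquiv_assoc {k : ℕ} (j : Fin k → ℕ) (l : ∀ a, Fin (j a) → ℕ)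
    (E : (Σ p : Σ a, Fin (j a), Fin (l p.1 p.2)) ≃
      Σ c, Fin (l (finSigmaFinEquiv.symm c).1 (finSigmaFinEquiv.symm c).2))
    (hE : ∀ c r, E ⟨finSigmaFinEquiv.symm c, r⟩ = ⟨c, r⟩) :
    (Equiv.sigmaAssoc fun a b => Fin (l a b)).trans
      ((Equiv.sigmaCongrRight fun a => finSigmaFinEquiv (n := l a)).trans finSigmaFinEquiv) =
      E.trans (finSigmaFinEquiv.trans (finCongr (sum_finSigma j l))) := by
  have h1 : finCongr (sum_finSigma j l) = finSigmaFinEquiv.symm.trans (E.symm.trans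
      ((Equiv.sigmaAssoc fun a b => Fin (l a b)).trans
      ((Equiv.sigmaCongrRight fun a => finSigmaFinEquiv (n := l a)).trans finSigmaFinEquiv))) := by
    refine (finCongr_eq_of_strictMono _ fun u v huv => ?_).symm
    obtain ⟨⟨c, r⟩, rfl⟩ := finSigmaFinEquiv.surjective u
    obtain ⟨⟨d, s⟩, rfl⟩ := finSigmaFinEquiv.surjective v
    have hs : ∀ c r, E.symm ⟨c, r⟩ = ⟨finSigmaFinEquiv.symm c, r⟩ := fun c r =>
      E.symm_apply_eq.2 (hE c r).symm
    have key : ∀ (p q : Σ a, Fin (j a)) (_ : finSigmaFinEquiv p < finSigmaFinEquiv q)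
        (r : Fin (l p.1 p.2)) (s : Fin (l q.1 q.2)),
        finSigmaFinEquiv (n := fun a => ∑ b, l a b) ⟨p.1, finSigmaFinEquiv (n := l p.1) ⟨p.2, r⟩⟩ <
          finSigmaFinEquiv (n := fun a => ∑ b, l a b)
            ⟨q.1, finSigmaFinEquiv (n := l q.1) ⟨q.2, s⟩⟩ := by
      rintro ⟨a, b⟩ ⟨a', b'⟩ h r s
      rcases lt_trichotomy a a' with h' | rfl | h'
      · exact finSigmaFinEquiv_lt h'
      · exact finSigmaFinEquiv_mk_lt_mk.2 (finSigmaFinEquiv_lt (finSigmaFinEquiv_mk_lt_mk.1 h))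
      · exact absurd h (lt_asymm (finSigmaFinEquiv_lt h'))
    simp only [Equiv.trans_apply, Equiv.symm_apply_apply, hs]
    rcases lt_trichotomy c d with h | rfl | h
    · refine key _ _ ?_ r s
      rwa [Equiv.apply_symm_apply, Equiv.apply_symm_apply]
    · have hrs : r < s := (finSigmaFinEquiv_mk_lt_mk
        (n := fun c => l (finSigmaFinEquiv.symm c).1 (finSigmaFinEquiv.symm c).2)).1 huv
      exact finSigmaFinEquiv_mk_lt_mk.2 (finSigmaFinEquiv_mk_lt_mk.2 hrs)
    · exact absurd huv (lt_asymm (finSigmaFinEquiv_lt h))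
  rw [h1]
  ext p
  simp

theorem Xi.reindex_comp_reindex {K L M : Type} {e : K ≃ L} {e' : L ≃ M} {e'' : K ≃ M}
    (h : e.trans e' = e'') (X : AugCosimp) :
    Xi.reindex e (fun _ => X) ≫ Xi.reindex e' (fun _ => X) = Xi.reindex e'' (fun _ => X) := by
  subst h
  exact (Xi.reindex_trans e e' fun _ => X).symm

section SumIdentities

variable (X : AugCosimp)

/-- This is the associativity of the operad composition with the outermost factors stripped off.
Naturality (`e1`) moves the maps `z` past `Γ`, `e2` and `e4` move the numberings of blocks past `Γ`,
`e3` is the associativity of `Γ`, and the numberings left over agree by `finSigmaFinEquiv_assoc`. -/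
theorem map_gammaSum_gammaSum {k : ℕ} (j : Fin k → ℕ) (l : ∀ a, Fin (j a) → ℕ)
    {Y : AugCosimp} (z : ∀ a b, Y ⟶ Xi fun _ : Fin (l a b) => X) :
    Xi.map (fun a => Xi.map (z a) ≫ gammaSum X (l a)) ≫ gammaSum X (fun a => ∑ b, l a b) =
      gammaSum Y j ≫
        Xi.map (fun c => z (finSigmaFinEquiv.symm c).1 (finSigmaFinEquiv.symm c).2) ≫
          gammaSum X (fun c => l (finSigmaFinEquiv.symm c).1 (finSigmaFinEquiv.symm c).2) ≫
            Xi.reindex (finCongr (sum_finSigma j l)) (fun _ => X) := by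
  let E : (Σ p : Σ a, Fin (j a), Fin (l p.1 p.2)) ≃
      Σ c, Fin (l (finSigmaFinEquiv.symm c).1 (finSigmaFinEquiv.symm c).2) :=
    (Equiv.sigmaCongrLeft (β := fun p : Σ a, Fin (j a) => Fin (l p.1 p.2))
      finSigmaFinEquiv.symm).symm
  have hE : ∀ c r, E ⟨finSigmaFinEquiv.symm c, r⟩ = ⟨c, r⟩ := fun c r =>
    (Equiv.symm_apply_eq _).2 rfl
  have e1 : gammaSum Y j ≫
        Xi.map (fun c => z (finSigmaFinEquiv.symm c).1 (finSigmaFinEquiv.symm c).2) =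
      Xi.map (fun a => Xi.map (z a)) ≫ Gamma (fun a b => Xi fun _ : Fin (l a b) => X) ≫
        Xi.reindex finSigmaFinEquiv (fun p : Σ a, Fin (j a) => Xi fun _ : Fin (l p.1 p.2) => X) := by
    have h1 := Xi.reindex_naturality (finSigmaFinEquiv (n := j)) (X := fun _ => Y)
      (Y := fun p => Xi fun _ : Fin (l p.1 p.2) => X) (fun p => z p.1 p.2)
    have h2 := Gamma_naturality (J := fun a => Fin (j a)) (X := fun _ _ => Y)
      (Y := fun a b => Xi fun _ : Fin (l a b) => X) z
    refine (Category.assoc _ _ _).trans ((congrArg (Gamma _ ≫ ·) h1).trans ?_)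
    rw [← Category.assoc, h2, Category.assoc]
  have e2 := reindex_Gamma (J := fun p : Σ a, Fin (j a) => Fin (l p.1 p.2)) X
    finSigmaFinEquiv.symm E hE
  have e3 := Gamma_assoc (J := fun a => Fin (j a)) (L := fun a b => Fin (l a b)) X
  have e4 := map_reindex_Gamma X (fun a => finSigmaFinEquiv (n := l a))
  calc _ = Xi.map (fun a => Xi.map (z a)) ≫
        Xi.map (fun a => Gamma (fun (b : Fin (j a)) (_ : Fin (l a b)) => X)) ≫
        (Xi.map (fun a => Xi.reindex (finSigmaFinEquiv (n := l a)) fun _ => X) ≫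
          Gamma (fun a (_ : Fin (∑ b, l a b)) => X)) ≫ Xi.reindex finSigmaFinEquiv (fun _ => X) := by
        rw [Xi.map_comp]
        simp only [gammaSum]
        rw [Xi.map_comp (fun a => Gamma (fun (b : Fin (j a)) (_ : Fin (l a b)) => X))]
        simp only [Category.assoc]
    _ = Xi.map (fun a => Xi.map (z a)) ≫
        (Xi.map (fun a => Gamma (fun (b : Fin (j a)) (_ : Fin (l a b)) => X)) ≫
          Gamma (fun a (_ : Σ b, Fin (l a b)) => X)) ≫
        Xi.reindex (Equiv.sigmaCongrRight fun a => finSigmaFinEquiv (n := l a)) (fun _ => X) ≫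
        Xi.reindex finSigmaFinEquiv (fun _ => X) := by
        rw [e4]
        simp only [Category.assoc]
    _ = Xi.map (fun a => Xi.map (z a)) ≫ Gamma (fun a b => Xi fun _ : Fin (l a b) => X) ≫
        Gamma (fun (p : Σ a, Fin (j a)) (_ : Fin (l p.1 p.2)) => X) ≫
        Xi.reindex (Equiv.sigmaAssoc fun a b => Fin (l a b)) (fun _ => X) ≫
        Xi.reindex (Equiv.sigmaCongrRight fun a => finSigmaFinEquiv (n := l a)) (fun _ => X) ≫
        Xi.reindex finSigmaFinEquiv (fun _ => X) := by
        rw [e3]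
        simp only [Category.assoc]
    _ = Xi.map (fun a => Xi.map (z a)) ≫ Gamma (fun a b => Xi fun _ : Fin (l a b) => X) ≫
        (Gamma (fun (p : Σ a, Fin (j a)) (_ : Fin (l p.1 p.2)) => X) ≫
        Xi.reindex E (fun _ => X)) ≫ Xi.reindex finSigmaFinEquiv (fun _ => X) ≫
        Xi.reindex (finCongr (sum_finSigma j l)) (fun _ => X) := by
        rw [Xi.reindex_comp_reindex rfl X, Xi.reindex_comp_reindex (finSigmaFinEquiv_assoc j l E hE) X,
          Category.assoc (Gamma _), Xi.reindex_comp_reindex rfl X, Xi.reindex_comp_reindex rfl X]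
    _ = _ := by
        refine (congrArg (fun φ => _ ≫ _ ≫ φ ≫ _) e2.symm).trans ?_
        have := congrArg (· ≫ gammaSum X (fun c => l (finSigmaFinEquiv.symm c).1 (finSigmaFinEquiv.symm c).2) ≫
            Xi.reindex (finCongr (sum_finSigma j l)) (fun _ => X)) e1
        simp only [Category.assoc] at this
        rw [this]
        simp only [gammaSum, Category.assoc]
        rfl

theorem iota_gammaSum (n : ℕ) :
    Xi.iota (Fin 1) (Xi fun _ : Fin n => X) ≫ gammaSum X (fun _ : Fin 1 => n) =
      Xi.reindex (finCongr (by simp)) (fun _ => X) := by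
  let e : Fin n ≃ Σ _ : Fin 1, Fin n := (Equiv.uniqueSigma fun _ : Fin 1 => Fin n).symm
  have he : ∀ l, e l = ⟨default, l⟩ := fun l => rfl
  have h := iota_Gamma (U := Fin 1) X e he
  refine (Category.assoc _ _ _).symm.trans ((congrArg (· ≫ _) h).trans ?_)
  refine Xi.reindex_comp_reindex ?_ X
  ext l
  refine (finSigmaFinEquiv_apply (n := fun _ : Fin 1 => n) ⟨0, l⟩).trans ?_
  exact Nat.zero_add _

theorem map_iota_gammaSum (n : ℕ) :
    Xi.map (fun _ => Xi.iota (Fin 1) X) ≫ gammaSum X (fun _ : Fin n => 1) =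
      Xi.reindex (finCongr (by simp)) (fun _ => X) := by
  let e : Fin n ≃ Σ _ : Fin n, Fin 1 := (Equiv.sigmaUnique (Fin n) fun _ => Fin 1).symm
  have he : ∀ l, e l = ⟨l, default⟩ := fun l => rfl
  have h := map_iota_Gamma (U := Fin 1) X e he
  refine (Category.assoc _ _ _).symm.trans ((congrArg (· ≫ _) h).trans ?_)
  refine Xi.reindex_comp_reindex ?_ X
  ext l
  simp [he]

theorem map_reindex_gammaSum {k : ℕ} {j j' : Fin k → ℕ} (τ : ∀ i, Fin (j i) ≃ Fin (j' i)) :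
    Xi.map (fun i => Xi.reindex (τ i) (fun _ => X)) ≫ gammaSum X j' =
      gammaSum X j ≫ Xi.reindex (blockSum τ) (fun _ => X) := by
  have h := map_reindex_Gamma X τ
  refine (Category.assoc _ _ _).symm.trans ((congrArg (· ≫ _) h).trans ?_)
  rw [gammaSum, Category.assoc, Category.assoc]
  refine congrArg (_ ≫ ·) ?_
  refine (Xi.reindex_comp_reindex ?_ X).trans (Xi.reindex_comp_reindex rfl X).symm
  ext p
  simp [blockSum]

theorem reindex_map_gammaSum {k k' : ℕ} (σ : Fin k ≃ Fin k') (j : Fin k' → ℕ) {Y : AugCosimp}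
    (y : ∀ i, Y ⟶ Xi fun _ : Fin (j i) => X) :
    Xi.reindex σ (fun _ => Y) ≫ Xi.map y ≫ gammaSum X j =
      Xi.map (fun i => y (σ i)) ≫ gammaSum X (fun i => j (σ i)) ≫
        Xi.reindex (blockPerm σ j) (fun _ => X) := by
  let E : (Σ p, Fin (j p)) ≃ Σ c, Fin (j (σ c)) :=
    (Equiv.sigmaCongrLeft (β := fun p => Fin (j p)) σ).symm
  have hE : ∀ c r, E ⟨σ c, r⟩ = ⟨c, r⟩ := fun c r => (Equiv.symm_apply_eq _).2 rfl
  -- Naturality replaces the permuted family by the original one, conjugated by the reindexing along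
  -- `σ`.
  have e1 : Xi.map (fun i => y (σ i)) = Xi.reindex σ (fun _ => Y) ≫ Xi.map y ≫
      Xi.reindex σ.symm (fun l => Xi fun _ : Fin (j l) => X) := by
    have h1 := Xi.reindex_naturality σ.symm (X := fun _ => Y)
      (Y := fun l => Xi fun _ : Fin (j l) => X) y
    rw [← h1]
    refine Eq.trans ?_ (Category.assoc _ _ _)
    refine Eq.trans ?_ (congrArg (· ≫ _) (Xi.reindex_symm_const σ Y).symm)
    exact (Category.id_comp _).symm
  have e2 := reindex_Gamma (J := fun l => Fin (j l)) X σ E hE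
  rw [e1]
  simp only [gammaSum, Category.assoc]
  refine congrArg (_ ≫ _ ≫ ·) ?_
  refine Eq.trans ?_ ((congrArg (· ≫ _) e2.symm).trans (Category.assoc _ _ _))
  rw [Category.assoc]
  refine congrArg (_ ≫ ·) (Eq.symm ?_)
  rw [Xi.reindex_comp_reindex rfl X]
  refine Xi.reindex_comp_reindex ?_ X
  ext p
  simp [blockPerm, E]

end SumIdentities

/-! ### Continuous families of maps of augmented cosimplicial spaces -/

/-- A family of maps `A → B`, indexed by a space, whose components are jointly continuous. -/
def JointlyCont {Z : Type} [TopologicalSpace Z] {A B : AugCosimp} (φ : Z → (A ⟶ B)) : Prop :=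
  ∀ S : FinLinOrd, KCont (fun p : Z × A.obj S => compAt (φ p.1) S p.2)

namespace JointlyCont

variable {Z : Type} [TopologicalSpace Z] {A B C : AugCosimp}

theorem const (φ : A ⟶ B) : JointlyCont (fun _ : Z => φ) := fun S =>
  Continuous.continuousGeneratedBy ((compAt φ S).continuous.comp continuous_snd)

theorem comp {φ : Z → (A ⟶ B)} {ψ : Z → (B ⟶ C)} (hφ : JointlyCont φ) (hψ : JointlyCont ψ) :
    JointlyCont (fun z => φ z ≫ ψ z) := fun S =>
  ContinuousGeneratedBy.comp (hψ S) (f := fun p : Z × A.obj S => (p.1, compAt (φ p.1) S p.2))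
    fun _ u => (continuous_fst.comp u.continuous).prodMk (hφ S u)

theorem isJointQuotient_id (Z : Type) [TopologicalSpace Z] :
    IsJointQuotient (fun (_ : Unit) (z : Z) => z) where
  surj z := ⟨(), z, rfl⟩
  desc _ _ _ h := h ()

/-- Joint continuity of a family of maps out of `Ξ_K(A)` may be tested on representatives. -/
theorem of_mk {K : Type} {A : K → AugCosimp} {φ : Z → (Xi A ⟶ C)}
    (h : ∀ (S T : FinLinOrd) (f : T → K) (g : T →o S),
      KCont fun p : Z × (∀ i, (A i).obj (fiber f i)) => compAt (φ p.1) S (Xi.mk f g p.2)) :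
    JointlyCont φ := fun S => by
  -- Joint quotients are stable under products in compactly generated spaces, so the parameter space
  -- `Z` may be carried along unchanged.
  refine ((isJointQuotient_id Z).prod (Xi.isJointQuotient (X := A) S)).desc _ _ fun a => ?_
  have h1 : KCont (fun p : Z × XiProd A a.2.f =>
      compAt (φ p.1) S (Xi.mk a.2.f a.2.h (WithGeneratedByTopology.equiv p.2))) :=
    ContinuousGeneratedBy.comp (h S _ a.2.f a.2.h)
      (f := fun p : Z × XiProd A a.2.f => (p.1, WithGeneratedByTopology.equiv p.2))
      (Continuous.continuousGeneratedBy (continuous_fst.prodMk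
        (WithGeneratedByTopology.continuous_equiv.comp continuous_snd)))
  exact fun _ u => (h1 u).congr fun k =>
    (congrArg (compAt (φ (u k).1) S) (Xi.quot_mk_eq a.2 (u k).2)).symm

theorem map {K : Type} {A B : K → AugCosimp} {φ : Z → ∀ i, A i ⟶ B i}
    (hφ : ∀ i, JointlyCont fun z => φ z i) : JointlyCont fun z => Xi.map (φ z) :=
  of_mk fun S T f g => by
    simp only [Xi.map_mk]
    refine ContinuousGeneratedBy.comp (Xi.continuous_mk f g)
      (f := fun (p : Z × (∀ i, (A i).obj (fiber f i))) i => compAt (φ p.1 i) _ (p.2 i))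
      (kcont_pi fun i => ?_)
    exact ContinuousGeneratedBy.comp (hφ i (fiber f i))
      (f := fun p : Z × (∀ i, (A i).obj (fiber f i)) => (p.1, p.2 i))
      (Continuous.continuousGeneratedBy (by fun_prop))

end JointlyCont

/-! ### Continuous maps into the spaces `Tot` -/

instance (S : FinLinOrd) : CompactSpace (Simp.obj S) :=
  inferInstanceAs (CompactSpace (stdSimplex ℝ S))

instance (S : FinLinOrd) : T2Space (Simp.obj S) :=
  inferInstanceAs (T2Space (stdSimplex ℝ S))

instance (X : AugCosimp) : IsGeneratedBy CH (Tot X) :=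
  letI : TopologicalSpace (Simp ⟶ X) :=
    ⨅ S : FinLinOrd, TopologicalSpace.induced (fun φ : Simp ⟶ X => compAt φ S) inferInstance
  inferInstanceAs (IsGeneratedBy CH (Kify (Simp ⟶ X)))

theorem Tot.continuous_compAt (X : AugCosimp) (S : FinLinOrd) :
    Continuous (fun φ : Tot X => compAt (X := Simp) (Y := X) φ S) :=
  continuous_iff_le_induced.2 ((TopologicalSpace.generatedBy_le (X := CH)
    (tY := ⨅ S : FinLinOrd, TopologicalSpace.induced (fun φ : Simp ⟶ X => compAt φ S)
      inferInstance)).trans (iInf_le _ S))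

/-- A map from a compact Hausdorff space to `Tot(X)` is continuous if and only if it is a jointly
continuous family of maps. -/
theorem Tot.continuous_iff {Z : Type} [TopologicalSpace Z] [CompactSpace Z] [T2Space Z]
    {X : AugCosimp} (φ : Z → Tot X) :
    Continuous φ ↔ JointlyCont (A := Simp) (B := X) φ := by
  constructor
  · intro h S
    -- `Δ^S` is compact Hausdorff, hence locally compact, so a continuous map to the mapping space
    -- can be uncurried.
    exact Continuous.continuousGeneratedBy
      (ContinuousMap.continuous_uncurry_of_continuous
        ⟨_, (Tot.continuous_compAt X S).comp h⟩)
  · intro h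
    have hc : @Continuous Z (Tot X) _ (⨅ S : FinLinOrd,
        TopologicalSpace.induced (fun φ : Simp ⟶ X => compAt φ S) inferInstance) φ := by
      refine continuous_iInf_rng.2 fun S => continuous_induced_rng.2 ?_
      exact ContinuousMap.continuous_of_continuous_uncurry _ (KCont.continuous (h S))
    -- As `Z` is compact Hausdorff, `φ` is one of the test maps whose coinduced topologies define
    -- the topology of `Tot X`.
    refine continuous_iff_coinduced_le.2 ?_
    exact le_iSup_of_le (CompHaus.of Z) (le_iSup_of_le (@ContinuousMap.mk _ _ _ (_) φ hc) le_rfl)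

theorem Tot.kcont_iff {Z : Type u} [TopologicalSpace Z] {X : AugCosimp} (φ : Z → Tot X) :
    KCont φ ↔ ∀ (K : CompHaus.{0}) (u : C(CH K, Z)),
      JointlyCont (A := Simp) (B := X) fun k => φ (u k) :=
  forall₂_congr fun _ _ => Tot.continuous_iff _

/-! ### The operad structure of `D` -/

theorem D_isOperad : D.IsOperad where
  isGeneratedBy n := inferInstanceAs (IsGeneratedBy CH (Tot (Xi fun _ : Fin n => Simp)))
  continuous_map {m n} e := by
    have : IsGeneratedBy CH (D.obj m) :=
      inferInstanceAs (IsGeneratedBy CH (Tot (Xi fun _ : Fin m => Simp)))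
    refine (IsGeneratedBy.continuous_iff CH _).2
      ((Tot.kcont_iff (X := Xi fun _ : Fin n => Simp) _).2 fun K u => ?_)
    exact ((Tot.continuous_iff _).1 u.continuous).comp (.const _)
  continuous_comp {k} j := by
    refine (Tot.kcont_iff (X := Xi fun _ => Simp) _).2 fun K u => ?_
    refine JointlyCont.comp ((Tot.continuous_iff (X := Xi fun _ : Fin k => Simp) _).1
      (continuous_fst.comp u.continuous)) (JointlyCont.comp (.map fun i => ?_) (.const _))
    exact (Tot.continuous_iff (X := Xi fun _ : Fin (j i) => Simp) _).1
      ((continuous_apply i).comp (continuous_snd.comp u.continuous))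
  map_refl {n} x := by
    refine (congrArg (_ ≫ ·) (Xi.reindex_refl fun _ : Fin n => Simp)).trans ?_
    exact Category.comp_id (X := (Simp : AugCosimp)) _
  map_trans e e' x := by
    refine (congrArg (_ ≫ ·) (Xi.reindex_trans e e' fun _ => Simp)).trans ?_
    exact (Category.assoc (W := (Simp : AugCosimp)) _ _ _).symm
  one_comp {n} x := by
    have h : ∀ x : Simp ⟶ Xi fun _ : Fin n => Simp,
        Xi.iota (Fin 1) Simp ≫ Xi.map (fun _ => x) ≫ gammaSum Simp (fun _ : Fin 1 => n) =
          x ≫ Xi.reindex (finCongr (by simp)) (fun _ => Simp) := fun x => by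
      rw [← Category.assoc, Xi.iota_naturality, Category.assoc, iota_gammaSum]
    exact h x
  comp_one {n} x := congrArg ((x : Simp ⟶ Xi fun _ : Fin n => Simp) ≫ ·) (map_iota_gammaSum Simp n)
  comp_assoc {k} j l x y z := by
    have h : ∀ (x : Simp ⟶ Xi fun _ : Fin k => Simp) (y : ∀ a, Simp ⟶ Xi fun _ : Fin (j a) => Simp)
        (z : ∀ a b, Simp ⟶ Xi fun _ : Fin (l a b) => Simp),
        x ≫ Xi.map (fun a => y a ≫ Xi.map (z a) ≫ gammaSum Simp (l a)) ≫
          gammaSum Simp (fun a => ∑ b, l a b) =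
        ((x ≫ Xi.map y ≫ gammaSum Simp j) ≫
          Xi.map (fun c => z (finSigmaFinEquiv.symm c).1 (finSigmaFinEquiv.symm c).2) ≫
          gammaSum Simp (fun c => l (finSigmaFinEquiv.symm c).1 (finSigmaFinEquiv.symm c).2)) ≫
          Xi.reindex (finCongr (sum_finSigma j l)) (fun _ => Simp) := fun x y z => by
      rw [Xi.map_comp y]
      simp only [Category.assoc]
      exact congrArg (fun φ => x ≫ Xi.map y ≫ φ) (map_gammaSum_gammaSum Simp j l z)
    exact h x y z
  comp_map_right {k j j'} τ x y := by
    have h : ∀ (x : Simp ⟶ Xi fun _ : Fin k => Simp) (y : ∀ a, Simp ⟶ Xi fun _ : Fin (j a) => Simp),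
        x ≫ Xi.map (fun i => y i ≫ Xi.reindex (τ i) (fun _ => Simp)) ≫ gammaSum Simp j' =
        (x ≫ Xi.map y ≫ gammaSum Simp j) ≫ Xi.reindex (blockSum τ) (fun _ => Simp) := fun x y => by
      rw [Xi.map_comp y]
      simp only [Category.assoc]
      exact congrArg (fun φ => x ≫ Xi.map y ≫ φ) (map_reindex_gammaSum Simp τ)
    exact h x y
  comp_map_left {k k'} σ j x y := by
    have h : ∀ (x : Simp ⟶ Xi fun _ : Fin k => Simp) (y : ∀ a, Simp ⟶ Xi fun _ : Fin (j a) => Simp),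
        (x ≫ Xi.reindex σ (fun _ => Simp)) ≫ Xi.map y ≫ gammaSum Simp j =
        (x ≫ Xi.map (fun i => y (σ i)) ≫ gammaSum Simp (fun i => j (σ i))) ≫
          Xi.reindex (blockPerm σ j) (fun _ => Simp) := fun x y => by
      refine (Category.assoc _ _ _).trans ?_
      refine (congrArg (x ≫ ·) (reindex_map_gammaSum Simp σ j y)).trans ?_
      simp only [Category.assoc]
    exact h x y

/-! ### The action of `D` on `Tot` of a `Ξ`-algebra -/

theorem gammaSum_naturality {X Y : AugCosimp} {k : ℕ} (j : Fin k → ℕ)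
    (y : Fin (∑ i, j i) → (X ⟶ Y)) :
    gammaSum X j ≫ Xi.map y =
      Xi.map (fun i => Xi.map fun b => y (finSigmaFinEquiv ⟨i, b⟩)) ≫ gammaSum Y j := by
  have h1 := Xi.reindex_naturality (finSigmaFinEquiv (n := j)) (X := fun _ => X) (Y := fun _ => Y)
    (fun p => y (finSigmaFinEquiv p))
  simp only [Equiv.apply_symm_apply] at h1
  have h2 := Gamma_naturality (J := fun i => Fin (j i)) (X := fun _ _ => X) (Y := fun _ _ => Y)
    (fun i b => y (finSigmaFinEquiv ⟨i, b⟩))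
  refine (Category.assoc _ _ _).trans ((congrArg (_ ≫ ·) h1).trans ?_)
  refine (Category.assoc _ _ _).symm.trans ((congrArg (· ≫ _) h2).trans ?_)
  exact Category.assoc _ _ _

/-- A `Ξ`-algebra structure is invariant under all bijections. -/
theorem XiAlgebra.reindex_act {X : AugCosimp} (A : XiAlgebra X) {m n : ℕ} (e : Fin m ≃ Fin n) :
    Xi.reindex e (fun _ => X) ≫ A.act n = A.act m := by
  obtain rfl : m = n := by simpa using Fintype.card_congr e
  exact A.equivariant e

theorem XiAlgebra.isAction {X : AugCosimp} (A : XiAlgebra X) : D.IsAction A.totAction where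
  isGeneratedBy := inferInstance
  continuous k := by
    refine (Tot.kcont_iff _).2 fun K u => ?_
    refine JointlyCont.comp ((Tot.continuous_iff (X := Xi fun _ : Fin k => Simp) _).1
      (continuous_fst.comp u.continuous)) (JointlyCont.comp (.map fun i => ?_) (.const _))
    exact (Tot.continuous_iff (X := X) _).1
      ((continuous_apply i).comp (continuous_snd.comp u.continuous))
  one y := by
    have h : ∀ y : Simp ⟶ X, Xi.iota (Fin 1) Simp ≫ Xi.map (fun _ => y) ≫ A.act 1 = y := fun y => by
      rw [← Category.assoc, Xi.iota_naturality, Category.assoc, A.unit, Category.comp_id]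
    exact h y
  comp {k} j x z y := by
    have h : ∀ (x : Simp ⟶ Xi fun _ : Fin k => Simp) (z : ∀ a, Simp ⟶ Xi fun _ : Fin (j a) => Simp)
        (y : Fin (∑ i, j i) → (Simp ⟶ X)),
        (x ≫ Xi.map z ≫ gammaSum Simp j) ≫ Xi.map y ≫ A.act (∑ i, j i) =
        x ≫ Xi.map (fun i => z i ≫ Xi.map (fun b => y (finSigmaFinEquiv ⟨i, b⟩)) ≫ A.act (j i)) ≫
          A.act k := fun x z y => by
      rw [Xi.map_comp z, Xi.map_comp (fun i => Xi.map fun b => y (finSigmaFinEquiv ⟨i, b⟩))]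
      simp only [Category.assoc]
      rw [A.assoc, ← Category.assoc (gammaSum Simp j), gammaSum_naturality, Category.assoc]
    exact h x z y
  map {m n} e x y := by
    have h : ∀ (x : Simp ⟶ Xi fun _ : Fin m => Simp) (y : Fin n → (Simp ⟶ X)),
        (x ≫ Xi.reindex e (fun _ => Simp)) ≫ Xi.map y ≫ A.act n =
          x ≫ Xi.map (fun i => y (e i)) ≫ A.act m := fun x y => by
      have h1 := Xi.reindex_naturality e (X := fun _ => Simp) (Y := fun _ => X)
        (fun p => y (e p))
      simp only [Equiv.apply_symm_apply] at h1
      refine (Category.assoc _ _ _).trans (congrArg (x ≫ ·) ?_)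
      refine (Category.assoc _ _ _).symm.trans ((congrArg (· ≫ A.act n) h1).trans ?_)
      exact (Category.assoc _ _ _).trans (congrArg (_ ≫ ·) (A.reindex_act e))
    exact h x y

/-! ### Barycentric coordinates -/

namespace Simp

variable {S T : FinLinOrd}

/-- The barycentric coordinates of a point of `Δ^S`. -/
def coord (x : Simp.obj S) (s : S) : ℝ := (show stdSimplex ℝ S from x).1 s

theorem coord_nonneg (x : Simp.obj S) (s : S) : 0 ≤ coord x s :=
  (show stdSimplex ℝ S from x).2.1 s

theorem sum_coord (x : Simp.obj S) : ∑ s, coord x s = 1 :=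
  (show stdSimplex ℝ S from x).2.2

theorem ext {x y : Simp.obj S} (h : ∀ s, coord x s = coord y s) : x = y :=
  Subtype.ext (funext h)

/-- The point of `Δ^S` with given barycentric coordinates. -/
def ofCoord (w : S → ℝ) (h0 : ∀ s, 0 ≤ w s) (h1 : ∑ s, w s = 1) : Simp.obj S :=
  (⟨w, h0, h1⟩ : stdSimplex ℝ S)

theorem coord_ofCoord (w : S → ℝ) (h0 : ∀ s, 0 ≤ w s) (h1 : ∑ s, w s = 1) (s : S) :
    coord (ofCoord w h0 h1) s = w s := rfl

theorem continuous_coord (s : S) : Continuous fun x : Simp.obj S => coord x s :=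
  (continuous_apply s).comp continuous_subtype_val

theorem continuous_of_coord {Z : Type u} [TopologicalSpace Z] {φ : Z → Simp.obj S}
    (h : ∀ s, Continuous fun z => coord (φ z) s) : Continuous φ :=
  Continuous.subtype_mk (continuous_pi h) _

open Classical in
theorem coord_ap (g : S →o T) (x : Simp.obj S) (t : T) :
    coord (ap Simp g x) t = ∑ s, if g s = t then coord x s else 0 := by
  refine (FunOnFinite.linearMap_apply_apply ℝ ℝ g (show stdSimplex ℝ S from x).1 t).trans ?_
  rw [Finset.sum_filter]
  refine Finset.sum_congr rfl fun s _ => ?_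
  congr

/-- Coordinates are nonnegative, so nothing cancels: the support of the image is the image of the
support. -/
theorem coord_ap_pos_iff (g : S →o T) (x : Simp.obj S) (t : T) :
    0 < coord (ap Simp g x) t ↔ ∃ s, g s = t ∧ 0 < coord x s := by
  classical
  rw [coord_ap]
  constructor
  · intro h
    obtain ⟨s, _, hs⟩ := Finset.exists_lt_of_sum_lt (s := Finset.univ) (f := fun _ : S => (0 : ℝ))
      (by simpa using h)
    by_cases hst : g s = t
    · exact ⟨s, hst, by simpa [hst] using hs⟩
    · simp [hst] at hs
  · rintro ⟨s, hst, hs⟩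
    refine Finset.sum_pos' (fun s _ => ?_) ⟨s, Finset.mem_univ _, by simpa [hst] using hs⟩
    split_ifs
    · exact coord_nonneg x s
    · exact le_rfl

/-- The coordinates sum to one, so they do not all vanish. Here `Δ^∅ = ∅` enters the proof of
freeness: every label occurs in every point. -/
theorem exists_coord_pos (x : Simp.obj S) : ∃ s, 0 < coord x s := by
  by_contra! h
  have h1 := sum_coord x
  rw [Finset.sum_eq_zero fun s _ => le_antisymm (h s) (coord_nonneg x s)] at h1
  exact zero_ne_one h1

theorem exists_first_coord_pos (x : Simp.obj S) :
    ∃ s, 0 < coord x s ∧ ∀ t, 0 < coord x t → s ≤ t := by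
  obtain ⟨s, hs, hmin⟩ := (Set.toFinite {s | 0 < coord x s}).exists_minimalFor id _ (exists_coord_pos x)
  exact ⟨s, hs, fun t ht => (le_total s t).elim (fun h => h) (hmin ht)⟩

end Simp

/-! ### Freeness of the action of the symmetric groups -/

section Free

variable {K L : Type}

/-- The first point of the support of `x_i` precedes the support of `x_j`. -/
def Precedes {T : FinLinOrd} (f : T → K) (x : ∀ i, Simp.obj (fiber f i)) (i j : K) : Prop :=
  ∃ s : fiber f i, 0 < Simp.coord (x i) s ∧
    ∀ t : fiber f j, 0 < Simp.coord (x j) t → s.1 < t.1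

/-- A monotone map could merge neighbouring elements, but `f' ∘ g = f` keeps elements with different
labels apart, so strict precedence survives in both directions. -/
theorem precedes_map {T T' : FinLinOrd} {f : T → K} {f' : T' → K} (g : T →o T')
    (hg : ∀ t, f' (g t) = f t) (x : ∀ i, Simp.obj (fiber f i)) (i j : K) :
    Precedes f' (fun i => ap Simp (fiberMap g hg i) (x i)) i j ↔ Precedes f x i j := by
  constructor
  · rintro ⟨s', hs', h⟩
    obtain ⟨s, rfl, hs⟩ := (Simp.coord_ap_pos_iff _ _ _).1 hs'
    refine ⟨s, hs, fun t ht => ?_⟩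
    exact g.monotone.reflect_lt (h (fiberMap g hg j t) ((Simp.coord_ap_pos_iff _ _ _).2 ⟨t, rfl, ht⟩))
  · rintro ⟨s, hs, h⟩
    refine ⟨fiberMap g hg i s, (Simp.coord_ap_pos_iff _ _ _).2 ⟨s, rfl, hs⟩, fun t' ht' => ?_⟩
    obtain ⟨t, rfl, ht⟩ := (Simp.coord_ap_pos_iff _ _ _).1 ht'
    -- If the images coincided, the labels would be equal, and then `h` applied to `s` itself would
    -- give `s < s`.
    refine lt_of_le_of_ne (g.monotone (h t ht).le) fun hst => ?_
    have hij : i = j := by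
      rw [← s.2, ← t.2, ← hg, ← hg]
      exact congrArg f' hst
    subst hij
    exact lt_irrefl _ (h s hs)

/-- The order in which the labels first occur in a point of `Ξ_K(Δ^•)^S`. -/
def labelOrder {S : FinLinOrd} (w : (Xi fun _ : K => Simp).obj S) : K → K → Prop :=
  Quot.lift (fun p : Σ a : XiIndex K S, XiProd (fun _ => Simp) a.f =>
    Precedes p.1.f (WithGeneratedByTopology.equiv p.2)) (by
      rintro ⟨a, x⟩ ⟨b, y⟩ ⟨g, hf, hh, hx⟩
      funext i j
      refine propext ?_
      refine Iff.trans (precedes_map g hf _ i j).symm ?_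
      rw [show y = _ from hx]
      rfl) w

theorem labelOrder_mk {S T : FinLinOrd} (f : T → K) (h : T →o S) (x : ∀ i, Simp.obj (fiber f i)) :
    labelOrder (Xi.mk (X := fun _ => Simp) f h x) = Precedes f x := by
  funext i j
  exact propext (precedes_map (f' := f ∘ enumHom T) (enumInv T)
    (fun t => congrArg f (enumHom_enumInv T t)) x i j)

theorem labelOrder_irrefl {S : FinLinOrd} (w : (Xi fun _ : K => Simp).obj S) (i : K) :
    ¬ labelOrder w i i := by
  induction w using Xi.ind with
  | H T f h x =>
    rw [labelOrder_mk]
    rintro ⟨s, hs, h⟩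
    exact lt_irrefl _ (h s hs)

theorem labelOrder_trans {S : FinLinOrd} (w : (Xi fun _ : K => Simp).obj S) {i j k : K}
    (hij : labelOrder w i j) (hjk : labelOrder w j k) : labelOrder w i k := by
  induction w using Xi.ind with
  | H T f h x =>
    rw [labelOrder_mk] at *
    obtain ⟨s, hs, h1⟩ := hij
    obtain ⟨t, ht, h2⟩ := hjk
    exact ⟨s, hs, fun r hr => (h1 t ht).trans (h2 r hr)⟩

/-- Both supports have a first element, and these two elements differ because their labels do. -/
theorem labelOrder_total {S : FinLinOrd} (w : (Xi fun _ : K => Simp).obj S) {i j : K}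
    (hij : i ≠ j) : labelOrder w i j ∨ labelOrder w j i := by
  induction w using Xi.ind with
  | H T f h x =>
    rw [labelOrder_mk]
    obtain ⟨s, hs, h1⟩ := Simp.exists_first_coord_pos (x i)
    obtain ⟨t, ht, h2⟩ := Simp.exists_first_coord_pos (x j)
    have hst : s.1 ≠ t.1 := fun h => hij (by rw [← s.2, ← t.2, h])
    rcases hst.lt_or_gt with h | h
    · exact Or.inl ⟨s, hs, fun r hr => lt_of_lt_of_le h (h2 r hr)⟩
    · exact Or.inr ⟨t, ht, fun r hr => lt_of_lt_of_le h (h1 r hr)⟩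

theorem labelOrder_reindex {S : FinLinOrd} (e : K ≃ L) (w : (Xi fun _ : K => Simp).obj S) (i j : L) :
    labelOrder (compAt (Xi.reindex e fun _ => Simp) S w) i j ↔
      labelOrder w (e.symm i) (e.symm j) := by
  induction w using Xi.ind with
  | H T f h x =>
    rw [Xi.reindex_mk, labelOrder_mk, labelOrder_mk]
    constructor
    · rintro ⟨s', hs', h⟩
      obtain ⟨s, rfl, hs⟩ := (Simp.coord_ap_pos_iff _ _ _).1 hs'
      exact ⟨s, hs, fun t ht => h (reindexFiber e f j t) ((Simp.coord_ap_pos_iff _ _ _).2 ⟨t, rfl, ht⟩)⟩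
    · rintro ⟨s, hs, h⟩
      refine ⟨reindexFiber e f i s, (Simp.coord_ap_pos_iff _ _ _).2 ⟨s, rfl, hs⟩, fun t' ht' => ?_⟩
      obtain ⟨t, rfl, ht⟩ := (Simp.coord_ap_pos_iff _ _ _).1 ht'
      exact h t ht

/-- A permutation which preserves a strict total order on a finite set is the identity. -/
theorem perm_eq_one_of_strictOrder [Finite K] {r : K → K → Prop} (irrefl : ∀ i, ¬ r i i)
    (trans : ∀ {i j k}, r i j → r j k → r i k) (total : ∀ {i j}, i ≠ j → r i j ∨ r j i)
    (σ : Equiv.Perm K) (hσ : ∀ i j, r (σ i) (σ j) ↔ r i j) : σ = 1 := by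
  -- The number of predecessors separates the elements, and `σ` preserves it.
  have hlt : ∀ {i j}, r i j → {k | r k i}.ncard < {k | r k j}.ncard := fun {i j} hij =>
    Set.ncard_lt_ncard (Set.ssubset_iff_of_subset (fun k hk => trans hk hij) |>.2
      ⟨i, hij, irrefl i⟩) (Set.toFinite _)
  have hcard : ∀ i, {k | r k (σ i)}.ncard = {k | r k i}.ncard := fun i => by
    rw [← Set.ncard_image_of_injective {k | r k i} σ.injective]
    congr 1
    ext k
    obtain ⟨k, rfl⟩ := σ.surjective k
    simp [hσ]
  ext i
  by_contra h
  rcases total h with h | h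
  · exact (hlt h).ne (hcard i)
  · exact (hlt h).ne' (hcard i)

/-- Reindexing transports `labelOrder`, so `σ` preserves the label order of a point that it fixes.
-/
theorem reindex_free [Finite K] {S : FinLinOrd} (w : (Xi fun _ : K => Simp).obj S)
    (σ : Equiv.Perm K) (h : compAt (Xi.reindex σ fun _ => Simp) S w = w) : σ = 1 := by
  refine perm_eq_one_of_strictOrder (labelOrder_irrefl w) (labelOrder_trans w)
    (labelOrder_total w) σ fun i j => ?_
  conv_lhs => rw [← h]
  rw [labelOrder_reindex, σ.symm_apply_apply, σ.symm_apply_apply]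

theorem D_free {n : ℕ} (σ : Equiv.Perm (Fin n)) (x : D.obj n) (h : D.map σ x = x) : σ = 1 := by
  -- A fixed map fixes each of its values, and one value suffices: the point of the simplex with one
  -- vertex supplies it.
  let v : Simp.obj (fin 1) := Simp.ofCoord (fun _ => 1) (fun _ => zero_le_one) (by simp)
  exact reindex_free (compAt (X := Simp) (Y := Xi fun _ : Fin n => Simp) x (fin 1) v) σ
    (congrArg (fun φ : Simp ⟶ Xi fun _ : Fin n => Simp => compAt φ (fin 1) v) h)

end Free

/-! ### `D(0)` is a point -/

/-- A map `T → ∅` forces `T = ∅`, so every diagram represents the same point as the empty one. -/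
theorem Xi.eq_of_isEmpty {K : Type} [IsEmpty K] {X : K → AugCosimp} {S : FinLinOrd}
    (w w' : (Xi X).obj S) : w = w' := by
  have h : ∀ w : (Xi X).obj S, w = Xi.mk (T := fin 0) (Fin.elim0) ⟨Fin.elim0, fun i => i.elim0⟩
      (fun i => isEmptyElim i) := by
    intro w
    induction w using Xi.ind with
    | H T f h x =>
      exact Xi.mk_eq_mk ⟨fun t => isEmptyElim (f t), fun t => isEmptyElim (f t)⟩
        (fun t => isEmptyElim (f t)) (fun t => isEmptyElim (f t)) (fun i => isEmptyElim i)
  rw [h w, h w']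

theorem D_zero : Nonempty (Unique (D.obj 0)) := by
  let φ : Simp ⟶ Xi (fun _ : Fin 0 => Simp) :=
    mkHom (fun S => ⟨fun _ => Xi.mk (T := fin 0) (Fin.elim0) ⟨Fin.elim0, fun i => i.elim0⟩
      (fun i => isEmptyElim i), continuous_const⟩) fun _ _ => Xi.eq_of_isEmpty _ _
  exact ⟨⟨⟨φ⟩, fun ψ => hom_ext fun S x => Xi.eq_of_isEmpty _ _⟩⟩

/-! ### Finite measures on finite ordered sets -/

section Mass

variable {P Q S : Type} [Fintype P]

/-- The total weight of a set. -/
def mass (w : P → ℝ) (A : Set P) : ℝ := ∑ a, A.indicator w a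

/-- The pushforward of a weight function. -/
def push (g : P → Q) (w : P → ℝ) (q : Q) : ℝ := mass w (g ⁻¹' {q})

theorem mass_nonneg {w : P → ℝ} (h : ∀ p, 0 ≤ w p) (A : Set P) : 0 ≤ mass w A :=
  Finset.sum_nonneg fun p _ => Set.indicator_nonneg (fun p _ => h p) p

theorem push_nonneg {w : P → ℝ} (h : ∀ p, 0 ≤ w p) (g : P → Q) (q : Q) : 0 ≤ push g w q :=
  mass_nonneg h _

theorem mass_mono {w : P → ℝ} (h : ∀ p, 0 ≤ w p) {A B : Set P} (hAB : A ⊆ B) :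
    mass w A ≤ mass w B :=
  Finset.sum_le_sum fun p _ => Set.indicator_le_indicator_of_subset hAB h p

theorem mass_empty (w : P → ℝ) : mass w ∅ = 0 := by simp [mass]

theorem mass_singleton (w : P → ℝ) (p : P) : mass w {p} = w p := by
  classical
  rw [mass, Finset.sum_eq_single p]
  · simp
  · intro q _ hq
    exact Set.indicator_of_notMem (fun h : q ∈ ({p} : Set P) => hq h) w
  · simp

theorem mass_univ (w : P → ℝ) : mass w Set.univ = ∑ p, w p := by simp [mass]

theorem mass_union {A B : Set P} (h : Disjoint A B) (w : P → ℝ) :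
    mass w (A ∪ B) = mass w A + mass w B := by
  simp only [mass, Set.indicator_union_of_disjoint h, Finset.sum_add_distrib]

variable [Fintype Q]

theorem mass_sum_preimage (g : P → Q) (w : P → ℝ) (B : Set Q) :
    mass w (g ⁻¹' B) = ∑ q, B.indicator (push g w) q := by
  classical
  have : ∀ q, B.indicator (push g w) q = ∑ p, if g p = q then (g ⁻¹' B).indicator w p else 0 := by
    intro q
    by_cases hq : q ∈ B
    · rw [Set.indicator_of_mem hq, push, mass]
      refine Finset.sum_congr rfl fun p _ => ?_
      by_cases hp : g p = q
      · subst hp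
        simp [Set.indicator, hq]
      · simp [Set.indicator, hp]
    · rw [Set.indicator_of_notMem hq]
      refine (Finset.sum_eq_zero fun p _ => ?_).symm
      by_cases hp : g p = q
      · subst hp
        simp [Set.indicator, hq]
      · simp [hp]
  simp only [this]
  rw [Finset.sum_comm]
  simp [mass]

theorem mass_push (g : P → Q) (w : P → ℝ) (B : Set Q) : mass (push g w) B = mass w (g ⁻¹' B) :=
  (mass_sum_preimage g w B).symm

theorem push_push (g : P → Q) (h : Q → S) (w : P → ℝ) : push h (push g w) = push (h ∘ g) w :=
  funext fun _ => mass_push g w _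

theorem sum_push (g : P → Q) (w : P → ℝ) : ∑ q, push g w q = ∑ p, w p := by
  rw [← mass_univ, mass_push, Set.preimage_univ, mass_univ]

theorem mass_prod (w : P × Q → ℝ) (A : Set P) (B : Set Q) :
    mass w (A ×ˢ B) = mass (fun p => mass (fun q => w (p, q)) B) A := by
  classical
  rw [mass, Fintype.sum_prod_type]
  refine Finset.sum_congr rfl fun p _ => ?_
  by_cases hp : p ∈ A
  · rw [Set.indicator_of_mem hp, mass]
    refine Finset.sum_congr rfl fun q _ => ?_
    simp [Set.indicator, hp]
  · rw [Set.indicator_of_notMem hp]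
    refine Finset.sum_eq_zero fun q _ => ?_
    simp [Set.indicator, hp]

theorem mass_sub (w w' : P → ℝ) (A : Set P) :
    mass (fun p => w p - w' p) A = mass w A - mass w' A := by
  rw [mass, mass, mass, ← Finset.sum_sub_distrib]
  exact Finset.sum_congr rfl fun p _ => congrFun (Set.indicator_sub A w w') p

theorem continuous_mass {Z : Type} [TopologicalSpace Z] {w : Z → P → ℝ}
    (h : ∀ p, Continuous fun z => w z p) (A : Set P) : Continuous fun z => mass (w z) A := by
  classical
  refine continuous_finsetSum _ fun p _ => ?_
  by_cases hp : p ∈ A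
  · simpa only [Set.indicator_of_mem hp] using h p
  · simpa only [Set.indicator_of_notMem hp] using continuous_const

end Mass

/-! ### The overlap of two subdivisions of an interval -/

section Overlap

variable {Q S Q' S' : Type} [Fintype Q] [Fintype S] [Fintype Q'] [Fintype S'] [LinearOrder Q]
  [LinearOrder S] [LinearOrder Q'] [LinearOrder S']

theorem mass_telescope_of_isLowerSet (u : S → ℝ) (G : ℝ → ℝ) {A : Set S} (hA : IsLowerSet A) :
    mass (fun s => G (mass u (Set.Iic s)) - G (mass u (Set.Iio s))) A = G (mass u A) - G 0 := by
  classical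
  obtain ⟨F, rfl⟩ : ∃ F : Finset S, (F : Set S) = A := ⟨A.toFinite.toFinset, by simp⟩
  -- When the elements are added in increasing order, those present before `a` form exactly `Set.Iio
  -- a`, so the new term cancels the old endpoint.
  induction F using Finset.induction_on_max with
  | empty => simp [mass_empty]
  | insert a F hF ih =>
    have hFa : (F : Set S) = Set.Iio a := by
      ext x
      refine ⟨hF x, fun hx => ?_⟩
      have := hA (le_of_lt hx) (Finset.mem_coe.2 (Finset.mem_insert_self a F))
      exact Finset.mem_coe.2 ((Finset.mem_insert.1 (Finset.mem_coe.1 this)).resolve_left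
        (ne_of_lt hx))
    have hins : ((insert a F : Finset S) : Set S) = {a} ∪ Set.Iio a := by
      rw [Finset.coe_insert, hFa]
      rfl
    have hIic : ({a} ∪ Set.Iio a : Set S) = Set.Iic a := by
      rw [Set.union_comm, Set.Iio_union_right]
    have hd : Disjoint ({a} : Set S) (Set.Iio a) := by simp
    rw [hFa] at ih
    rw [hins, mass_union hd, ih (isLowerSet_Iio a), mass_singleton, hIic]
    ring

/-- The fibre over `s'` is the difference of the lower sets `g⁻¹(Iic s')` and `g⁻¹(Iio s')`, on each
of which the sum telescopes. -/
theorem mass_telescope (g : S →o S') (u : S → ℝ) (G : ℝ → ℝ) (s' : S') :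
    mass (fun s => G (mass u (Set.Iic s)) - G (mass u (Set.Iio s))) (g ⁻¹' {s'}) =
      G (mass (push g u) (Set.Iic s')) - G (mass (push g u) (Set.Iio s')) := by
  rw [mass_push, mass_push]
  have hd : Disjoint (g ⁻¹' {s'}) (g ⁻¹' Set.Iio s') :=
    Disjoint.preimage g (by simp)
  have hu : g ⁻¹' Set.Iic s' = g ⁻¹' {s'} ∪ g ⁻¹' Set.Iio s' := by
    rw [← Set.preimage_union, Set.union_comm, Set.Iio_union_right]
  have h1 := mass_telescope_of_isLowerSet u G (A := g ⁻¹' Set.Iic s')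
    fun a b hab h => (g.monotone hab).trans h
  have h2 := mass_telescope_of_isLowerSet u G (A := g ⁻¹' Set.Iio s')
    fun a b hab h => lt_of_le_of_lt (g.monotone hab) h
  rw [hu, mass_union hd, h2, ← hu] at h1
  linarith

/-- The length of the intersection of the `q`-th interval of the subdivision with lengths `v` and
the `s`-th interval of the subdivision with lengths `u`. -/
def overlap (v : Q → ℝ) (u : S → ℝ) (p : Q × S) : ℝ :=
  min (mass v (Set.Iic p.1)) (mass u (Set.Iic p.2)) -
    min (mass v (Set.Iic p.1)) (mass u (Set.Iio p.2)) -
    (min (mass v (Set.Iio p.1)) (mass u (Set.Iic p.2)) -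
      min (mass v (Set.Iio p.1)) (mass u (Set.Iio p.2)))

/-- This second difference of `min` is the length of `[a, b] ∩ [c, d]`. -/
theorem min_second_difference_nonneg {a b c d : ℝ} (hab : a ≤ b) (hcd : c ≤ d) :
    0 ≤ min b d - min b c - (min a d - min a c) := by
  simp only [min_def]
  split_ifs <;> linarith

theorem min_second_difference_eq_zero {a b c d : ℝ} (hab : a ≤ b) (hcd : c ≤ d)
    (h : d ≤ a ∨ b ≤ c) : min b d - min b c - (min a d - min a c) = 0 := by
  rcases h with h | h
  · rw [min_eq_right (h.trans hab), min_eq_right (hcd.trans (h.trans hab)), min_eq_right h,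
      min_eq_right (hcd.trans h)]
    ring
  · rw [min_eq_left (h.trans hcd), min_eq_left h, min_eq_left (hab.trans (h.trans hcd)),
      min_eq_left (hab.trans h)]
    ring

variable {v : Q → ℝ} {u : S → ℝ}

theorem overlap_nonneg (hv : ∀ q, 0 ≤ v q) (hu : ∀ s, 0 ≤ u s) (p : Q × S) : 0 ≤ overlap v u p :=
  min_second_difference_nonneg (mass_mono hv Set.Iio_subset_Iic_self)
    (mass_mono hu Set.Iio_subset_Iic_self)

/-- Intervals that overlap in positive length each start before the other ends. -/
theorem overlap_ne_zero (hv : ∀ q, 0 ≤ v q) (hu : ∀ s, 0 ≤ u s) {p : Q × S}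
    (h : overlap v u p ≠ 0) : mass v (Set.Iio p.1) < mass u (Set.Iic p.2) ∧
      mass u (Set.Iio p.2) < mass v (Set.Iic p.1) := by
  by_contra hn
  refine h (min_second_difference_eq_zero (mass_mono hv Set.Iio_subset_Iic_self)
    (mass_mono hu Set.Iio_subset_Iic_self) ?_)
  by_contra! hn'
  exact hn hn'

/-- If `q < q'` and `s' < s`, positive overlaps at `(q, s)` and `(q', s')` would give: start of `s`
< end of `q` ≤ start of `q'` < end of `s'` ≤ start of `s`. -/
theorem isChain_overlap (hv : ∀ q, 0 ≤ v q) (hu : ∀ s, 0 ≤ u s) :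
    IsChain (· ≤ ·) {p | overlap v u p ≠ 0} := by
  have key : ∀ p ∈ {p | overlap v u p ≠ 0}, ∀ p' ∈ {p | overlap v u p ≠ 0},
      p.1 < p'.1 → p.2 ≤ p'.2 := by
    intro p hp p' hp' h1
    by_contra! h2
    have h3 := (overlap_ne_zero hv hu hp).2
    have h4 := (overlap_ne_zero hv hu hp').1
    have h5 : mass v (Set.Iic p.1) ≤ mass v (Set.Iio p'.1) :=
      mass_mono hv fun a (ha : a ≤ p.1) => lt_of_le_of_lt ha h1
    have h6 : mass u (Set.Iic p'.2) ≤ mass u (Set.Iio p.2) :=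
      mass_mono hu fun a (ha : a ≤ p'.2) => lt_of_le_of_lt ha h2
    linarith
  intro p hp p' hp' _
  rcases lt_trichotomy p.1 p'.1 with h | h | h
  · exact Or.inl ⟨h.le, key p hp p' hp' h⟩
  · rcases le_total p.2 p'.2 with h2 | h2
    · exact Or.inl ⟨h.le, h2⟩
    · exact Or.inr ⟨h.ge, h2⟩
  · exact Or.inr ⟨h.le, key p' hp' p hp h⟩

/-- In each variable the overlap is a difference of values of one function at consecutive partial
sums, so `mass_telescope` applies first over `S` and then over `Q`. This is the source of the
naturality of `cut`. -/
theorem push_overlap (g : Q →o Q') (g' : S →o S') (v : Q → ℝ) (u : S → ℝ) :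
    push (Prod.map g g') (overlap v u) = overlap (push g v) (push g' u) := by
  funext p
  obtain ⟨q', s'⟩ := p
  have h1 : Prod.map g g' ⁻¹' {(q', s')} = (g ⁻¹' {q'}) ×ˢ (g' ⁻¹' {s'}) := by
    ext p
    simp [Prod.ext_iff]
  rw [push, h1, mass_prod]
  have h2 : ∀ q, mass (fun s => overlap v u (q, s)) (g' ⁻¹' {s'}) =
      (min (mass v (Set.Iic q)) (mass (push g' u) (Set.Iic s')) -
        min (mass v (Set.Iic q)) (mass (push g' u) (Set.Iio s'))) -
      (min (mass v (Set.Iio q)) (mass (push g' u) (Set.Iic s')) -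
        min (mass v (Set.Iio q)) (mass (push g' u) (Set.Iio s'))) := by
    intro q
    rw [← mass_telescope g' u (fun y => min (mass v (Set.Iic q)) y),
      ← mass_telescope g' u (fun y => min (mass v (Set.Iio q)) y), ← mass_sub]
    rfl
  simp only [h2]
  exact mass_telescope g v (fun y => min y (mass (push g' u) (Set.Iic s')) -
    min y (mass (push g' u) (Set.Iio s'))) q'

theorem push_fst_overlap (hv : ∀ q, 0 ≤ v q) (h : ∑ q, v q = ∑ s, u s) :
    push Prod.fst (overlap v u) = v := by
  funext q
  -- Collapsing `S` to a point leaves one interval, which by the equality of totals covers the whole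
  -- subdivision `v`.
  have h1 := congrFun (push_overlap (OrderHom.id : Q →o Q)
    (⟨fun _ => (), fun _ _ _ => le_rfl⟩ : S →o Unit) v u) (q, ())
  have h2 : push (⇑(OrderHom.id : Q →o Q)) v = v := funext fun q => mass_singleton v q
  rw [h2] at h1
  have h3 : Prod.map (⇑(OrderHom.id : Q →o Q)) (⇑(⟨fun _ => (), fun _ _ _ => le_rfl⟩ : S →o Unit)) ⁻¹'
      {(q, ())} = Prod.fst ⁻¹' {q} := by
    ext p
    simp [Prod.ext_iff]
  rw [push, h3] at h1
  refine h1.trans ?_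
  have h4 : mass v (Set.Iic q) = v q + mass v (Set.Iio q) := by
    rw [← mass_singleton v q, ← mass_union (by simp), Set.union_comm, Set.Iio_union_right]
  have h5 : ∀ A, mass v A ≤ ∑ s, u s := fun A =>
    (mass_mono hv (Set.subset_univ A)).trans (by rw [mass_univ, h])
  have h6 : Set.Iic () = Set.univ := rfl
  have h7 : Set.Iio () = ∅ := by
    ext x
    simp
  rw [overlap, mass_push, mass_push, h6, h7, Set.preimage_univ, Set.preimage_empty, mass_univ,
    mass_empty, min_eq_left (h5 _), min_eq_left (h5 _), min_eq_right (mass_nonneg hv _),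
    min_eq_right (mass_nonneg hv _), h4]
  ring

/-- The overlap of a subdivision with itself is concentrated on the diagonal. -/
theorem overlap_self (hv : ∀ q, 0 ≤ v q) : overlap v v = push (fun q => (q, q)) v := by
  funext p
  obtain ⟨q, q'⟩ := p
  rcases lt_trichotomy q q' with h | rfl | h
  · have h1 : (fun q : Q => (q, q)) ⁻¹' {(q, q')} = ∅ := by
      ext x
      simp only [Set.mem_preimage, Set.mem_singleton_iff, Prod.mk.injEq, Set.mem_empty_iff_false,
        iff_false, not_and]
      rintro rfl
      exact h.ne
    rw [push, h1, mass_empty]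
    by_contra hne
    have h2 := (overlap_ne_zero hv hv hne).2
    have h3 : mass v (Set.Iic q) ≤ mass v (Set.Iio q') :=
      mass_mono hv fun a (ha : a ≤ q) => lt_of_le_of_lt ha h
    exact absurd h2 (not_lt.2 h3)
  · have h1 : (fun q : Q => (q, q)) ⁻¹' {(q, q)} = {q} := by
      ext x
      simp
    rw [push, h1, mass_singleton, overlap]
    have h4 : mass v (Set.Iic q) = v q + mass v (Set.Iio q) := by
      rw [← mass_singleton v q, ← mass_union (by simp), Set.union_comm, Set.Iio_union_right]
    have h5 : mass v (Set.Iio q) ≤ mass v (Set.Iic q) := mass_mono hv Set.Iio_subset_Iic_self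
    simp only [min_self]
    rw [min_eq_right h5, min_eq_left h5, h4]
    ring
  · have h1 : (fun q : Q => (q, q)) ⁻¹' {(q, q')} = ∅ := by
      ext x
      simp only [Set.mem_preimage, Set.mem_singleton_iff, Prod.mk.injEq, Set.mem_empty_iff_false,
        iff_false, not_and]
      rintro rfl
      exact h.ne'
    rw [push, h1, mass_empty]
    by_contra hne
    have h2 := (overlap_ne_zero hv hv hne).1
    have h3 : mass v (Set.Iic q') ≤ mass v (Set.Iio q) :=
      mass_mono hv fun a (ha : a ≤ q') => lt_of_le_of_lt ha h
    exact absurd h2 (not_lt.2 h3)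

theorem continuous_overlap {Z : Type} [TopologicalSpace Z] {v : Z → Q → ℝ} {u : Z → S → ℝ}
    (hv : ∀ q, Continuous fun z => v z q) (hu : ∀ s, Continuous fun z => u z s) (p : Q × S) :
    Continuous fun z => overlap (v z) (u z) p := by
  have h1 := continuous_mass hv
  have h2 := continuous_mass hu
  exact (((h1 _).min (h2 _)).sub ((h1 _).min (h2 _))).sub
    (((h1 _).min (h2 _)).sub ((h1 _).min (h2 _)))

end Overlap

/-! ### Points of `Ξ_K(Δ^•)^S` given by weights on partially ordered sets -/

instance {K : Type} {T : FinLinOrd} (f : T → K) (i : K) : Fintype (fiber f i).carrier :=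
  instFintypeCarrier (fiber f i)

/-- Nonnegative weights on a finite set such that each label has total weight one. -/
structure LabelWeight {K P : Type} [Fintype P] (lab : P → K) where
  w : P → ℝ
  nonneg : ∀ p, 0 ≤ w p
  push_lab : ∀ i, push lab w i = 1

/-- A chain in a finite partially ordered set as a finite totally ordered set. -/
abbrev chainOrd {P : Type} [PartialOrder P] [Finite P] (C : Set P) (hC : IsChain (· ≤ ·) C) :
    FinLinOrd where
  carrier := C
  order := { (inferInstance : PartialOrder C) with
    le_total := fun a b => hC.total a.2 b.2
    toDecidableLE := Classical.decRel _ }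

section Realize

variable {K P P' : Type} [Fintype P] [PartialOrder P] [Fintype P'] [PartialOrder P']
  {lab : P → K} {lab' : P' → K} {S S' : FinLinOrd}

/-- The label on a chain. -/
abbrev chainLab (lab : P → K) (C : Set P) (hC : IsChain (· ≤ ·) C) : chainOrd C hC → K :=
  fun c => lab c.1

instance {C : Set P} (hC : IsChain (· ≤ ·) C) (i : K) :
    Fintype (fiber (chainLab lab C hC) i).carrier :=
  instFintypeCarrier (fiber (chainLab lab C hC) i)

theorem sum_fiber_chainLab {C : Set P} (hC : IsChain (· ≤ ·) C) (i : K) (F : P → ℝ)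
    (hF : ∀ p, p ∉ C ∨ lab p ≠ i → F p = 0) :
    ∑ t : fiber (chainLab lab C hC) i, F t.1.1 = ∑ p, F p := by
  refine Finset.sum_of_injOn (fun t => t.1.1)
    (fun a _ b _ h => Subtype.ext (Subtype.ext h)) (fun _ _ => Finset.mem_univ _)
    (fun p _ hp => hF p ?_) (fun _ _ => rfl)
  by_contra! h
  exact hp ⟨⟨⟨p, h.1⟩, h.2⟩, Finset.mem_coe.2 (Finset.mem_univ _), rfl⟩

/-- The points of the simplices `Δ^{f⁻¹(i)}` given by weights supported on a chain. -/
def LabelWeight.point (W : LabelWeight lab) {C : Set P} (hC : IsChain (· ≤ ·) C)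
    (h : ∀ p, p ∉ C → W.w p = 0) (i : K) : Simp.obj (fiber (chainLab lab C hC) i) :=
  Simp.ofCoord (fun t => W.w t.1.1) (fun t => W.nonneg _) (by
    rw [← W.push_lab i, push, mass, ← sum_fiber_chainLab (lab := lab) hC i]
    · refine Finset.sum_congr rfl fun t _ => ?_
      exact (Set.indicator_of_mem (show t.1.1 ∈ lab ⁻¹' {i} from t.2) W.w).symm
    · rintro p (hp | hp)
      · rw [Set.indicator_apply_eq_zero]
        exact fun _ => h p hp
      · exact Set.indicator_of_notMem (fun h : p ∈ lab ⁻¹' {i} => hp h) _)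

/-- The point of `Ξ_K(Δ^•)^S` given by weights supported on a chain. -/
def LabelWeight.realizeOn (W : LabelWeight lab) {C : Set P} (hC : IsChain (· ≤ ·) C)
    (h : ∀ p, p ∉ C → W.w p = 0) (k : P →o S) : (Xi fun _ : K => Simp).obj S :=
  Xi.mk (X := fun _ => Simp) (chainLab lab C hC) ⟨fun c => k c.1, fun _ _ h => k.monotone h⟩
    (W.point hC h)

/-- Restricted to the chains, `g` is a map of diagrams over `K` and `b`, and its effect on the
coordinates of the simplices is pushforward of weights. The sets `P` are only partially ordered
because products `Q × S` will be used. -/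
theorem LabelWeight.ap_realizeOn (W : LabelWeight lab) {C : Set P} (hC : IsChain (· ≤ ·) C)
    (h : ∀ p, p ∉ C → W.w p = 0) (k : P →o S) (W' : LabelWeight lab') {C' : Set P'}
    (hC' : IsChain (· ≤ ·) C') (h' : ∀ p, p ∉ C' → W'.w p = 0) (k' : P' →o S')
    (g : P →o P') (hg : ∀ p, lab' (g p) = lab p) (b : S →o S') (hk : ∀ p, k' (g p) = b (k p))
    (hCC : ∀ p ∈ C, g p ∈ C') (hw : W'.w = push g W.w) :
    ap (Xi fun _ : K => Simp) b (W.realizeOn hC h k) = W'.realizeOn hC' h' k' := by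
  classical
  refine (Xi.ap_mk _ _ _ _).trans ?_
  refine Xi.mk_eq_mk ?_ ?_ ?_ fun i => Simp.ext fun t => ?_
  · exact ⟨fun c => ⟨g c.1, hCC c.1 c.2⟩, fun _ _ h => g.monotone h⟩
  · exact fun c => hg c.1
  · exact fun c => hk c.1
  · rw [Simp.coord_ap]
    refine Eq.trans ?_ (congrFun hw t.1.1).symm
    rw [push, mass, ← sum_fiber_chainLab (lab := lab) hC i]
    · refine Finset.sum_congr rfl fun s _ => ?_
      by_cases hs : g s.1.1 = t.1.1
      · rw [if_pos (Subtype.ext (Subtype.ext hs)),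
          Set.indicator_of_mem (show s.1.1 ∈ g ⁻¹' {t.1.1} from hs)]
        rfl
      · rw [if_neg fun hst => hs (congrArg (fun r => r.1.1) hst),
          Set.indicator_of_notMem (show s.1.1 ∉ g ⁻¹' {t.1.1} from hs)]
    · rintro p (hp | hp)
      · rw [Set.indicator_apply_eq_zero]
        exact fun _ => h p hp
      · refine Set.indicator_of_notMem (fun hpt => hp ?_) _
        rw [← hg, show g p = t.1.1 from hpt]
        exact t.2

/-- The point of `Ξ_K(Δ^•)^S` given by weights whose support is a chain. -/
def LabelWeight.realize (W : LabelWeight lab) (hW : IsChain (· ≤ ·) {p | W.w p ≠ 0}) (k : P →o S) :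
    (Xi fun _ : K => Simp).obj S :=
  W.realizeOn hW (fun _ hp => not_not.1 hp) k

/-- A chain larger than the support only adds elements of weight zero, and the inclusion of the
support is a map of diagrams. -/
theorem LabelWeight.realizeOn_eq (W : LabelWeight lab) {C : Set P} (hC : IsChain (· ≤ ·) C)
    (h : ∀ p, p ∉ C → W.w p = 0) (hW : IsChain (· ≤ ·) {p | W.w p ≠ 0}) (k : P →o S) :
    W.realizeOn hC h k = W.realize hW k := by
  refine (W.ap_realizeOn hW (fun _ hp => not_not.1 hp) k W hC h k OrderHom.id (fun _ => rfl)
    OrderHom.id (fun _ => rfl) (fun p hp => ?_) ?_).symm.trans (ap_id _ _)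
  · by_contra hp'
    exact hp (h p hp')
  · exact (funext fun q => mass_singleton W.w q).symm

theorem LabelWeight.ap_realize (W : LabelWeight lab) (hW : IsChain (· ≤ ·) {p | W.w p ≠ 0})
    (k : P →o S) (W' : LabelWeight lab') (hW' : IsChain (· ≤ ·) {p | W'.w p ≠ 0}) (k' : P' →o S')
    (g : P →o P') (hg : ∀ p, lab' (g p) = lab p) (b : S →o S') (hk : ∀ p, k' (g p) = b (k p))
    (hw : W'.w = push g W.w) :
    ap (Xi fun _ : K => Simp) b (W.realize hW k) = W'.realize hW' k' := by
  refine W.ap_realizeOn hW _ k W' hW' _ k' g hg b hk (fun p hp => ?_) hw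
  -- Nonnegative weights do not cancel under pushforward, so `g` maps support into support.
  have h1 : W.w p ≤ push g W.w (g p) := by
    rw [← mass_singleton W.w p]
    exact mass_mono W.nonneg fun q hq => by
      rw [show q = p from hq]
      exact rfl
  have h2 : 0 < W.w p := lt_of_le_of_ne (W.nonneg p) (Ne.symm hp)
  rw [Set.mem_ofPred_eq, hw]
  exact (h2.trans_le h1).ne'

/-- The support jumps as `z` varies, so no single chain need serve for all `z`. But there are
finitely many chains `C`, the conditions "supported in `C`" define closed sets covering `Z`, and on
each of them the chain `C` can be kept fixed. -/
theorem LabelWeight.continuous_realize {Z : Type} [TopologicalSpace Z] [CompactSpace Z] [T2Space Z]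
    (W : Z → LabelWeight lab) (hW : ∀ z, IsChain (· ≤ ·) {p | (W z).w p ≠ 0})
    (hc : ∀ p, Continuous fun z => (W z).w p) (k : P →o S) :
    Continuous fun z => (W z).realize (hW z) k := by
  let A : {C : Set P // IsChain (· ≤ ·) C} → Set Z := fun C => {z | ∀ p, p ∉ C.1 → (W z).w p = 0}
  have hA : ∀ C, IsClosed (A C) := fun C => by
    simp only [A, Set.ofPred_forall]
    exact isClosed_iInter fun p => isClosed_iInter fun _ => isClosed_eq (hc p) continuous_const
  refine LocallyFinite.continuous (locallyFinite_of_finite A) ?_ hA fun C => ?_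
  · exact Set.eq_univ_of_forall fun z => Set.mem_iUnion.2 ⟨⟨_, hW z⟩, fun p hp => not_not.1 hp⟩
  · rw [continuousOn_iff_continuous_domRestrict]
    have : CompactSpace (A C) := isCompact_iff_compactSpace.1 (hA C).isCompact
    have h1 : (A C).domRestrict (fun z => (W z).realize (hW z) k) =
        fun z => (W z.1).realizeOn C.2 z.2 k :=
      funext fun z => ((W z.1).realizeOn_eq C.2 z.2 (hW z.1) k).symm
    rw [h1]
    refine KCont.continuous (ContinuousGeneratedBy.comp (Xi.continuous_mk (X := fun _ : K => Simp)
      (chainLab lab C.1 C.2) _) (f := fun z : A C => (W z.1).point C.2 z.2)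
      (Continuous.continuousGeneratedBy (continuous_pi fun i => ?_)))
    exact Simp.continuous_of_coord fun t => (hc t.1.1).comp continuous_subtype_val

end Realize

/-! ### From points of `Ξ_K(Δ^•)` back to weights -/

section PointWeight

variable {K : Type} {S T : FinLinOrd}

/-- The weights on `T` given by points of the simplices `Δ^{f⁻¹(i)}`. -/
def pointWeight (f : T → K) (x : ∀ i, Simp.obj (fiber f i)) (t : T) : ℝ :=
  Simp.coord (x (f t)) ⟨t, rfl⟩

theorem pointWeight_nonneg (f : T → K) (x : ∀ i, Simp.obj (fiber f i)) (t : T) :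
    0 ≤ pointWeight f x t := Simp.coord_nonneg _ _

theorem pointWeight_fiber (f : T → K) (x : ∀ i, Simp.obj (fiber f i)) (i : K) (t : fiber f i) :
    pointWeight f x t.1 = Simp.coord (x i) t := by
  obtain ⟨t, rfl⟩ := t
  rfl

theorem sum_fiber_eq (f : T → K) (i : K) (F : T → ℝ) (hF : ∀ t, f t ≠ i → F t = 0) :
    ∑ t : fiber f i, F t.1 = ∑ t, F t := by
  refine Finset.sum_of_injOn (fun t => t.1) (fun a _ b _ h => Subtype.ext h)
    (fun _ _ => Finset.mem_univ _) (fun t _ ht => hF t fun h => ht ?_) (fun _ _ => rfl)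
  exact ⟨⟨t, h⟩, Finset.mem_coe.2 (Finset.mem_univ _), rfl⟩

theorem push_pointWeight (f : T → K) (x : ∀ i, Simp.obj (fiber f i)) (i : K) :
    push f (pointWeight f x) i = 1 := by
  rw [← Simp.sum_coord (x i), push, mass, ← sum_fiber_eq f i]
  · refine Finset.sum_congr rfl fun t _ => ?_
    rw [Set.indicator_of_mem (show t.1 ∈ f ⁻¹' {i} from t.2), pointWeight_fiber]
  · exact fun t ht => Set.indicator_of_notMem (fun h : t ∈ f ⁻¹' {i} => ht h) _

/-- The weights on `T` given by points of the simplices `Δ^{f⁻¹(i)}`. -/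
def LabelWeight.ofPoint (f : T → K) (x : ∀ i, Simp.obj (fiber f i)) : LabelWeight f :=
  ⟨pointWeight f x, pointWeight_nonneg f x, push_pointWeight f x⟩

theorem pointWeight_ap {T' : FinLinOrd} {f : T → K} {f' : T' → K} (g : T →o T')
    (hg : ∀ t, f' (g t) = f t) (x : ∀ i, Simp.obj (fiber f i)) :
    pointWeight f' (fun i => ap Simp (fiberMap g hg i) (x i)) = push g (pointWeight f x) := by
  classical
  funext t
  rw [pointWeight, Simp.coord_ap, push, mass, ← sum_fiber_eq f (f' t)]
  · refine Finset.sum_congr rfl fun s _ => ?_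
    by_cases hs : g s.1 = t
    · rw [if_pos (Subtype.ext hs), Set.indicator_of_mem (show s.1 ∈ g ⁻¹' {t} from hs),
        pointWeight_fiber]
    · rw [if_neg fun h => hs (congrArg Subtype.val h),
        Set.indicator_of_notMem (show s.1 ∉ g ⁻¹' {t} from hs)]
  · exact fun s hs => Set.indicator_of_notMem
      (fun h : s ∈ g ⁻¹' {t} => hs ((hg s).symm.trans (congrArg f' h))) _

/-- The inclusion of the support into `T` is a map of diagrams; only elements of weight zero are
lost. -/
theorem LabelWeight.realize_ofPoint (f : T → K) (h : T →o S) (x : ∀ i, Simp.obj (fiber f i))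
    (hW : IsChain (· ≤ ·) {p | (LabelWeight.ofPoint f x).w p ≠ 0}) :
    (LabelWeight.ofPoint f x).realize hW h = Xi.mk (X := fun _ => Simp) f h x := by
  classical
  refine Xi.mk_eq_mk ?_ ?_ ?_ fun i => Simp.ext fun t => ?_
  · exact ⟨fun c => c.1, fun _ _ h => h⟩
  · exact fun _ => rfl
  · exact fun _ => rfl
  · rw [Simp.coord_ap, ← pointWeight_fiber f x i t]
    have h1 := sum_fiber_chainLab (lab := f) hW i
      (fun p => if p = t.1 then pointWeight f x p else 0) (by
        rintro p (hp | hp)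
        · have : pointWeight f x p = 0 := not_not.1 hp
          simp [this]
        · exact if_neg fun h : p = t.1 => hp (h ▸ t.2))
    simp only [Finset.sum_ite_eq', Finset.mem_univ, if_true] at h1
    rw [← h1]
    refine Finset.sum_congr rfl fun s _ => ?_
    by_cases hs : s.1.1 = t.1
    · rw [if_pos hs, if_pos (Subtype.ext hs)]
      rfl
    · rw [if_neg hs, if_neg fun h => hs (congrArg Subtype.val h)]

theorem continuous_pointWeight (f : T → K) (t : T) :
    Continuous fun x : ∀ i, Simp.obj (fiber f i) => pointWeight f x t :=
  (Simp.continuous_coord _).comp (continuous_apply (f t))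

end PointWeight

/-! ### Cutting a path into pieces of given lengths -/

section Cut

variable {K : Type} [Fintype K] {Q Q' S S' : FinLinOrd} {lab : Q → K} {lab' : Q' → K}

theorem LabelWeight.sum_w {P : Type} [Fintype P] {lab : P → K} (V : LabelWeight lab) :
    ∑ q, V.w q = Fintype.card K := by
  rw [← sum_push lab, Finset.sum_congr rfl fun i _ => V.push_lab i]
  simp

/-- The lengths of a subdivision of an interval of length `|K|`, indexed by `S`. -/
structure Lengths (K : Type) [Fintype K] (S : FinLinOrd) where
  u : S → ℝ
  nonneg : ∀ s, 0 ≤ u s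
  sum : ∑ s, u s = Fintype.card K

/-- The weights given by the overlap of two subdivisions. -/
def LabelWeight.overlap (V : LabelWeight lab) (U : Lengths K S) :
    LabelWeight (fun p : Q × S => lab p.1) where
  w := CosimpOperad.overlap V.w U.u
  nonneg := overlap_nonneg V.nonneg U.nonneg
  push_lab i := by
    have h := congrFun (push_push (Prod.fst : Q × S → Q) lab (CosimpOperad.overlap V.w U.u)) i
    rw [push_fst_overlap V.nonneg (V.sum_w.trans U.sum.symm), V.push_lab] at h
    exact h.symm

/-- The point of `Ξ_K(Δ^•)^S` obtained by cutting a path, with weights `V`, into pieces of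
lengths `U`. -/
def cut (V : LabelWeight lab) (U : Lengths K S) : (Xi fun _ : K => Simp).obj S :=
  (V.overlap U).realize (isChain_overlap V.nonneg U.nonneg) OrderHom.snd

/-- Naturality in the path and in the lengths at once: the former makes the cut independent of how a
path is represented, the latter makes it cosimplicial. -/
theorem ap_cut (V : LabelWeight lab) (U : Lengths K S) (V' : LabelWeight lab') (U' : Lengths K S')
    (g : Q →o Q') (hg : ∀ q, lab' (g q) = lab q) (b : S →o S') (hV : V'.w = push g V.w)
    (hU : U'.u = push b U.u) : ap (Xi fun _ : K => Simp) b (cut V U) = cut V' U' := by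
  refine (V.overlap U).ap_realize _ OrderHom.snd (V'.overlap U') _ OrderHom.snd
    ⟨Prod.map g b, g.monotone.prodMap b.monotone⟩ (fun p => hg p.1) b (fun _ => rfl) ?_
  refine Eq.trans ?_ (push_overlap g b V.w U.u).symm
  rw [← hV, ← hU]
  rfl

theorem push_id {P : Type} [Fintype P] (w : P → ℝ) : push (fun p => p) w = w :=
  funext fun p => mass_singleton w p

theorem cut_eq_cut (V : LabelWeight lab) (U : Lengths K S) (V' : LabelWeight lab')
    (U' : Lengths K S) (g : Q →o Q') (hg : ∀ q, lab' (g q) = lab q) (hV : V'.w = push g V.w)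
    (hU : U'.u = U.u) : cut V U = cut V' U' :=
  (ap_id _ _).symm.trans (ap_cut V U V' U' g hg OrderHom.id hV (hU.trans (push_id U.u).symm))

/-- The overlap of a subdivision with itself lies on the diagonal, so cutting a path by its own
lengths changes nothing. -/
theorem cut_self (f : S → K) (x : ∀ i, Simp.obj (fiber f i)) (U : Lengths K S)
    (hU : U.u = pointWeight f x) :
    cut (LabelWeight.ofPoint f x) U = Xi.mk (X := fun _ => Simp) f OrderHom.id x := by
  have hc : IsChain (· ≤ ·) {p | (LabelWeight.ofPoint f x).w p ≠ 0} :=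
    fun a _ b _ _ => le_total a b
  rw [← LabelWeight.realize_ofPoint f OrderHom.id x hc]
  refine Eq.trans ?_ (ap_id (Xi fun _ : K => Simp) _)
  refine ((LabelWeight.ofPoint f x).ap_realize hc OrderHom.id
    ((LabelWeight.ofPoint f x).overlap U) (isChain_overlap (pointWeight_nonneg f x) U.nonneg)
    OrderHom.snd
    ⟨fun s => (s, s), fun _ _ h => Prod.mk_le_mk.2 ⟨h, h⟩⟩ (fun _ => rfl) OrderHom.id (fun _ => rfl) ?_).symm
  change CosimpOperad.overlap (pointWeight f x) U.u = _
  rw [hU, overlap_self (pointWeight_nonneg f x)]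
  rfl

theorem continuous_cut {Z : Type} [TopologicalSpace Z] [CompactSpace Z] [T2Space Z]
    {V : Z → LabelWeight lab} {U : Z → Lengths K S} (hV : ∀ q, Continuous fun z => (V z).w q)
    (hU : ∀ s, Continuous fun z => (U z).u s) : Continuous fun z => cut (V z) (U z) :=
  LabelWeight.continuous_realize (fun z => (V z).overlap (U z)) _
    (fun p => continuous_overlap hV hU p) OrderHom.snd

end Cut

/-! ### The contraction of `Ξ_K(Δ^•)` -/

section Contraction

variable {K : Type} [Fintype K] [LinearOrder K]

/-- A finite totally ordered set of labels as an object of `Δ₊`. -/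
def ordOf (K : Type) [Fintype K] [LinearOrder K] : FinLinOrd := ⟨K⟩

/-- The identity of `K` as a label on the totally ordered set `K`. -/
def ordLab (K : Type) [Fintype K] [LinearOrder K] (i : ordOf K) : K := i

/-- The ordered sum of `K` and `T`. -/
def sumOrd (K : Type) [Fintype K] [LinearOrder K] (T : FinLinOrd) : FinLinOrd where
  carrier := K ⊕ₗ T
  finite := inferInstanceAs (Finite (K ⊕ T))

/-- The inclusion of the first summand. -/
def sumInl (K : Type) [Fintype K] [LinearOrder K] (T : FinLinOrd) : ordOf K →o sumOrd K T :=
  ⟨fun i => toLex (Sum.inl i), fun _ _ h => Sum.Lex.inl_le_inl_iff.2 h⟩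

/-- The inclusion of the second summand. -/
def sumInr (K : Type) [Fintype K] [LinearOrder K] (T : FinLinOrd) : T →o sumOrd K T :=
  ⟨fun t => toLex (Sum.inr t), fun _ _ h => Sum.Lex.inr_le_inr_iff.2 h⟩

/-- The map of ordered sums induced by an order-preserving map of the second summands. -/
def sumMap (K : Type) [Fintype K] [LinearOrder K] {T T' : FinLinOrd} (g : T →o T') :
    sumOrd K T →o sumOrd K T' :=
  ⟨fun q => toLex (Sum.map id g (ofLex q)), by
    intro a b hab
    induction a using Lex.rec with
    | h a =>
      induction b using Lex.rec with
      | h b =>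
        rcases a with a | a <;> rcases b with b | b
        · exact Sum.Lex.inl_le_inl_iff.2 (Sum.Lex.inl_le_inl_iff.1 hab)
        · exact Sum.Lex.inl_le_inr _ _
        · exact absurd hab Sum.Lex.not_inr_le_inl
        · exact Sum.Lex.inr_le_inr_iff.2 (g.monotone (Sum.Lex.inr_le_inr_iff.1 hab))⟩

/-- The label on an ordered sum. -/
def sumLab {T : FinLinOrd} (f : T → K) (q : sumOrd K T) : K := Sum.elim id f (ofLex q)

theorem push_add_mul {P Q : Type} [Fintype P] (g : P → Q) (a b : ℝ) (w w' : P → ℝ) (q : Q) :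
    push g (fun p => a * w p + b * w' p) q = a * push g w q + b * push g w' q := by
  classical
  simp only [push, mass, Finset.mul_sum, ← Finset.sum_add_distrib]
  refine Finset.sum_congr rfl fun p _ => ?_
  by_cases hp : p ∈ g ⁻¹' {q}
  · simp only [Set.indicator_of_mem hp]
  · simp only [Set.indicator_of_notMem hp, mul_zero, add_zero]

/-- The path which runs through all labels, each with weight one, in increasing order. -/
def unitWeight (K : Type) [Fintype K] [LinearOrder K] : LabelWeight (ordLab K) where
  w _ := 1
  nonneg _ := zero_le_one
  push_lab i := congrFun (push_id (P := ordOf K) fun _ => 1) i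

/-- The path composed of the path through all labels, shrunk by the factor `r`, and the path given
by `x`, shrunk by the factor `1 - r`. -/
def interpWeight {T : FinLinOrd} (f : T → K) (r : unitInterval) (x : ∀ i, Simp.obj (fiber f i)) :
    LabelWeight (sumLab f) where
  w q := (r : ℝ) * push (sumInl K T) (fun _ => 1) q +
    (1 - r : ℝ) * push (sumInr K T) (pointWeight f x) q
  nonneg q := add_nonneg
    (mul_nonneg r.2.1 (push_nonneg (fun _ => zero_le_one) _ _))
    (mul_nonneg (sub_nonneg.2 r.2.2) (push_nonneg (pointWeight_nonneg f x) _ _))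
  push_lab i := by
    rw [push_add_mul, push_push, push_push]
    have h1 : push (sumLab f ∘ sumInl K T) (fun _ => (1 : ℝ)) i = 1 :=
      (unitWeight K).push_lab i
    have h2 : push (sumLab f ∘ sumInr K T) (pointWeight f x) i = 1 := push_pointWeight f x i
    rw [h1, h2]
    ring

/-- The lengths of the pieces of the path given by `x`. -/
def pointLengths {T : FinLinOrd} (f : T → K) (x : ∀ i, Simp.obj (fiber f i)) : Lengths K T :=
  ⟨pointWeight f x, pointWeight_nonneg f x, (LabelWeight.ofPoint f x).sum_w⟩

/-- The contraction of `Ξ_K(Δ^•)`: change the path and keep the lengths of the pieces. -/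
def contraction (K : Type) [Fintype K] [LinearOrder K] (r : unitInterval) :
    Xi (fun _ : K => Simp) ⟶ Xi (fun _ : K => Simp) :=
  Xi.desc (fun f x => cut (interpWeight f r x) (pointLengths f x))
    (fun f => (continuous_cut (V := interpWeight f r) (U := pointLengths f)
      (fun q => continuous_const.add (continuous_const.mul
        (continuous_mass (continuous_pointWeight f) _)))
      (continuous_pointWeight f)).continuousGeneratedBy)
    (fun {T T'} f f' g hg x => by
      refine ap_cut (interpWeight f r x) (pointLengths f x) (interpWeight f' r _)
        (pointLengths f' _) (sumMap K g) (fun q => ?_) g ?_ (pointWeight_ap g hg x)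
      · induction q using Lex.rec with
        | h q =>
          rcases q with i | t
          · rfl
          · exact hg t
      · funext q
        refine Eq.trans ?_ (push_add_mul _ _ _ _ _ _).symm
        rw [push_push, push_push]
        change _ * _ + _ * push (sumInr K T') (pointWeight f' _) q = _
        rw [pointWeight_ap g hg x, push_push]
        rfl)

theorem contraction_mk (r : unitInterval) {S T : FinLinOrd} (f : T → K) (h : T →o S)
    (x : ∀ i, Simp.obj (fiber f i)) :
    compAt (contraction K r) S (Xi.mk (X := fun _ => Simp) f h x) =
      ap (Xi fun _ : K => Simp) h (cut (interpWeight f r x) (pointLengths f x)) :=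
  Xi.desc_mk _ _ _ f h x

theorem jointlyCont_contraction : JointlyCont (contraction K) :=
  JointlyCont.of_mk fun S T f h => by
    simp only [contraction_mk]
    refine Continuous.continuousGeneratedBy ((ap _ h).continuous.comp (continuous_cut
      (V := fun p : unitInterval × (∀ i, Simp.obj (fiber f i)) => interpWeight f p.1 p.2)
      (U := fun p => pointLengths f p.2) (fun q => ?_) fun t => ?_))
    · refine ((continuous_subtype_val.comp continuous_fst).mul continuous_const).add
        ((continuous_const.sub (continuous_subtype_val.comp continuous_fst)).mul ?_)
      exact continuous_mass (fun t => (continuous_pointWeight f t).comp continuous_snd) _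
    · exact (continuous_pointWeight f t).comp continuous_snd

/-- At `r = 0` the summand `K` of the ordered sum has weight zero, so the path is that of `x`, and
`cut_self` applies. -/
theorem contraction_zero : contraction K 0 = 𝟙 _ :=
  Xi.hom_ext fun T f x => by
    rw [contraction_mk, ap_id]
    refine Eq.trans ?_ (cut_self f x (pointLengths f x) rfl)
    -- The inclusion of `T` in the ordered sum pushes the weights of `x` forward to the interpolated
    -- weights.
    refine (cut_eq_cut _ _ _ _ (sumInr K T) (fun _ => rfl) ?_ rfl).symm
    funext q
    change (0 : ℝ) * _ + (1 - 0) * _ = _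
    rw [zero_mul, zero_add, sub_zero, one_mul]
    rfl

/-- The map `Ξ_K(Δ^•) → Δ^•` which remembers the lengths of the pieces. -/
def average (K : Type) [Fintype K] [Nonempty K] : Xi (fun _ : K => Simp) ⟶ Simp :=
  Xi.desc (fun f x => Simp.ofCoord (fun t => pointWeight f x t / Fintype.card K)
      (fun t => div_nonneg (pointWeight_nonneg f x t) (Nat.cast_nonneg _))
      (by
        rw [← Finset.sum_div, show ∑ t, pointWeight f x t = _ from (LabelWeight.ofPoint f x).sum_w]
        exact div_self (Nat.cast_ne_zero.2 Fintype.card_ne_zero)))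
    (fun f => Continuous.continuousGeneratedBy (Simp.continuous_of_coord fun t =>
      (continuous_pointWeight f t).div_const _))
    (fun {T T'} f f' g hg x => Simp.ext fun t => by
      classical
      rw [Simp.coord_ap, Simp.coord_ofCoord, pointWeight_ap g hg x, push, mass]
      refine Eq.trans ?_ (Finset.sum_div _ _ _).symm
      refine Finset.sum_congr rfl fun s _ => ?_
      by_cases hs : g s = t
      · rw [if_pos hs, Set.indicator_of_mem (show s ∈ g ⁻¹' {t} from hs)]
        rfl
      · rw [if_neg hs, Set.indicator_of_notMem (show s ∉ g ⁻¹' {t} from hs), zero_div])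

/-- The lengths given by a point of a simplex. -/
def simpLengths (K : Type) [Fintype K] {S : FinLinOrd} (y : Simp.obj S) : Lengths K S :=
  ⟨fun s => Fintype.card K * Simp.coord y s,
    fun s => mul_nonneg (Nat.cast_nonneg _) (Simp.coord_nonneg y s), by
      rw [← Finset.mul_sum, Simp.sum_coord, mul_one]⟩

/-- The map `Δ^• → Ξ_K(Δ^•)` which cuts the path through all labels in increasing order. -/
def standardCut (K : Type) [Fintype K] [LinearOrder K] : Simp ⟶ Xi (fun _ : K => Simp) :=
  mkHom (fun S => ⟨fun y => cut (unitWeight K) (simpLengths K y), continuous_cut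
      (V := fun _ => unitWeight K) (U := fun y : Simp.obj S => simpLengths K y) (fun _ => continuous_const) (fun s => continuous_const.mul (Simp.continuous_coord s))⟩)
    (fun {S S'} g y => by
      classical
      refine (ap_cut (unitWeight K) (simpLengths K y) (unitWeight K) (simpLengths K _) OrderHom.id
        (fun _ => rfl) g (push_id _).symm ?_).symm
      funext s
      change _ * Simp.coord (ap Simp g y) s = _
      rw [Simp.coord_ap, push, mass, Finset.mul_sum]
      refine Finset.sum_congr rfl fun t _ => ?_
      by_cases ht : g t = s
      · rw [if_pos ht, Set.indicator_of_mem (show t ∈ g ⁻¹' {s} from ht)]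
        rfl
      · rw [if_neg ht, Set.indicator_of_notMem (show t ∉ g ⁻¹' {s} from ht), mul_zero])

/-- At `r = 1` the path no longer depends on `x`. Only the lengths remain; `average` records them
divided by `|K|`, and `simpLengths` multiplies by `|K|` again. -/
theorem contraction_one [Nonempty K] : contraction K 1 = average K ≫ standardCut K :=
  Xi.hom_ext fun T f x => by
    rw [contraction_mk, ap_id]
    have h : compAt (average K) T (Xi.mk (X := fun _ => Simp) f OrderHom.id x) = _ :=
      Xi.desc_mk _ _ _ f OrderHom.id x
    rw [compAt_comp, h, ap_id]
    refine (cut_eq_cut _ _ _ _ (sumInl K T) (fun _ => rfl) ?_ ?_).symm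
    · funext q
      change (1 : ℝ) * _ + (1 - 1) * _ = _
      rw [sub_self, zero_mul, add_zero, one_mul]
      rfl
    · funext t
      change _ = (Fintype.card K : ℝ) * (pointWeight f x t / Fintype.card K)
      rw [mul_div_cancel₀]
      · rfl
      · exact Nat.cast_ne_zero.2 Fintype.card_ne_zero

/-- The straight line from an endomorphism of `Δ^•` to the identity. -/
def straightLine (r : unitInterval) (φ : Simp ⟶ Simp) : Simp ⟶ Simp :=
  mkHom (fun S => ⟨fun y => Simp.ofCoord
      (fun s => (1 - r : ℝ) * Simp.coord (compAt φ S y) s + r * Simp.coord y s)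
      (fun s => add_nonneg (mul_nonneg (sub_nonneg.2 r.2.2) (Simp.coord_nonneg _ _))
        (mul_nonneg r.2.1 (Simp.coord_nonneg _ _)))
      (by
        rw [Finset.sum_add_distrib, ← Finset.mul_sum, ← Finset.mul_sum, Simp.sum_coord,
          Simp.sum_coord]
        ring),
      Simp.continuous_of_coord fun s => (continuous_const.mul
        ((Simp.continuous_coord s).comp (compAt φ S).continuous)).add
          (continuous_const.mul (Simp.continuous_coord s))⟩)
    (fun {S S'} g y => Simp.ext fun s => by
      classical
      rw [Simp.coord_ap]
      change (1 - r : ℝ) * Simp.coord (compAt φ S' (ap Simp g y)) s + r * Simp.coord (ap Simp g y) s =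
        ∑ t, if g t = s then (1 - r : ℝ) * Simp.coord (compAt φ S y) t + r * Simp.coord y t else 0
      rw [compAt_ap, Simp.coord_ap, Simp.coord_ap, Finset.mul_sum, Finset.mul_sum,
        ← Finset.sum_add_distrib]
      refine Finset.sum_congr rfl fun t _ => ?_
      split_ifs <;> simp)

theorem jointlyCont_straightLine {Z : Type} [TopologicalSpace Z] [CompactSpace Z] [T2Space Z]
    {φ : Z → (Simp ⟶ Simp)} (hφ : JointlyCont φ) :
    JointlyCont fun p : Z × unitInterval => straightLine p.2 (φ p.1) := fun S => by
  refine Continuous.continuousGeneratedBy (Simp.continuous_of_coord fun s => ?_)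
  have h1 : Continuous fun p : (Z × unitInterval) × Simp.obj S => compAt (φ p.1.1) S p.2 :=
    (hφ S).continuous.comp (f := fun p : (Z × unitInterval) × Simp.obj S => (p.1.1, p.2))
      (by fun_prop)
  have h2 : Continuous fun p : (Z × unitInterval) × Simp.obj S => (p.1.2 : ℝ) := by fun_prop
  exact ((continuous_const.sub h2).mul ((Simp.continuous_coord s).comp h1)).add
    (h2.mul ((Simp.continuous_coord s).comp continuous_snd))

theorem straightLine_zero (φ : Simp ⟶ Simp) : straightLine 0 φ = φ :=
  hom_ext fun S y => Simp.ext fun s => by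
    change (1 - 0 : ℝ) * _ + 0 * _ = _
    rw [sub_zero, one_mul, zero_mul, add_zero]

theorem straightLine_one (φ : Simp ⟶ Simp) : straightLine 1 φ = 𝟙 _ :=
  hom_ext fun S y => Simp.ext fun s => by
    change (1 - 1 : ℝ) * _ + 1 * _ = _
    rw [sub_self, zero_mul, one_mul, zero_add]
    rfl

end Contraction

/-! ### Contractibility of `D(k)` -/

/-- A family of maps of spaces `Tot`, parametrized by the unit interval, is continuous if it
preserves jointly continuous families. -/
theorem Tot.continuous_uncurry {X Y : AugCosimp} (Φ : unitInterval → Tot X → Tot Y)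
    (h : ∀ (K : CompHaus.{0}) (φ : CH K → (Simp ⟶ X)), JointlyCont φ →
      JointlyCont (A := Simp) (B := Y) fun p : CH K × unitInterval => Φ p.2 (φ p.1)) :
    Continuous fun p : unitInterval × Tot X => Φ p.1 p.2 := by
  have h1 : ∀ (K : CompHaus.{0}) (φ : C(CH K, Tot X)),
      Continuous fun p : CH K × unitInterval => Φ p.2 (φ p.1) := fun K φ =>
    (Tot.continuous_iff _).2 (h K φ ((Tot.continuous_iff _).1 φ.continuous))
  -- A one-point parameter space isolates the dependence on `r`.
  have h2 : ∀ x : Tot X, Continuous fun r => Φ r x := fun x =>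
    (h1 (CompHaus.of PUnit) (ContinuousMap.const _ x)).comp
      (f := fun r : unitInterval => (PUnit.unit, r)) (by fun_prop)
  -- In curried form continuity can be tested on compact Hausdorff spaces, as `Tot X` is compactly
  -- generated; since the interval is locally compact, the result can be uncurried.
  have h3 : Continuous fun x : Tot X => (⟨fun r => Φ r x, h2 x⟩ : C(unitInterval, Tot Y)) :=
    (IsGeneratedBy.continuous_iff CH _).2 fun K φ =>
      ContinuousMap.continuous_of_continuous_uncurry _ (h1 K φ)
  exact (ContinuousMap.continuous_uncurry_of_continuous ⟨_, h3⟩).comp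
    (f := fun p : unitInterval × Tot X => (p.2, p.1)) (by fun_prop)

theorem contractibleSpace_of_homotopies {Y : Type u} [TopologicalSpace Y]
    (F G : unitInterval → Y → Y) (c : Y)
    (hF : Continuous fun p : unitInterval × Y => F p.1 p.2)
    (hG : Continuous fun p : unitInterval × Y => G p.1 p.2)
    (h0 : ∀ y, F 0 y = y) (h1 : ∀ y, G 0 y = F 1 y) (h2 : ∀ y, G 1 y = c) :
    ContractibleSpace Y := by
  let γ : C(Y, Y) := ⟨F 1, hF.comp (continuous_const.prodMk continuous_id)⟩
  have hγ : (ContinuousMap.id Y).Homotopic γ := ⟨⟨⟨_, hF⟩, h0, fun _ => rfl⟩⟩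
  have hc : γ.Homotopic (ContinuousMap.const _ c) := ⟨⟨⟨_, hG⟩, h1, h2⟩⟩
  exact (contractible_iff_id_nullhomotopic _).2 ⟨c, hγ.trans hc⟩

section ContractTot

/-- The map of spaces `Tot` induced by the contraction of `Ξ_K(Δ^•)`. -/
def totContraction (K : Type) [Fintype K] [LinearOrder K] (r : unitInterval)
    (φ : Tot (Xi fun _ : K => Simp)) : Tot (Xi fun _ : K => Simp) :=
  (φ : Simp ⟶ Xi fun _ : K => Simp) ≫ contraction K r

/-- The contraction of the image of `Tot(Δ^•)`. -/
def totStraightLine (K : Type) [Fintype K] [LinearOrder K] [Nonempty K] (r : unitInterval)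
    (φ : Tot (Xi fun _ : K => Simp)) : Tot (Xi fun _ : K => Simp) :=
  straightLine r ((φ : Simp ⟶ Xi fun _ : K => Simp) ≫ average K) ≫ standardCut K

variable (K : Type) [Fintype K] [LinearOrder K]

theorem continuous_totContraction : Continuous fun p : unitInterval × Tot (Xi fun _ : K => Simp) =>
    totContraction K p.1 p.2 := by
  refine Tot.continuous_uncurry (totContraction K) fun Z φ hφ => ?_
  refine JointlyCont.comp (B := Xi fun _ : K => Simp) (fun S => ?_) (fun S => ?_)
  · exact ContinuousGeneratedBy.comp (hφ S)
      (f := fun p : (CH Z × unitInterval) × Simp.obj S => (p.1.1, p.2))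
      (Continuous.continuousGeneratedBy (by fun_prop))
  · exact ContinuousGeneratedBy.comp (jointlyCont_contraction (K := K) S)
      (f := fun p : (CH Z × unitInterval) × (Xi fun _ : K => Simp).obj S => (p.1.2, p.2))
      (Continuous.continuousGeneratedBy (by fun_prop))

theorem totContraction_zero (φ : Tot (Xi fun _ : K => Simp)) : totContraction K 0 φ = φ := by
  rw [totContraction, contraction_zero]
  exact Category.comp_id (X := (Simp : AugCosimp)) _

variable [Nonempty K]

theorem continuous_totStraightLine :
    Continuous fun p : unitInterval × Tot (Xi fun _ : K => Simp) =>
      totStraightLine K p.1 p.2 := by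
  refine Tot.continuous_uncurry (totStraightLine K) fun Z φ hφ => ?_
  have : CompactSpace (CH Z) := inferInstanceAs (CompactSpace Z)
  have : T2Space (CH Z) := inferInstanceAs (T2Space Z)
  have hav : JointlyCont fun z : CH Z => φ z ≫ average K := hφ.comp (.const (average K))
  have hl := jointlyCont_straightLine hav
  have hs : JointlyCont fun _ : CH Z × unitInterval => standardCut K := .const _
  exact hl.comp hs

theorem totStraightLine_zero (φ : Tot (Xi fun _ : K => Simp)) :
    totStraightLine K 0 φ = totContraction K 1 φ := by
  rw [totStraightLine, totContraction, straightLine_zero, contraction_one]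
  exact Category.assoc (W := (Simp : AugCosimp)) _ _ _

theorem totStraightLine_one (φ : Tot (Xi fun _ : K => Simp)) :
    totStraightLine K 1 φ = standardCut K := by
  rw [totStraightLine, straightLine_one]
  exact Category.id_comp _

/-- The path is deformed first; the map is then in the image of `Tot(Δ^•)` under `standardCut`,
where straight lines lead to the identity. `K` must be nonempty because `average` divides by `|K|`.
-/
theorem contractibleSpace_tot : ContractibleSpace (Tot (Xi fun _ : K => Simp)) :=
  contractibleSpace_of_homotopies _ _ (standardCut K) (continuous_totContraction K)
    (continuous_totStraightLine K) (totContraction_zero K) (totStraightLine_zero K)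
    (totStraightLine_one K)

end ContractTot

theorem D_contractible (n : ℕ) : ContractibleSpace (D.obj n) := by
  rcases n with _ | n
  · obtain ⟨h⟩ := D_zero
    infer_instance
  · exact contractibleSpace_tot (Fin (n + 1))

theorem D_isEInfty : D.IsEInfty where
  toIsOperad := D_isOperad
  zero := D_zero
  contractible := D_contractible
  free := D_free

/-! ### The inverse of `(X ⊠ Y) ⊠ Z → Ξ_3(X, Y, Z)` -/

section LeftTriple

/-- Changing the index set along a bijection and back again, with identifications of the
families. -/
theorem Xi.reindex_map_reindex_map {K L : Type} {X : K → AugCosimp} {Y : L → AugCosimp}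
    (e : K ≃ L) (e' : L ≃ K) (φ : ∀ l, X (e.symm l) ⟶ Y l) (ψ : ∀ k, Y (e'.symm k) ⟶ X k)
    (he : ∀ k, e.symm (e'.symm k) = k)
    (h : ∀ k, φ (e'.symm k) ≫ ψ k = eqToHom (congrArg X (he k))) :
    Xi.reindex e X ≫ Xi.map φ ≫ Xi.reindex e' Y ≫ Xi.map ψ = 𝟙 (Xi X) :=
  Xi.hom_ext fun T f x => by
    have he' : ∀ k, e' (e k) = k := fun k =>
      (congrArg (fun k => e' (e k)) (he k).symm).trans (by simp)
    rw [compAt_comp, compAt_comp, compAt_comp, Xi.reindex_mk, Xi.map_mk, Xi.reindex_mk, Xi.map_mk,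
      compAt_id]
    refine Xi.mk_eq_mk OrderHom.id (fun t => (he' _).symm) (fun _ => rfl) fun k => ?_
    have key : ∀ (k' : K) (hk : k' = k) (g : fiber f k' →o fiber f k) (hg : ∀ t, (g t).1 = t.1),
        ap (X k) g (compAt (eqToHom (congrArg X hk)) _ (x k')) = x k := by
      rintro k' rfl g hg
      exact (ap_eq_self _ (fun t => Subtype.ext (hg t)) _)
    rw [compAt_ap, compAt_ap, compAt_ap, ap_ap, ← compAt_comp, h]
    exact (ap_ap (X k) _ _ _).trans (key _ (he k) _ fun t => rfl)

/-- The inverse of `leftIndex`. -/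
def leftIndexInv : (Σ i, Fin (leftArity i)) → Fin 3
  | ⟨0, j⟩ => Fin.castSucc (n := 2) j
  | ⟨1, _⟩ => 2

/-- The increasing bijection `{1, 2, 3} → {1, 2} ∐ {1}`. -/
def leftEquiv : Fin 3 ≃ Σ i, Fin (leftArity i) where
  toFun := leftIndex
  invFun := leftIndexInv
  left_inv := by decide
  right_inv := by decide

/-- The increasing bijection `{1, 2, 3} → {1} ∐ {1, 2}`. -/
def rightEquiv : Fin 3 ≃ Σ i, Fin (rightArity i) :=
  (Equiv.ofBijective rightIndex (by decide)).symm

/-- The identification of the families `(X, Y, Z)` and `((X, Y), (Z))`. -/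
def leftHomInv (X Y Z : AugCosimp) : ∀ p : Σ i, Fin (leftArity i),
    triple X Y Z (leftIndexInv p) ⟶ leftFamily X Y Z p.1 p.2
  | ⟨0, (0 : Fin 2)⟩ => 𝟙 X
  | ⟨0, (1 : Fin 2)⟩ => 𝟙 Y
  | ⟨1, (0 : Fin 1)⟩ => 𝟙 Z

/-- The isomorphism `Ξ_3(X, Y, Z) → (X ⊠ Y) ⊠ Z` given by `Λ = Γ⁻¹`. -/
def leftTripleInv (X Y Z : AugCosimp) : Xi (triple X Y Z) ⟶ box (box X Y) Z :=
  Xi.reindex leftEquiv (triple X Y Z) ≫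
  Xi.map (leftHomInv X Y Z) ≫
  Lambda (leftFamily X Y Z) ≫
  Xi.map (pairHom (X := fun i => Xi (leftFamily X Y Z i)) (Y := pair (box X Y) Z)
    (𝟙 (box X Y)) (Xi.eps (Fin 1) Z))

theorem Xi.map_pairHom_comp {X Y Z : Fin 2 → AugCosimp} (φ : X 0 ⟶ Y 0) (ψ : X 1 ⟶ Y 1)
    (φ' : Y 0 ⟶ Z 0) (ψ' : Y 1 ⟶ Z 1) :
    Xi.map (pairHom φ ψ) ≫ Xi.map (pairHom φ' ψ') = Xi.map (pairHom (φ ≫ φ') (ψ ≫ ψ')) := by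
  rw [← Xi.map_comp]
  congr 1
  funext i
  match i with
  | 0 => rfl
  | 1 => rfl

theorem Xi.map_pairHom_id (X : Fin 2 → AugCosimp) :
    Xi.map (pairHom (𝟙 (X 0)) (𝟙 (X 1))) = 𝟙 (Xi X) := by
  rw [← Xi.map_id]
  congr 1
  funext i
  match i with
  | 0 => rfl
  | 1 => rfl

theorem comp_comp_eq_id {C : Type*} [Category C] {A A₁ A₂ B A₃ A₄ : C} {a : A ⟶ A₁} {b : A₁ ⟶ A₂}
    {c : A₂ ⟶ A₃} {d : A₃ ⟶ A₄} {d' : A₄ ⟶ A₃} {c' : A₃ ⟶ A₂} {b' : A₂ ⟶ B} {a' : B ⟶ A}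
    (hd : d ≫ d' = 𝟙 _) (hc : c ≫ c' = 𝟙 _) (ha : a ≫ b ≫ b' ≫ a' = 𝟙 _) :
    (a ≫ b ≫ c ≫ d) ≫ d' ≫ c' ≫ b' ≫ a' = 𝟙 _ := by
  simp only [Category.assoc]
  rw [reassoc_of% hd, reassoc_of% hc, ha]

theorem comp_comp_eq_id' {C : Type*} [Category C] {A A₁ A₂ B A₃ A₄ : C} {a : A ⟶ A₁} {b : A₁ ⟶ A₂}
    {c : A₂ ⟶ A₃} {d : A₃ ⟶ A₄} {d' : A₄ ⟶ B} {c' : B ⟶ A₂} {b' : A₂ ⟶ A₁} {a' : A₁ ⟶ A}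
    (hc : c ≫ d ≫ d' ≫ c' = 𝟙 _) (hb : b ≫ b' = 𝟙 _) (ha : a ≫ a' = 𝟙 _) :
    (a ≫ b ≫ c ≫ d) ≫ d' ≫ c' ≫ b' ≫ a' = 𝟙 _ := by
  simp only [Category.assoc]
  rw [reassoc_of% hc, reassoc_of% hb, ha]

theorem leftTripleInv_leftTriple (X Y Z : AugCosimp) :
    leftTripleInv X Y Z ≫ leftTriple X Y Z = 𝟙 _ := by
  have h1 : Xi.map (pairHom (X := fun i => Xi (leftFamily X Y Z i)) (Y := pair (box X Y) Z)
      (𝟙 (box X Y)) (Xi.eps (Fin 1) Z)) ≫ Xi.map (pairHom (X := pair (box X Y) Z)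
      (Y := fun i => Xi (leftFamily X Y Z i)) (𝟙 (box X Y)) (Xi.iota (Fin 1) Z)) = 𝟙 _ := by
    refine (Xi.map_pairHom_comp _ _ _ _).trans (Eq.trans ?_ (Xi.map_pairHom_id _))
    congr 2
    exact Xi.eps_iota _ _
  -- The two numberings of the three factors are inverse to each other, and over each index the
  -- identifications of families are identities.
  have h2 := Xi.reindex_map_reindex_map (X := triple X Y Z)
    (Y := fun p : Σ i, Fin (leftArity i) => leftFamily X Y Z p.1 p.2) leftEquiv
    (Equiv.ofBijective leftIndex (by decide)).symm (leftHomInv X Y Z) (leftHom X Y Z)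
    (fun k => leftEquiv.symm_apply_apply k) (fun k => by
      match k with
      | 0 => exact Category.comp_id _
      | 1 => exact Category.comp_id _
      | 2 => exact Category.comp_id _)
  exact comp_comp_eq_id h1 (Lambda_Gamma _) h2

theorem leftTriple_leftTripleInv (X Y Z : AugCosimp) :
    leftTriple X Y Z ≫ leftTripleInv X Y Z = 𝟙 _ := by
  have h1 : Xi.map (pairHom (X := pair (box X Y) Z)
      (Y := fun i => Xi (leftFamily X Y Z i)) (𝟙 (box X Y)) (Xi.iota (Fin 1) Z)) ≫
      Xi.map (pairHom (X := fun i => Xi (leftFamily X Y Z i)) (Y := pair (box X Y) Z)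
      (𝟙 (box X Y)) (Xi.eps (Fin 1) Z)) = 𝟙 _ := by
    refine (Xi.map_pairHom_comp _ _ _ _).trans (Eq.trans ?_ (Xi.map_pairHom_id _))
    congr 2
    exact Xi.iota_eps _ _
  have h2 := Xi.reindex_map_reindex_map (Y := triple X Y Z)
    (X := fun p : Σ i, Fin (leftArity i) => leftFamily X Y Z p.1 p.2)
    (Equiv.ofBijective leftIndex (by decide)).symm leftEquiv (leftHom X Y Z) (leftHomInv X Y Z)
    (fun k => leftEquiv.apply_symm_apply k) (fun k => by
      match k with
      | ⟨0, (0 : Fin 2)⟩ => exact Category.comp_id _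
      | ⟨0, (1 : Fin 2)⟩ => exact Category.comp_id _
      | ⟨1, (0 : Fin 1)⟩ => exact Category.comp_id _)
  refine comp_comp_eq_id' h2 (Gamma_Lambda _) h1

/-- The associativity of a product `X ⊠ X → X`, as an equality of maps defined on
`Ξ_3(X, X, X)`. -/
theorem box_assoc_iff {X : AugCosimp} (μ : box X X ⟶ X) :
    boxHom μ (𝟙 X) ≫ μ = associator X X X ≫ boxHom (𝟙 X) μ ≫ μ ↔
      leftTripleInv X X X ≫ boxHom μ (𝟙 X) ≫ μ = rightTriple X X X ≫ boxHom (𝟙 X) μ ≫ μ := by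
  constructor
  · intro h
    rw [h, associator, Category.assoc, reassoc_of% (leftTripleInv_leftTriple X X X)]
  · intro h
    rw [associator, Category.assoc, ← h, reassoc_of% (leftTriple_leftTripleInv X X X)]

end LeftTriple

/-! ### The commutative monoid of a `Ξ`-algebra -/

section ToMonoid

variable {X : AugCosimp} (A : XiAlgebra X)

namespace XiAlgebra

/-- `Xi.eps` is inverse to `Xi.iota`, so the unit axiom determines the unary structure map. -/
theorem act_one_eq_eps : A.act 1 = Xi.eps (Fin 1) X := by
  have h := congrArg (Xi.eps (Fin 1) X ≫ ·) A.unit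
  exact ((Category.id_comp _).symm.trans (congrArg (· ≫ A.act 1) (Xi.eps_iota (Fin 1) X)).symm).trans
    ((Category.assoc _ _ _).trans (h.trans (Category.comp_id _)))

/-- The associativity of a `Ξ`-algebra in terms of `Λ`. -/
theorem Lambda_map_act {k n : ℕ} (j : Fin k → ℕ) (e : (Σ i, Fin (j i)) ≃ Fin n) :
    Lambda (fun i (_ : Fin (j i)) => X) ≫ Xi.map (fun i => A.act (j i)) ≫ A.act k =
      Xi.reindex e (fun _ => X) ≫ A.act n := by
  have h1 : Xi.map (fun i => A.act (j i)) ≫ A.act k = Gamma (fun i (_ : Fin (j i)) => X) ≫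
      Xi.reindex finSigmaFinEquiv (fun _ => X) ≫ A.act (∑ i, j i) :=
    (A.assoc j).trans (Category.assoc _ _ _)
  refine (eq_Gamma_comp_iff.1 h1).trans ?_
  rw [← A.reindex_act (finSigmaFinEquiv.symm.trans e)]
  refine (Category.assoc _ _ _).symm.trans (congrArg (· ≫ A.act n) ?_)
  refine Xi.reindex_comp_reindex ?_ X
  ext p
  simp

/-- A block decomposition of `n` factors, evaluated block by block, gives the `n`-ary action. The
families are arbitrary so that both bracketings of a triple `⊠`-product are instances. -/
theorem reindex_Lambda_map_act {k n : ℕ} {j : Fin k → ℕ} (e : Fin n ≃ Σ i, Fin (j i))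
    {W : Fin n → AugCosimp} {Z : ∀ i, Fin (j i) → AugCosimp}
    (χ : ∀ p : Σ i, Fin (j i), W (e.symm p) ⟶ Z p.1 p.2) (φ : ∀ i b, Z i b ⟶ X)
    (τ : ∀ l, W l ⟶ X) (h : ∀ p : Σ i, Fin (j i), χ p ≫ φ p.1 p.2 = τ (e.symm p)) :
    Xi.reindex e W ≫ Xi.map χ ≫ Lambda Z ≫ Xi.map (fun i => Xi.map (φ i) ≫ A.act (j i)) ≫
      A.act k = Xi.map τ ≫ A.act n := by
  have h1 := Lambda_naturality (X := Z) (Y := fun _ _ => X) φ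
  have h2 := Xi.reindex_naturality e (X := W) (Y := fun _ => X) τ
  have h3 := A.Lambda_map_act j e.symm
  have h4 : Xi.reindex e (fun _ => X) ≫ Xi.reindex e.symm (fun _ => X) ≫ A.act n = A.act n :=
    (Category.assoc _ _ _).symm.trans ((congrArg (· ≫ A.act n) (Xi.reindex_symm_const e X)).trans
      (Category.id_comp _))
  have h5 : Xi.map (fun i => Xi.map (φ i) ≫ A.act (j i)) =
      Xi.map (fun i => Xi.map (φ i)) ≫ Xi.map (fun i => A.act (j i)) := Xi.map_comp _ _
  have h6 : Xi.map χ ≫ Xi.map (fun p : Σ i, Fin (j i) => φ p.1 p.2) =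
      Xi.map (fun p => τ (e.symm p)) :=
    (Xi.map_comp _ _).symm.trans (congrArg Xi.map (funext h))
  rw [h5, Category.assoc, reassoc_of% h1, h3, reassoc_of% h6, reassoc_of% h2, h4]

/-- The unit of the commutative monoid of a `Ξ`-algebra. -/
def one : boxUnit ⟶ X := Xi.map (Y := fun _ : Fin 0 => X) (fun i => i.elim0) ≫ A.act 0

/-- The product of the commutative monoid of a `Ξ`-algebra. -/
def mul : box X X ⟶ X :=
  Xi.map (pairHom (X := pair X X) (Y := fun _ => X) (𝟙 X) (𝟙 X)) ≫ A.act 2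

theorem braiding_mul : braiding X X ≫ A.mul = A.mul := by
  have h := Xi.reindex_naturality (Equiv.swap (0 : Fin 2) 1) (X := pair X X) (Y := fun _ => X)
    (pairHom (X := pair X X) (Y := fun _ => X) (𝟙 X) (𝟙 X))
  have h' : Xi.map (pairHom (X := fun l => pair X X ((Equiv.swap (0 : Fin 2) 1).symm l))
      (Y := pair X X) (𝟙 X) (𝟙 X)) ≫
      Xi.map (pairHom (X := pair X X) (Y := fun _ => X) (𝟙 X) (𝟙 X)) =
      Xi.map (fun l => pairHom (X := pair X X) (Y := fun _ => X) (𝟙 X) (𝟙 X)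
        ((Equiv.swap (0 : Fin 2) 1).symm l)) := by
    refine (Xi.map_comp _ _).symm.trans (congrArg Xi.map (funext fun l => ?_))
    match l with
    | 0 => exact Category.comp_id _
    | 1 => exact Category.comp_id _
  have h₁ : (braiding X X ≫ Xi.map (pairHom (X := pair X X) (Y := fun _ => X) (𝟙 X) (𝟙 X)) :
      box X X ⟶ Xi fun _ => X) = Xi.map (pairHom (X := pair X X) (Y := fun _ => X) (𝟙 X) (𝟙 X)) ≫
        Xi.reindex (Equiv.swap (0 : Fin 2) 1) (fun _ => X) :=
    (Category.assoc _ _ _).trans ((congrArg (_ ≫ ·) h').trans h)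
  refine (Category.assoc _ _ _).symm.trans ((congrArg (· ≫ A.act 2) h₁).trans ?_)
  exact (Category.assoc _ _ _).trans (congrArg (_ ≫ ·) (A.equivariant _))

/-- The identification of the family `(X, X, X)` with a constant family. -/
def _root_.CosimpOperad.tripleHom (X : AugCosimp) : ∀ l, triple X X X l ⟶ X
  | 0 => 𝟙 X
  | 1 => 𝟙 X
  | 2 => 𝟙 X

/-- Associativity of the algebra in arities `(2, 1)`; `rightTriple_mul` is the case `(1, 2)`. Both
bracketings are thus the ternary action. -/
theorem leftTripleInv_mul :
    leftTripleInv X X X ≫ boxHom A.mul (𝟙 X) ≫ A.mul = Xi.map (tripleHom X) ≫ A.act 3 := by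
  let φ : ∀ i b, leftFamily X X X i b ⟶ X
    | 0 => pairHom (X := pair X X) (Y := fun _ => X) (𝟙 X) (𝟙 X)
    | 1 => fun _ => 𝟙 X
  have h := A.reindex_Lambda_map_act leftEquiv (leftHomInv X X X) φ (tripleHom X) (by
    intro p
    match p with
    | ⟨0, (0 : Fin 2)⟩ => exact Category.comp_id _
    | ⟨0, (1 : Fin 2)⟩ => exact Category.comp_id _
    | ⟨1, (0 : Fin 1)⟩ => exact Category.comp_id _)
  have h' : Xi.map (pairHom (X := fun i => Xi (leftFamily X X X i)) (Y := pair (box X X) X)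
      (𝟙 (box X X)) (Xi.eps (Fin 1) X)) ≫ boxHom A.mul (𝟙 X) ≫
      Xi.map (pairHom (X := pair X X) (Y := fun _ => X) (𝟙 X) (𝟙 X)) =
      Xi.map (fun i => Xi.map (φ i) ≫ A.act (leftArity i)) := by
    refine (congrArg (_ ≫ ·) (Xi.map_comp _ _).symm).trans
      ((Xi.map_comp _ _).symm.trans (congrArg Xi.map (funext fun i => ?_)))
    match i with
    | 0 => exact (Category.id_comp _).trans (Category.comp_id A.mul)
    | 1 =>
      refine (Category.comp_id (Xi.eps (Fin 1) X ≫ 𝟙 X)).trans ((Category.comp_id _).trans ?_)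
      refine Eq.symm ((congrArg (· ≫ A.act 1) (Xi.map_id _)).trans ?_)
      exact (Category.id_comp _).trans A.act_one_eq_eps
  refine Eq.trans ?_ h
  rw [← h', leftTripleInv, mul]
  simp only [Category.assoc]
  rfl

theorem rightTriple_mul :
    rightTriple X X X ≫ boxHom (𝟙 X) A.mul ≫ A.mul = Xi.map (tripleHom X) ≫ A.act 3 := by
  let φ : ∀ i b, rightFamily X X X i b ⟶ X
    | 0 => fun _ => 𝟙 X
    | 1 => pairHom (X := pair X X) (Y := fun _ => X) (𝟙 X) (𝟙 X)
  have h := A.reindex_Lambda_map_act rightEquiv (rightHom X X X) φ (tripleHom X) (by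
    intro p
    match p with
    | ⟨0, (0 : Fin 1)⟩ => exact Category.comp_id _
    | ⟨1, (0 : Fin 2)⟩ => exact Category.comp_id _
    | ⟨1, (1 : Fin 2)⟩ => exact Category.comp_id _)
  have h' : Xi.map (pairHom (X := fun i => Xi (rightFamily X X X i)) (Y := pair X (box X X))
      (Xi.eps (Fin 1) X) (𝟙 (box X X))) ≫ boxHom (𝟙 X) A.mul ≫
      Xi.map (pairHom (X := pair X X) (Y := fun _ => X) (𝟙 X) (𝟙 X)) =
      Xi.map (fun i => Xi.map (φ i) ≫ A.act (rightArity i)) := by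
    refine (congrArg (_ ≫ ·) (Xi.map_comp _ _).symm).trans
      ((Xi.map_comp _ _).symm.trans (congrArg Xi.map (funext fun i => ?_)))
    match i with
    | 0 =>
      refine (Category.comp_id (Xi.eps (Fin 1) X ≫ 𝟙 X)).trans ((Category.comp_id _).trans ?_)
      refine Eq.symm ((congrArg (· ≫ A.act 1) (Xi.map_id _)).trans ?_)
      exact (Category.id_comp _).trans A.act_one_eq_eps
    | 1 => exact (Category.id_comp _).trans (Category.comp_id A.mul)
  refine Eq.trans ?_ h
  rw [← h', rightTriple, mul]
  simp only [Category.assoc]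
  rfl

/-- The arities `(0, 1)`. -/
def _root_.CosimpOperad.unitArity : Fin 2 → ℕ
  | 0 => 0
  | 1 => 1

/-- The bijection `{1} → ∅ ∐ {1}`. -/
def _root_.CosimpOperad.unitEquiv : Fin 1 ≃ Σ i, Fin (unitArity i) where
  toFun _ := ⟨1, (0 : Fin 1)⟩
  invFun _ := 0
  left_inv := by decide
  right_inv := by decide

/-- Associativity in arities `(0, 1)`, evaluated at the image of `x` under `Xi.iota`. Its component
at label `0` comes from a nullary operation, and `Ξ_0` has only one point at each level, so the
choice of `w` is immaterial. -/
theorem act_two_unit {S : FinLinOrd} (x : X.obj S)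
    (y : ∀ i, X.obj (fiber (T := S) (fun _ => (1 : Fin 2)) i))
    (h0 : ∃ w, y 0 = compAt (A.act 0) _ w)
    (h1 : y 1 = ap X (T := fiber (T := S) (fun _ => (1 : Fin 2)) 1)
      ⟨fun s => ⟨s, rfl⟩, fun _ _ h => h⟩ x) :
    compAt (A.act 2) S (Xi.mk (T := S) (X := fun _ => X) (fun _ => 1) OrderHom.id y) = x := by
  have h2 := A.Lambda_map_act unitArity unitEquiv.symm
  have h3 := (congrArg (Xi.reindex unitEquiv (fun _ => X) ≫ ·) h2).trans
    ((Category.assoc _ _ _).symm.trans ((congrArg (· ≫ A.act 1)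
      (Xi.reindex_symm_const unitEquiv X)).trans (Category.id_comp _)))
  have h4 : compAt (A.act 2) S (compAt (Xi.map fun i => A.act (unitArity i)) S
      (compAt (Lambda fun i (_ : Fin (unitArity i)) => X) S
        (compAt (Xi.reindex unitEquiv fun _ => X) S (compAt (Xi.iota (Fin 1) X) S x)))) =
        compAt (A.act 1) S (compAt (Xi.iota (Fin 1) X) S x) :=
    congrArg (fun φ => compAt φ S (compAt (Xi.iota (Fin 1) X) S x)) h3
  have h5 : compAt (A.act 1) S (compAt (Xi.iota (Fin 1) X) S x) = x :=
    congrArg (fun φ => compAt φ S x) A.unit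
  rw [h5, Xi.iota_apply, Xi.reindex_mk, Lambda_mk, Xi.map_mk] at h4
  refine Eq.trans (congrArg (compAt (A.act 2) S) (Eq.symm ?_)) h4
  refine Xi.mk_eq_mk (f' := fun _ : S => (1 : Fin 2)) OrderHom.id (fun _ => ?_) (fun _ => rfl)
    fun i => ?_
  · rfl
  match i with
  | 0 =>
    obtain ⟨w, hw⟩ := h0
    rw [hw]
    refine (compAt_ap (A.act 0) _ _).symm.trans (congrArg _ ?_)
    exact Xi.eq_of_isEmpty (K := Fin 0) _ _
  | 1 =>
    rw [h1]
    change ap X _ (compAt (A.act 1) _ _) = _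
    rw [A.act_one_eq_eps]
    refine (congrArg (ap X _) (Xi.eps_mk (Fin 1) X _ _ _)).trans ?_
    refine (ap_ap X _ _ _).trans ((ap_ap X _ _ _).trans ((ap_ap X _ _ _).trans
      ((ap_ap X _ _ _).trans ?_)))
    rfl

theorem one_mul : boxHom A.one (𝟙 X) ≫ A.mul = leftUnitor X :=
  Xi.hom_ext fun T f x => by
    have h1 : compAt (leftUnitor X) T (Xi.mk f OrderHom.id x) = ap X (fiberIncl f 1) (x 1) :=
      (Xi.desc_mk _ _ _ f OrderHom.id x).trans (ap_id X _)
    -- Elements labelled `0` carry only the point of `Ξ_0`, so `T` can be cut down to the fibre over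
    -- `1`, where the label is constant and `act_two_unit` applies.
    let y : ∀ i, X.obj (fiber (T := fiber f 1) (fun _ => (1 : Fin 2)) i)
      | 0 => compAt A.one _ (Xi.mk (T := fin 0) Fin.elim0 ⟨Fin.elim0, fun i => i.elim0⟩ Fin.rec0)
      | 1 => ap X (T := fiber (T := fiber f 1) (fun _ => (1 : Fin 2)) 1)
          ⟨fun s => ⟨s, rfl⟩, fun _ _ h => h⟩ (x 1)
    refine Eq.trans ?_ ((congrArg (ap X (fiberIncl f 1))
      (A.act_two_unit (x 1) y ⟨_, rfl⟩ rfl)).trans h1.symm)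
    rw [← compAt_ap, Xi.ap_mk]
    refine (congrArg (compAt A.mul T) (Xi.map_mk _ _ _ _)).trans ?_
    refine congrArg (compAt (A.act 2) T) ((Xi.map_mk _ _ _ _).trans (Eq.symm ?_))
    refine Xi.mk_eq_mk (fiberIncl f 1) (fun t => t.2) (fun _ => rfl) fun i => ?_
    match i with
    | 0 =>
      refine (compAt_ap A.one _ _).symm.trans (congrArg (compAt A.one _) ?_)
      exact Xi.eq_of_isEmpty (K := Fin 0) _ _
    | 1 => exact (ap_ap X _ _ _).trans (ap_eq_self X (fun _ => rfl) _)

theorem _root_.CosimpOperad.braiding_boxHom (ν : boxUnit ⟶ X) :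
    boxHom (𝟙 X) ν ≫ braiding X X = braiding X boxUnit ≫ boxHom ν (𝟙 X) :=
  Xi.hom_ext fun T f x => by
    refine (congrArg (compAt (braiding X X) T) (Xi.map_mk _ _ _ _)).trans ?_
    refine (congrArg (compAt (Xi.map _) T) (Xi.reindex_mk _ _ _ _)).trans
      ((Xi.map_mk _ _ _ _).trans ?_)
    refine Eq.symm ((congrArg (fun w => compAt (boxHom ν (𝟙 X)) T (compAt (Xi.map _) T w))
      (Xi.reindex_mk _ _ _ _)).trans ?_)
    refine (congrArg (compAt (boxHom ν (𝟙 X)) T) (Xi.map_mk _ _ _ _)).trans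
      ((Xi.map_mk _ _ _ _).trans (congrArg (Xi.mk _ _) (funext fun i => ?_)))
    match i with
    | 0 => exact compAt_ap ν _ _
    | 1 => rfl

theorem _root_.CosimpOperad.braiding_leftUnitor (X : AugCosimp) :
    braiding X boxUnit ≫ leftUnitor X = rightUnitor X :=
  Xi.hom_ext fun T f x => by
    have h1 : compAt (rightUnitor X) T (Xi.mk f OrderHom.id x) = ap X (fiberIncl f 0) (x 0) :=
      (Xi.desc_mk _ _ _ f OrderHom.id x).trans (ap_id X _)
    refine Eq.trans ?_ h1.symm
    refine (congrArg (fun w => compAt (leftUnitor X) T (compAt (Xi.map _) T w))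
      (Xi.reindex_mk _ _ _ _)).trans ?_
    refine (congrArg (compAt (leftUnitor X) T) (Xi.map_mk _ _ _ _)).trans
      ((Xi.desc_mk _ _ _ _ _ _).trans ((ap_id X _).trans ?_))
    exact ap_ap X _ _ _

theorem mul_one : boxHom (𝟙 X) A.one ≫ A.mul = rightUnitor X := by
  rw [← A.braiding_mul, ← braiding_leftUnitor, ← A.one_mul, ← Category.assoc, ← Category.assoc,
    braiding_boxHom]

/-- The commutative monoid of a `Ξ`-algebra. -/
def toCommBoxMonoid : CommBoxMonoid X where
  one := A.one
  mul := A.mul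
  one_mul := A.one_mul
  mul_one := A.mul_one
  mul_assoc := (box_assoc_iff A.mul).2 (A.leftTripleInv_mul.trans A.rightTriple_mul.symm)
  mul_comm := A.braiding_mul

theorem restrictsTo_toCommBoxMonoid : A.RestrictsTo A.toCommBoxMonoid := ⟨rfl, rfl⟩

end XiAlgebra

end ToMonoid

/-! ### The partial monoid of elements of a commutative `⊠`-monoid -/

section Pieces

variable {X : AugCosimp} {M : CommBoxMonoid X} {Ω : FinLinOrd}

/-- A subset of a finite totally ordered set, with the induced order. -/
abbrev FinLinOrd.sub (A : Set Ω) : FinLinOrd := ⟨A⟩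

/-- The points of the spaces `X^A` for `A ⊆ Ω`, together with an absorbing element. -/
inductive Piece (M : CommBoxMonoid X) (Ω : FinLinOrd) : Type
  | none
  | of (p : Σ A : Set Ω, X.obj (sub A))

theorem sigma_sub_ext {p q : Σ A : Set Ω, X.obj (sub A)} (h : p.1 = q.1)
    (hx : ap X (S := sub p.1) (T := sub q.1) ⟨fun a => ⟨a.1, h ▸ a.2⟩, fun _ _ hab => hab⟩ p.2 = q.2) :
    p = q := by
  obtain ⟨A, x⟩ := p
  obtain ⟨B, y⟩ := q
  obtain rfl : A = B := h
  obtain rfl : x = y := (ap_eq_self X (fun _ => rfl) x).symm.trans hx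
  rfl

/-- An order-preserving map as a map to its range. -/
def toRange {S : FinLinOrd} (u : S →o Ω) : S →o sub (Set.range u) :=
  ⟨fun s => ⟨u s, s, rfl⟩, fun _ _ h => u.monotone h⟩

/-- The image in `Piece M Ω` of a point of `X^S`, for a map `S → Ω`. -/
def elt (M : CommBoxMonoid X) {S : FinLinOrd} (u : S →o Ω) (x : X.obj S) : Piece M Ω :=
  .of ⟨Set.range u, ap X (toRange u) x⟩

theorem elt_eq_of {S : FinLinOrd} {u : S →o Ω} {x : X.obj S} {A : Set Ω} {y : X.obj (sub A)}
    (g : S →o sub A) (hg : Function.Surjective g) (h : ∀ s, (g s).1 = u s) (hx : ap X g x = y) :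
    elt M u x = .of ⟨A, y⟩ := by
  refine congrArg Piece.of (sigma_sub_ext ?_ ?_)
  · ext a
    constructor
    · rintro ⟨s, rfl⟩
      exact h s ▸ (g s).2
    · intro ha
      obtain ⟨s, hs⟩ := hg ⟨a, ha⟩
      exact ⟨s, (h s).symm.trans (congrArg Subtype.val hs)⟩
  · refine (ap_ap X _ _ _).trans ((ap_congr X (fun s => ?_) x).trans hx)
    exact Subtype.ext (h s).symm

theorem elt_congr {S : FinLinOrd} {u v : S →o Ω} (h : ∀ s, u s = v s) (x : X.obj S) :
    elt M u x = elt M v x := by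
  rw [OrderHom.ext _ _ (funext h)]

/-- A piece remembers the range of the map to `Ω`; surjectivity of `g` ensures that the range is the
same on both sides. -/
theorem elt_ap {S S' : FinLinOrd} (u : S' →o Ω) {g : S →o S'} (hg : Function.Surjective g)
    (x : X.obj S) : elt M u (ap X g x) = elt M (u.comp g) x := by
  refine Eq.symm (elt_eq_of ((toRange u).comp g) ?_ (fun _ => rfl) (ap_ap X _ _ _).symm)
  rintro ⟨_, s, rfl⟩
  obtain ⟨r, rfl⟩ := hg s
  exact ⟨r, rfl⟩

/-- For injective `u`, the map to the range is an isomorphism of ordered sets, so identities between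
pieces descend to identities in `X^S`. -/
theorem elt_injective {S : FinLinOrd} {u : S →o Ω} (hu : Function.Injective u) :
    Function.Injective (elt M u (X := X)) := by
  intro x y hxy
  have h : ap X (toRange u) x = ap X (toRange u) y :=
    eq_of_heq (Sigma.ext_iff.1 (Piece.of.inj hxy)).2
  let e := (u.monotone.strictMono_of_injective hu).orderIso
  let g : sub (Set.range u) →o S := ⟨e.symm, e.symm.monotone⟩
  have hg : ∀ s, g (toRange u s) = s := fun s => e.symm_apply_apply s
  have h' := congrArg (ap X g) h
  rw [ap_ap, ap_ap] at h'
  exact (ap_eq_self X (g := g.comp (toRange u)) hg x).symm.trans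
    (h'.trans (ap_eq_self X (g := g.comp (toRange u)) hg y))

/-- Pairwise disjoint subsets are the fibres of a map. -/
theorem exists_elt_eq {K : Type} (p : K → Σ A : Set Ω, X.obj (sub A))
    (hp : Pairwise fun i j => Disjoint (p i).1 (p j).1) :
    ∃ (T : FinLinOrd) (w : T →o Ω) (_ : Function.Injective w) (f : T → K)
      (x : ∀ i, X.obj (fiber f i)), ∀ i, Piece.of (p i) = elt M (w.comp (fiberIncl f i)) (x i) := by
  let T : FinLinOrd := sub (⋃ i, (p i).1)
  have hT : ∀ t : T, ∃ i, t.1 ∈ (p i).1 := fun t => Set.mem_iUnion.1 t.2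
  choose f hf using hT
  have hf' : ∀ (t : T) i, t.1 ∈ (p i).1 → f t = i := fun t i hi => by
    by_contra hne
    exact Set.disjoint_left.1 (hp hne) (hf t) hi
  let g : ∀ i, sub (p i).1 →o fiber f i := fun i =>
    ⟨fun a => ⟨⟨a.1, Set.mem_iUnion.2 ⟨i, a.2⟩⟩, hf' _ i a.2⟩, fun _ _ h => h⟩
  have hg : ∀ i, Function.Surjective (g i) := by
    rintro i ⟨t, rfl⟩
    exact ⟨⟨t.1, hf t⟩, rfl⟩
  refine ⟨T, ⟨Subtype.val, fun _ _ h => h⟩, Subtype.val_injective, f,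
    fun i => ap X (g i) (p i).2, fun i => ?_⟩
  rw [elt_ap _ (hg i)]
  exact (elt_eq_of OrderHom.id Function.surjective_id (fun _ => rfl) (ap_id X _)).symm

/-- The label of a union of two disjoint subsets. -/
def unionLabel (A B : Set Ω) (t : sub (A ∪ B)) : Fin 2 := by
  classical exact if t.1 ∈ A then 0 else 1

/-- The family of two points on disjoint subsets, as a family on the fibres of `unionLabel`. -/
def unionFamily (p q : Σ A : Set Ω, X.obj (sub A)) (h : Disjoint p.1 q.1) :
    ∀ i, (pair X X i).obj (fiber (unionLabel p.1 q.1) i)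
  | 0 => ap X (S := sub p.1) (T := fiber (unionLabel p.1 q.1) 0)
      ⟨fun a => ⟨⟨a.1, Or.inl a.2⟩, if_pos a.2⟩, fun _ _ h => h⟩ p.2
  | 1 => ap X (S := sub q.1) (T := fiber (unionLabel p.1 q.1) 1)
      ⟨fun a => ⟨⟨a.1, Or.inr a.2⟩, if_neg (Set.disjoint_right.1 h a.2)⟩, fun _ _ h => h⟩ q.2

open Classical in
/-- The product of pieces: it is defined (that is, not `none`) for disjoint subsets. -/
instance : Mul (Piece M Ω) where
  mul
    | .of p, .of q =>
      if h : Disjoint p.1 q.1 then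
        .of ⟨p.1 ∪ q.1, compAt M.mul _ (Xi.mk (X := pair X X) (unionLabel p.1 q.1) OrderHom.id
          (unionFamily p q h))⟩
      else .none
    | .of _, .none => .none
    | .none, _ => .none

theorem Piece.of_mul_of {p q : Σ A : Set Ω, X.obj (sub A)} (h : Disjoint p.1 q.1) :
    (Piece.of p * Piece.of q : Piece M Ω) = .of ⟨p.1 ∪ q.1, compAt M.mul _ (Xi.mk (X := pair X X)
      (unionLabel p.1 q.1) OrderHom.id (unionFamily p q h))⟩ := dif_pos h

theorem Piece.of_mul_of_of_not_disjoint {p q : Σ A : Set Ω, X.obj (sub A)}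
    (h : ¬ Disjoint p.1 q.1) : (Piece.of p * Piece.of q : Piece M Ω) = .none := dif_neg h

theorem Piece.none_mul (a : Piece M Ω) : Piece.none * a = .none := rfl

theorem Piece.mul_none (a : Piece M Ω) : a * Piece.none = .none := by
  cases a <;> rfl

/-- The fibres of `f` embed in `Ω` as disjoint subsets, and `T` maps onto their union compatibly
with labels; naturality of `M.mul` does the rest. Products of pieces can thus be computed on any
labelled `T`. -/
theorem elt_mul {T : FinLinOrd} {w : T →o Ω} (hw : Function.Injective w) (f : T → Fin 2)
    (x : ∀ i, (pair X X i).obj (fiber f i)) :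
    elt M w (compAt M.mul T (Xi.mk (X := pair X X) f OrderHom.id x)) =
      elt M (w.comp (fiberIncl f 0)) (x 0) * elt M (w.comp (fiberIncl f 1)) (x 1) := by
  have hd : Disjoint (Set.range (w.comp (fiberIncl f 0))) (Set.range (w.comp (fiberIncl f 1))) := by
    rw [Set.disjoint_left]
    rintro _ ⟨s, rfl⟩ ⟨t, ht⟩
    have h1 : t.1 = s.1 := hw ht
    have h2 : (1 : Fin 2) = 0 := t.2.symm.trans ((congrArg f h1).trans s.2)
    exact absurd h2 (by decide)
  have hf : ∀ t, f t = 0 ∨ f t = 1 := fun t => by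
    generalize f t = i
    revert i
    decide
  refine Eq.trans ?_ (Piece.of_mul_of hd).symm
  let g : T →o sub (Set.range (w.comp (fiberIncl f 0)) ∪ Set.range (w.comp (fiberIncl f 1))) :=
    ⟨fun t => ⟨w t, (hf t).imp (fun h => ⟨⟨t, h⟩, rfl⟩) (fun h => ⟨⟨t, h⟩, rfl⟩)⟩,
      fun _ _ h => w.monotone h⟩
  have hg : ∀ t, unionLabel (Set.range (w.comp (fiberIncl f 0)))
      (Set.range (w.comp (fiberIncl f 1))) (g t) = f t := by
    intro t
    rcases hf t with h | h
    · exact (if_pos ⟨⟨t, h⟩, rfl⟩).trans h.symm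
    · exact (if_neg (Set.disjoint_right.1 hd ⟨⟨t, h⟩, rfl⟩)).trans h.symm
  refine elt_eq_of g ?_ (fun _ => rfl) ?_
  · rintro ⟨_, ⟨t, rfl⟩ | ⟨t, rfl⟩⟩ <;> exact ⟨t.1, rfl⟩
  · refine (compAt_ap M.mul g _).symm.trans ?_
    refine congrArg (compAt M.mul _) ((Xi.ap_mk _ _ _ _).trans ?_)
    refine Xi.mk_eq_mk g hg (fun _ => rfl) fun i => ?_
    match i with
    | 0 => exact Eq.symm (ap_ap X (toRange (w.comp (fiberIncl f 0))) _ (x 0))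
    | 1 => exact Eq.symm (ap_ap X (toRange (w.comp (fiberIncl f 1))) _ (x 1))

theorem reindexFiber_surjective {K L : Type} (e : K ≃ L) {T : FinLinOrd} (f : T → K) (l : L) :
    Function.Surjective (reindexFiber e f l) := fun t =>
  ⟨⟨t.1, e.injective (t.2.trans (e.apply_symm_apply l).symm)⟩, rfl⟩

theorem sigmaIncl_surjective {K : Type} {J : K → Type} {T : FinLinOrd} (f : T → Σ i, J i) (i : K)
    (j : J i) : Function.Surjective (sigmaIncl f i j) := fun t =>
  ⟨⟨t.1.1, (sigmaLabel_eq f t.1.1 t.1.2).2 t.2⟩, rfl⟩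

theorem fiberIncl_surjective {K : Type} [Unique K] {T : FinLinOrd} (f : T → K) (i : K) :
    Function.Surjective (fiberIncl f i) := fun t => ⟨⟨t, Subsingleton.elim _ _⟩, rfl⟩

theorem elt_fiber {K : Type} {J : K → Type} {L : Type} {T : FinLinOrd} (w : T →o Ω) (f : T → L)
    (e : L ≃ Σ i, J i) (i : K) (j : J i) (x : X.obj (fiber f (e.symm ⟨i, j⟩))) :
    elt M ((w.comp (fiberIncl (T := T) (fun t => (e (f t)).1) i)).comp
        (fiberIncl (sigmaLabel (T := T) (fun t => e (f t)) i) j))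
      (ap X (sigmaIncl (T := T) (fun t => e (f t)) i j) (ap X (reindexFiber e f ⟨i, j⟩) x)) =
    elt M (w.comp (fiberIncl f (e.symm ⟨i, j⟩))) x := by
  rw [elt_ap _ (sigmaIncl_surjective _ i j), elt_ap _ (reindexFiber_surjective e f ⟨i, j⟩)]
  rfl

theorem Piece.mul_comm (a b : Piece M Ω) : a * b = b * a := by
  rcases a with _ | p
  · exact (Piece.none_mul b).trans (Piece.mul_none b).symm
  rcases b with _ | q
  · exact (Piece.mul_none _).trans (Piece.none_mul _).symm
  by_cases h : Disjoint p.1 q.1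
  -- Disjoint pieces are fibres over one `T`, where the commutativity of `M` can be evaluated.
  · obtain ⟨T, w, hw, f, x, hx⟩ := exists_elt_eq (M := M)
      (fun i : Fin 2 => match i with
        | 0 => p
        | 1 => q) (by
        intro i j hij
        match i, j with
        | 0, 0 => exact absurd rfl hij
        | 0, 1 => exact h
        | 1, 0 => exact h.symm
        | 1, 1 => exact absurd rfl hij)
    have h0 : Piece.of p = elt M (w.comp (fiberIncl f 0)) (x 0) := hx 0
    have h1 : Piece.of q = elt M (w.comp (fiberIncl f 1)) (x 1) := hx 1
    let y : ∀ i, (pair X X i).obj (fiber f i)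
      | 0 => x 0
      | 1 => x 1
    have h2 := congrArg (fun φ => elt M w (compAt φ T (Xi.mk f OrderHom.id y))) M.mul_comm
    have h3 := elt_mul (M := M) hw f y
    have h4 : compAt (braiding X X) T (Xi.mk f OrderHom.id y) = _ :=
      (congrArg (compAt (Xi.map _) T) (Xi.reindex_mk _ _ _ _)).trans (Xi.map_mk _ _ _ _)
    have h5 := congrArg (fun z => elt M w (compAt M.mul T z)) h4
    have h6 := (elt_mul (M := M) hw _ _).symm.trans (h5.symm.trans (h2.trans h3))
    rw [h0, h1]
    refine h6.symm.trans ?_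
    refine congrArg₂ (· * ·) ?_ ?_
    · exact elt_ap _ (reindexFiber_surjective (Equiv.swap (0 : Fin 2) 1) f 0) _
    · exact elt_ap _ (reindexFiber_surjective (Equiv.swap (0 : Fin 2) 1) f 1) _
  · rw [Piece.of_mul_of_of_not_disjoint h,
      Piece.of_mul_of_of_not_disjoint fun h' => h h'.symm]

/-- The unique point of `Ξ_0^S`. -/
def unitPoint (S : FinLinOrd) : boxUnit.obj S :=
  Xi.mk (T := fin 0) Fin.elim0 ⟨Fin.elim0, fun i => i.elim0⟩ Fin.rec0

instance : One (Piece M Ω) where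
  one := elt M (S := fin 0) ⟨Fin.elim0, fun i => i.elim0⟩ (compAt M.one _ (unitPoint _))

theorem elt_unitPoint {S : FinLinOrd} [IsEmpty S] (u : S →o Ω) (z : boxUnit.obj S) :
    elt M u (compAt M.one S z) = 1 := by
  have h : z = ap boxUnit (S := fin 0) ⟨Fin.elim0, fun i => i.elim0⟩ (unitPoint _) :=
    Xi.eq_of_isEmpty (K := Fin 0) _ _
  rw [h, compAt_ap, elt_ap _ fun s => isEmptyElim s]
  exact elt_congr (fun s : Fin 0 => s.elim0) _

theorem Piece.one_mul (a : Piece M Ω) : 1 * a = a := by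
  rcases a with _ | p
  · exact Piece.mul_none _
  let T : FinLinOrd := sub p.1
  let w : T →o Ω := ⟨Subtype.val, fun _ _ h => h⟩
  have hw : Function.Injective w := Subtype.val_injective
  have hp : Piece.of p = elt M w p.2 :=
    (elt_eq_of OrderHom.id Function.surjective_id (fun _ => rfl) (ap_id X _)).symm
  -- With constant label `1` the fibre over `0` is empty and holds the unit, so the left unit law of
  -- `M` applies to `p`.
  let f : T → Fin 2 := fun _ => 1
  let g : T →o fiber f 1 := ⟨fun t => ⟨t, rfl⟩, fun _ _ h => h⟩
  have hg : Function.Surjective g := fun t => ⟨t.1, rfl⟩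
  let y : ∀ i, (pair boxUnit X i).obj (fiber f i)
    | 0 => unitPoint _
    | 1 => ap X g p.2
  have : IsEmpty (fiber f 0) := ⟨fun t => absurd t.2 (by decide)⟩
  have h1 := congrArg (fun φ => elt M w (compAt φ T (Xi.mk f OrderHom.id y))) M.one_mul
  have h2 : compAt (leftUnitor X) T (Xi.mk f OrderHom.id y) = p.2 :=
    (Xi.desc_mk _ _ _ f OrderHom.id y).trans ((ap_id X _).trans
      ((ap_ap X _ _ _).trans (ap_eq_self X (fun _ => rfl) _)))
  have h3 := h1.trans (congrArg (elt M w) h2)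
  have h4 := congrArg (fun z => elt M w (compAt M.mul T z))
    (Xi.map_mk (pairHom (X := pair boxUnit X) (Y := pair X X) M.one (𝟙 X)) f OrderHom.id y)
  have h5 := (elt_mul (M := M) hw f _).symm.trans (h4.symm.trans h3)
  rw [hp]
  refine Eq.trans (congrArg₂ (· * ·) ?_ ?_) h5
  · exact (elt_unitPoint _ _).symm
  · exact (elt_ap (w.comp (fiberIncl f 1)) hg p.2).symm

end Pieces

/-! ### Associativity of the product of pieces -/

section PieceMonoid

variable {X : AugCosimp} {M : CommBoxMonoid X} {Ω : FinLinOrd}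

theorem injective_comp_fiberIncl {K : Type} {T : FinLinOrd} {w : T →o Ω}
    (hw : Function.Injective w) (f : T → K) (i : K) :
    Function.Injective (w.comp (fiberIncl f i)) :=
  hw.comp Subtype.val_injective

theorem compAt_reindex_map_Lambda_map {K L : Type} {J : K → Type} {W : L → AugCosimp}
    {Z : ∀ i, J i → AugCosimp} {V : K → AugCosimp} (e : L ≃ Σ i, J i)
    (χ : ∀ p : Σ i, J i, W (e.symm p) ⟶ Z p.1 p.2) (ψ : ∀ i, Xi (Z i) ⟶ V i) {T : FinLinOrd}
    (f : T → L) (x : ∀ l, (W l).obj (fiber f l)) :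
    compAt (Xi.reindex e W ≫ Xi.map χ ≫ Lambda Z ≫ Xi.map ψ) T (Xi.mk f OrderHom.id x) =
      Xi.mk (T := T) (fun t => (e (f t)).1) OrderHom.id fun i => compAt (ψ i) _
        (Xi.mk (sigmaLabel (T := T) (fun t => e (f t)) i) OrderHom.id fun j =>
          ap (Z i j) (sigmaIncl (T := T) (fun t => e (f t)) i j)
            (compAt (χ ⟨i, j⟩) _ (ap _ (reindexFiber e f ⟨i, j⟩) (x (e.symm ⟨i, j⟩))))) := by
  rw [compAt_comp, compAt_comp, compAt_comp, Xi.reindex_mk, Xi.map_mk, Lambda_mk, Xi.map_mk]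

/-- `Λ` groups the labels into `{0, 1}` and `{2}`. Then `elt_mul` is used for the outer product and
again for the first block. -/
theorem elt_leftTripleInv {T : FinLinOrd} {w : T →o Ω} (hw : Function.Injective w) (f : T → Fin 3)
    (x : ∀ i, (triple X X X i).obj (fiber f i)) :
    elt M w (compAt (leftTripleInv X X X ≫ boxHom M.mul (𝟙 X) ≫ M.mul) T
      (Xi.mk f OrderHom.id x)) =
      elt M (w.comp (fiberIncl f 0)) (x 0) * elt M (w.comp (fiberIncl f 1)) (x 1) *
        elt M (w.comp (fiberIncl f 2)) (x 2) := by
  have h1 := compAt_reindex_map_Lambda_map leftEquiv (W := triple X X X) (Z := leftFamily X X X)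
    (V := pair (box X X) X) (leftHomInv X X X) (pairHom (X := fun i => Xi (leftFamily X X X i))
      (Y := pair (box X X) X) (𝟙 (box X X)) (Xi.eps (Fin 1) X)) f x
  have h2 := congrArg (fun z => elt M w (compAt M.mul T z))
    ((congrArg (compAt (boxHom M.mul (𝟙 X)) T) h1).trans (Xi.map_mk _ _ _ _))
  refine (h2.trans (elt_mul hw _ _)).trans ?_
  refine congrArg₂ (· * ·) ?_ ?_
  · refine (elt_mul (M := M) (injective_comp_fiberIncl hw _ _) _ _).trans
      (congrArg₂ (· * ·) ?_ ?_)
    · exact elt_fiber w f leftEquiv 0 (0 : Fin 2) (x 0)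
    · exact elt_fiber w f leftEquiv 0 (1 : Fin 2) (x 1)
  · refine (congrArg (elt M _) (Xi.eps_mk (Fin 1) X _ _ _)).trans ?_
    refine (elt_ap _ (fiberIncl_surjective (K := Fin 1) _ _) _).trans ?_
    exact elt_fiber w f leftEquiv 1 (0 : Fin 1) (x 2)

theorem rightTriple_eq (X : AugCosimp) : rightTriple X X X =
    Xi.reindex rightEquiv (triple X X X) ≫ Xi.map (rightHom X X X) ≫ Lambda (rightFamily X X X) ≫
      Xi.map (pairHom (X := fun i => Xi (rightFamily X X X i)) (Y := pair X (box X X))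
        (Xi.eps (Fin 1) X) (𝟙 (box X X))) := rfl

theorem elt_rightTriple {T : FinLinOrd} {w : T →o Ω} (hw : Function.Injective w) (f : T → Fin 3)
    (x : ∀ i, (triple X X X i).obj (fiber f i)) :
    elt M w (compAt (rightTriple X X X ≫ boxHom (𝟙 X) M.mul ≫ M.mul) T
      (Xi.mk f OrderHom.id x)) =
      elt M (w.comp (fiberIncl f 0)) (x 0) * (elt M (w.comp (fiberIncl f 1)) (x 1) *
        elt M (w.comp (fiberIncl f 2)) (x 2)) := by
  have h1 := compAt_reindex_map_Lambda_map rightEquiv (W := triple X X X) (Z := rightFamily X X X)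
    (V := pair X (box X X)) (rightHom X X X) (pairHom (X := fun i => Xi (rightFamily X X X i))
      (Y := pair X (box X X)) (Xi.eps (Fin 1) X) (𝟙 (box X X))) f x
  have h2 := congrArg (fun z => elt M w (compAt M.mul T z))
    ((congrArg (compAt (boxHom (𝟙 X) M.mul) T) h1).trans (Xi.map_mk _ _ _ _))
  refine (congrArg (fun φ => elt M w (compAt M.mul T (compAt (boxHom (𝟙 X) M.mul) T
    (compAt φ T (Xi.mk f OrderHom.id x))))) (rightTriple_eq X)).trans ?_
  refine (h2.trans (elt_mul hw _ _)).trans ?_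
  refine congrArg₂ (· * ·) ?_ ?_
  · refine (congrArg (elt M _) (Xi.eps_mk (Fin 1) X _ _ _)).trans ?_
    refine (elt_ap _ (fiberIncl_surjective (K := Fin 1) _ _) _).trans ?_
    exact elt_fiber w f rightEquiv 0 (0 : Fin 1) (x 0)
  · refine (elt_mul (M := M) (injective_comp_fiberIncl hw _ _) _ _).trans
      (congrArg₂ (· * ·) ?_ ?_)
    · exact elt_fiber w f rightEquiv 1 (0 : Fin 2) (x 1)
    · exact elt_fiber w f rightEquiv 1 (1 : Fin 2) (x 2)

/-- For pairwise disjoint subsets this is the associativity of `M` on a common `T` with labels in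
`Fin 3`; in all other cases both sides are `none`. -/
theorem Piece.mul_assoc (a b c : Piece M Ω) : a * b * c = a * (b * c) := by
  rcases a with _ | p
  · rfl
  rcases b with _ | q
  · rfl
  rcases c with _ | r
  · rw [Piece.mul_none, Piece.mul_none, Piece.mul_none]
  by_cases h₁ : Disjoint p.1 q.1
  · by_cases h₂ : Disjoint q.1 r.1
    · by_cases h₃ : Disjoint p.1 r.1
      · obtain ⟨T, w, hw, f, x, hx⟩ := exists_elt_eq (M := M)
          (fun i : Fin 3 => match i with
            | 0 => p
            | 1 => q
            | 2 => r) (by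
            intro i j hij
            match i, j with
            | 0, 0 => exact absurd rfl hij
            | 0, 1 => exact h₁
            | 0, 2 => exact h₃
            | 1, 0 => exact h₁.symm
            | 1, 1 => exact absurd rfl hij
            | 1, 2 => exact h₂
            | 2, 0 => exact h₃.symm
            | 2, 1 => exact h₂.symm
            | 2, 2 => exact absurd rfl hij)
        have h0 : Piece.of p = elt M (w.comp (fiberIncl f 0)) (x 0) := hx 0
        have h1 : Piece.of q = elt M (w.comp (fiberIncl f 1)) (x 1) := hx 1
        have h2 : Piece.of r = elt M (w.comp (fiberIncl f 2)) (x 2) := hx 2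
        let y : ∀ i, (triple X X X i).obj (fiber f i)
          | 0 => x 0
          | 1 => x 1
          | 2 => x 2
        have h3 := congrArg (fun φ => elt M w (compAt φ T (Xi.mk f OrderHom.id y)))
          ((box_assoc_iff M.mul).1 M.mul_assoc)
        rw [h0, h1, h2]
        exact (elt_leftTripleInv hw f y).symm.trans (h3.trans (elt_rightTriple hw f y))
      · rw [Piece.of_mul_of h₁, Piece.of_mul_of h₂,
          Piece.of_mul_of_of_not_disjoint fun h => h₃ (Set.disjoint_union_left.1 h).1,
          Piece.of_mul_of_of_not_disjoint fun h => h₃ (Set.disjoint_union_right.1 h).2]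
    · rw [Piece.of_mul_of h₁, Piece.of_mul_of_of_not_disjoint h₂, Piece.mul_none,
        Piece.of_mul_of_of_not_disjoint fun h => h₂ (Set.disjoint_union_left.1 h).2]
  · rw [Piece.of_mul_of_of_not_disjoint h₁, Piece.none_mul]
    by_cases h₂ : Disjoint q.1 r.1
    · rw [Piece.of_mul_of h₂,
        Piece.of_mul_of_of_not_disjoint fun h => h₁ (Set.disjoint_union_right.1 h).1]
    · rw [Piece.of_mul_of_of_not_disjoint h₂, Piece.mul_none]

instance : CommMonoid (Piece M Ω) where
  mul_assoc := Piece.mul_assoc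
  one_mul := Piece.one_mul
  mul_one a := (Piece.mul_comm a 1).trans (Piece.one_mul a)
  mul_comm := Piece.mul_comm

end PieceMonoid


/-! ### Iterated products -/

section IteratedProduct

variable {X : AugCosimp} (M : CommBoxMonoid X)

/-- The map `φ : Ξ_K(X, …, X) → X` is the iterated product of the commutative monoid `M`. -/
structure IsIteratedProduct (K : Type) [Fintype K] (φ : Xi (fun _ : K => X) ⟶ X) : Prop where
  elt_eq : ∀ {Ω T : FinLinOrd} (w : T →o Ω), Function.Injective w → ∀ (f : T → K)
    (x : ∀ i, X.obj (fiber f i)),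
    elt M w (compAt φ T (Xi.mk (X := fun _ : K => X) f OrderHom.id x)) =
      ∏ i, elt M (w.comp (fiberIncl f i)) (x i)

variable {M}

namespace IsIteratedProduct

/-- With `Ω = T` and the identity embedding, `elt` is injective, so the product of the pieces
determines the value of the map. -/
theorem unique {K : Type} [Fintype K] {φ ψ : Xi (fun _ : K => X) ⟶ X}
    (hφ : IsIteratedProduct M K φ) (hψ : IsIteratedProduct M K ψ) : φ = ψ :=
  Xi.hom_ext fun T f x => elt_injective (M := M) (u := (OrderHom.id : T →o T))
    Function.injective_id ((hφ.elt_eq OrderHom.id Function.injective_id f x).trans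
      (hψ.elt_eq OrderHom.id Function.injective_id f x).symm)

theorem eps (K : Type) [Fintype K] [Unique K] : IsIteratedProduct M K (Xi.eps K X) := by
  refine ⟨fun {Ω T} w hw f x => ?_⟩
  rw [Xi.eps_mk, Fintype.prod_unique]
  exact elt_ap w (fiberIncl_surjective f _) _

theorem reindex {K L : Type} [Fintype K] [Fintype L] (e : K ≃ L) {φ : Xi (fun _ : L => X) ⟶ X}
    (hφ : IsIteratedProduct M L φ) : IsIteratedProduct M K (Xi.reindex e (fun _ => X) ≫ φ) := by
  refine ⟨fun {Ω T} w hw f x => ?_⟩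
  rw [compAt_comp, Xi.reindex_mk]
  refine (hφ.elt_eq w hw _ _).trans ?_
  rw [← e.symm.prod_comp]
  exact Finset.prod_congr rfl fun l _ => elt_ap _ (reindexFiber_surjective e f l) _

/-- A finite product over a disjoint union is a product of products; this carries the associativity
of `Ξ`-algebras. -/
theorem sigma {K : Type} [Fintype K] {J : K → Type} [∀ i, Fintype (J i)]
    {φ : Xi (fun _ : K => X) ⟶ X} (hφ : IsIteratedProduct M K φ)
    {ψ : ∀ i, Xi (fun _ : J i => X) ⟶ X} (hψ : ∀ i, IsIteratedProduct M (J i) (ψ i)) :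
    IsIteratedProduct M (Σ i, J i) (Lambda (fun i (_ : J i) => X) ≫ Xi.map ψ ≫ φ) := by
  refine ⟨fun {Ω T} w hw f x => ?_⟩
  rw [compAt_comp, compAt_comp, Lambda_mk, Xi.map_mk]
  refine (hφ.elt_eq w hw _ _).trans ?_
  rw [Fintype.prod_sigma]
  refine Finset.prod_congr rfl fun i _ => ?_
  refine ((hψ i).elt_eq _ (injective_comp_fiberIncl hw _ _) _ _).trans ?_
  exact Finset.prod_congr rfl fun j _ => elt_ap _ (sigmaIncl_surjective f i j) _

theorem one {φ : Xi (fun _ : Fin 0 => X) ⟶ X}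
    (hφ : M.one = Xi.map (Y := fun _ : Fin 0 => X) (fun i => i.elim0) ≫ φ) :
    IsIteratedProduct M (Fin 0) φ := by
  refine ⟨fun {Ω T} w hw f x => ?_⟩
  have : IsEmpty T := ⟨fun t => (f t).elim0⟩
  rw [Fintype.prod_empty, ← elt_unitPoint w (unitPoint T), hφ]
  exact congrArg (fun z => elt M w (compAt φ T z)) (Xi.eq_of_isEmpty (K := Fin 0) _ _)

theorem mul {φ : Xi (fun _ : Fin 2 => X) ⟶ X}
    (hφ : M.mul = Xi.map (pairHom (X := pair X X) (Y := fun _ => X) (𝟙 X) (𝟙 X)) ≫ φ) :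
    IsIteratedProduct M (Fin 2) φ := by
  refine ⟨fun {Ω T} w hw f x => ?_⟩
  let y : ∀ i, (pair X X i).obj (fiber f i)
    | 0 => x 0
    | 1 => x 1
  have h1 := congrArg (fun ψ => elt M w (compAt ψ T (Xi.mk f OrderHom.id y))) hφ
  have h2 : compAt (Xi.map (pairHom (X := pair X X) (Y := fun _ => X) (𝟙 X) (𝟙 X))) T
      (Xi.mk f OrderHom.id y) = Xi.mk f OrderHom.id x := by
    refine (Xi.map_mk _ _ _ _).trans (congrArg (Xi.mk _ _) (funext fun i => ?_))
    match i with
    | 0 => rfl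
    | 1 => rfl
  rw [Fin.prod_univ_two]
  exact (congrArg (fun z => elt M w (compAt φ T z)) h2).symm.trans
    (h1.symm.trans (elt_mul hw f y))

end IsIteratedProduct

end IteratedProduct

/-! ### The `Ξ`-algebra of a commutative monoid -/

section OfMonoid

variable {X : AugCosimp} (M : CommBoxMonoid X)

/-- The arities `(1, n)`. -/
def succArity (n : ℕ) : Fin 2 → ℕ
  | 0 => 1
  | 1 => n

/-- A bijection `{1, …, n + 1} → {1} ∐ {1, …, n}`. -/
def succEquiv (n : ℕ) : Fin (n + 1) ≃ Σ i, Fin (succArity n i) :=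
  (finCongr (by rw [Fin.sum_univ_two]; exact Nat.add_comm n 1)).trans
    (finSigmaFinEquiv (n := succArity n)).symm

/-- The unit of `M` as a map defined on `Ξ_0` of the empty constant family. -/
def CommBoxMonoid.nullary : Xi (fun _ : Fin 0 => X) ⟶ X :=
  Xi.map (Y := (Fin.elim0 : Fin 0 → AugCosimp)) (fun i => i.elim0) ≫ M.one

/-- The product of `M` as a map defined on `Ξ_2` of a constant family. -/
def CommBoxMonoid.binary : Xi (fun _ : Fin 2 => X) ⟶ X :=
  Xi.map (pairHom (X := fun _ => X) (Y := pair X X) (𝟙 X) (𝟙 X)) ≫ M.mul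

theorem CommBoxMonoid.one_eq :
    M.one = Xi.map (Y := fun _ : Fin 0 => X) (fun i => i.elim0) ≫ M.nullary :=
  hom_ext fun S _ => congrArg (compAt M.one S) (Xi.eq_of_isEmpty (K := Fin 0) _ _)

theorem CommBoxMonoid.mul_eq :
    M.mul = Xi.map (pairHom (X := pair X X) (Y := fun _ => X) (𝟙 X) (𝟙 X)) ≫ M.binary := by
  have h : Xi.map (pairHom (X := pair X X) (Y := fun _ => X) (𝟙 X) (𝟙 X)) ≫
      Xi.map (pairHom (X := fun _ => X) (Y := pair X X) (𝟙 X) (𝟙 X)) = 𝟙 (box X X) := by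
    refine (Xi.map_comp _ _).symm.trans (Eq.trans (congrArg Xi.map (funext fun i => ?_))
      (Xi.map_id (pair X X)))
    match i with
    | 0 => exact Category.comp_id _
    | 1 => exact Category.comp_id _
  exact Eq.symm ((Category.assoc _ _ _).symm.trans
    ((congrArg (· ≫ M.mul) h).trans (Category.id_comp _)))

theorem exists_isIteratedProduct (n : ℕ) :
    ∃ φ : Xi (fun _ : Fin n => X) ⟶ X, IsIteratedProduct M (Fin n) φ := by
  induction n with
  | zero => exact ⟨M.nullary, .one M.one_eq⟩
  | succ n ih =>
    obtain ⟨φ, hφ⟩ := ih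
    let ψ : ∀ i, Xi (fun _ : Fin (succArity n i) => X) ⟶ X
      | 0 => Xi.eps (Fin 1) X
      | 1 => φ
    have hψ : ∀ i, IsIteratedProduct M (Fin (succArity n i)) (ψ i)
      | 0 => .eps (Fin 1)
      | 1 => hφ
    -- One factor is split off, and the binary product multiplies it with the `n`-fold product of
    -- the others. Which bijection numbers them is irrelevant, since products of pieces are
    -- commutative.
    exact ⟨_, ((IsIteratedProduct.mul M.mul_eq).sigma hψ).reindex (succEquiv n)⟩

/-- Associativity in arities `(1, n)` expresses the action of arity `n + 1` through those of arities
`2`, `1` and `n`, so the nullary and binary actions determine all others. -/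
theorem XiAlgebra.RestrictsTo.isIteratedProduct {A : XiAlgebra X} {M : CommBoxMonoid X}
    (h : A.RestrictsTo M) (n : ℕ) : IsIteratedProduct M (Fin n) (A.act n) := by
  induction n with
  | zero => exact .one h.1
  | succ n ih =>
    have hψ : ∀ i, IsIteratedProduct M (Fin (succArity n i)) (A.act (succArity n i))
      | 0 => A.act_one_eq_eps ▸ .eps (Fin 1)
      | 1 => ih
    have h1 := ((IsIteratedProduct.mul h.2).sigma hψ).reindex (succEquiv n)
    rw [A.Lambda_map_act (succArity n) (succEquiv n).symm] at h1
    refine Eq.mp (congrArg (IsIteratedProduct M (Fin (n + 1))) ?_) h1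
    exact (Category.assoc _ _ _).symm.trans ((congrArg (· ≫ A.act (n + 1))
      (Xi.reindex_symm_const (succEquiv n) X)).trans (Category.id_comp _))

/-- The `Ξ`-algebra of a commutative monoid: its structure maps are the iterated products. -/
def CommBoxMonoid.toXiAlgebra : XiAlgebra X where
  act n := (exists_isIteratedProduct M n).choose
  unit := by
    rw [(exists_isIteratedProduct M 1).choose_spec.unique (.eps (Fin 1))]
    exact Xi.iota_eps _ _
  assoc {k} j := by
    refine Eq.trans ?_ (Category.assoc _ _ _).symm
    -- After `Γ` is replaced by `Λ`, both sides are iterated products over `Σ i, Fin (j i)`, and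
    -- there is only one such map.
    refine eq_Gamma_comp_iff.2 (IsIteratedProduct.unique (M := M) (.sigma ?_ fun i => ?_)
      (.reindex _ ?_)) <;> exact (exists_isIteratedProduct M _).choose_spec
  equivariant {k} σ := IsIteratedProduct.unique (M := M)
    (.reindex σ (exists_isIteratedProduct M k).choose_spec)
    (exists_isIteratedProduct M k).choose_spec

theorem CommBoxMonoid.toXiAlgebra_act (n : ℕ) : IsIteratedProduct M (Fin n) (M.toXiAlgebra.act n) :=
  (exists_isIteratedProduct M n).choose_spec

theorem CommBoxMonoid.toXiAlgebra_restrictsTo : M.toXiAlgebra.RestrictsTo M := by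
  constructor
  · rw [(M.toXiAlgebra_act 0).unique (.one M.one_eq)]
    exact M.one_eq
  · rw [(M.toXiAlgebra_act 2).unique (.mul M.mul_eq)]
    exact M.mul_eq

theorem existsUnique_restrictsTo : ∃! A : XiAlgebra X, A.RestrictsTo M :=
  ⟨M.toXiAlgebra, M.toXiAlgebra_restrictsTo, fun _ hA => XiAlgebra.ext (funext fun n =>
    (hA.isIteratedProduct n).unique (M.toXiAlgebra_act n))⟩

end OfMonoid

end CosimpOperad

end

theorem theorem4p5 :
    CosimpOperad.D.IsEInfty ∧
    ∀ X : CosimpOperad.AugCosimp,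
      (∀ A : CosimpOperad.XiAlgebra X, CosimpOperad.D.IsAction A.totAction) ∧
      (∀ A : CosimpOperad.XiAlgebra X, ∃ M : CosimpOperad.CommBoxMonoid X, A.RestrictsTo M) ∧
      (∀ M : CosimpOperad.CommBoxMonoid X, ∃! A : CosimpOperad.XiAlgebra X, A.RestrictsTo M) :=
  ⟨CosimpOperad.D_isEInfty, fun _ => ⟨fun A => A.isAction,
    fun A => ⟨A.toCommBoxMonoid, A.restrictsTo_toCommBoxMonoid⟩,
    fun M => CosimpOperad.existsUnique_restrictsTo M⟩⟩
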